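/- Let $A$ be an abelian von Neumann algebra with a faithful normal semifinite weight $\Phi$. Let $M$ be a finite von Neumann algebra with a faithful normal trace $\tau$, $\tau(1)=1$, represented standardly on $L^2(M,\tau)$, where $\xi$ denotes the vector corresponding to $1\in M$. Let $B\subseteq M$ be a von Neumann subalgebra with the same unit such that $B'\cap M\subseteq B$. Let $e_B$ be the orthogonal projection of $L^2(M,\tau)$ onto $L^2(B)=\overline{B\xi}$, let $\langle M,e_B\rangle=(M\cup\{e_B\})''$ be the basic construction, and let $\mathrm{Tr}$ be its canonical trace, that is, the unique faithful normal semifinite trace on $\langle M,e_B\rangle$ with $\mathrm{Tr}(xe_By)=\tau(xy)$ for all $x,y\in M$. Let $q$ be a projection in the von Neumann algebra tensor product $A\,\overline{\otimes}\,B$, and let $P$ be a nonzero projection in $$\bigl(A\,\overline{\otimes}\,(B'\cap\langle M,e_B\rangle)\bigr)q=\{Tq: T\in A\,\overline{\otimes}\,(B'\cap\langle M,e_B\rangle)\}.$$ Suppose that $P\precsim 1\otimes e_B$ in $A\,\overline{\otimes}\,\langle M,e_B\rangle$ (Murray--von Neumann subequivalence), and that $$(\Phi\otimes\mathrm{Tr})(Pr)\le(\Phi\otimes\tau)(qr)$$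 for every projection $r$ in the center $Z\bigl(q(A\,\overline{\otimes}\,B)q\bigr)$. Then there is an intertwiner $v$ of $A\,\overline{\otimes}\,B$ in $A\,\overline{\otimes}\,M$, that is, a partial isometry $v\in A\,\overline{\otimes}\,M$ with $v(A\,\overline{\otimes}\,B)v^*\subseteq A\,\overline{\otimes}\,B$ and $v^*v\in A\,\overline{\otimes}\,B$, such that $$P=v^*(1\otimes e_B)v.$$ -/

import Mathlib

open scoped TensorProduct ENNReal NNReal InnerProductSpace

noncomputable section

namespace GroupoidNormalizers

section SingleSpace

variable {H : Type*} [NormedAddCommGroup H] [InnerProductSpace ℂ H] [CompleteSpace H]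

/-- The von Neumann algebra generated by a set of operators, i.e. the double commutant of the set
together with its adjoints. -/
def vnGenerated (S : Set (H →L[ℂ] H)) : VonNeumannAlgebra H where
  toStarSubalgebra :=
    StarSubalgebra.centralizer ℂ (StarSubalgebra.centralizer ℂ S : Set (H →L[ℂ] H))
  centralizer_centralizer' := by
    change Set.centralizer (Set.centralizer
      ((StarSubalgebra.centralizer ℂ (StarSubalgebra.centralizer ℂ S : Set (H →L[ℂ] H)) :
        StarSubalgebra ℂ (H →L[ℂ] H)) : Set (H →L[ℂ] H))) =
      ((StarSubalgebra.centralizer ℂ (StarSubalgebra.centralizer ℂ S : Set (H →L[ℂ] H)) :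
        StarSubalgebra ℂ (H →L[ℂ] H)) : Set (H →L[ℂ] H))
    rw [StarSubalgebra.coe_centralizer_centralizer, Set.centralizer_centralizer_centralizer]

/-- The intersection of two von Neumann algebras on the same Hilbert space. -/
def vnInter (N₁ N₂ : VonNeumannAlgebra H) : VonNeumannAlgebra H where
  toStarSubalgebra := N₁.toStarSubalgebra ⊓ N₂.toStarSubalgebra
  centralizer_centralizer' := by
    change Set.centralizer (Set.centralizer ((N₁ : Set (H →L[ℂ] H)) ∩ N₂)) =
      (N₁ : Set (H →L[ℂ] H)) ∩ N₂
    apply Set.Subset.antisymm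
    · apply Set.subset_inter
      · conv_rhs => rw [← N₁.centralizer_centralizer]
        exact Set.centralizer_subset (Set.centralizer_subset Set.inter_subset_left)
      · conv_rhs => rw [← N₂.centralizer_centralizer]
        exact Set.centralizer_subset (Set.centralizer_subset Set.inter_subset_right)
    · exact Set.subset_centralizer_centralizer

/-- The relative commutant `B' ∩ N`. -/
def relCommutant (B N : VonNeumannAlgebra H) : VonNeumannAlgebra H :=
  vnInter B.commutant N

/-- The positive cone of a von Neumann algebra. -/
def positivePart (N : VonNeumannAlgebra H) : Set (H →L[ℂ] H) :=
  {x | x ∈ N ∧ 0 ≤ x}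

/-- The corner `q N q`. -/
def corner (q : H →L[ℂ] H) (N : VonNeumannAlgebra H) : Set (H →L[ℂ] H) :=
  {y | ∃ x ∈ N, y = q * x * q}

/-- The center of a set of operators: the elements of the set commuting with the whole set. -/
def centerOf (S : Set (H →L[ℂ] H)) : Set (H →L[ℂ] H) :=
  S ∩ Set.centralizer S

/-- Murray-von Neumann subequivalence of projections in `N`: `p` is the initial projection of an
element of `N` whose final projection lies below `e`. -/
def SubEquivalent (N : VonNeumannAlgebra H) (p e : H →L[ℂ] H) : Prop :=
  ∃ v ∈ N, star v * v = p ∧ v * star v ≤ e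

/-- The intertwiners of `B` in `M`: the partial isometries `v ∈ M` with `v B v* ⊆ B` and
`v* v ∈ B`. -/
def intertwiners (M B : VonNeumannAlgebra H) : Set (H →L[ℂ] H) :=
  {v | v ∈ M ∧ v * star v * v = v ∧ (∀ b ∈ B, v * b * star v ∈ B) ∧ star v * v ∈ B}

/-- `M` is a finite von Neumann algebra with faithful normal tracial state
`τ(x) = ⟪ξ, x ξ⟫`, represented standardly: the space `H` is `L²(M, τ)` and `ξ` is the vector
corresponding to `1 ∈ M`. -/
structure IsStandardTracial (M : VonNeumannAlgebra H) (ξ : H) : Prop where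
  norm_eq_one : ‖ξ‖ = 1
  cyclic : Dense {η : H | ∃ x ∈ M, η = x ξ}
  tracial : ∀ x ∈ M, ∀ y ∈ M, ⟪ξ, (x * y) ξ⟫_ℂ = ⟪ξ, (y * x) ξ⟫_ℂ
  faithful : ∀ x ∈ M, ⟪ξ, (star x * x) ξ⟫_ℂ = 0 → x = 0

/-- The vector functional `x ↦ ⟪ξ, x ξ⟫` on positive operators, with values in `[0, ∞]`. -/
def vectorWeight (ξ : H) (x : H →L[ℂ] H) : ℝ≥0∞ :=
  ENNReal.ofReal (RCLike.re ⟪ξ, x ξ⟫_ℂ)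

/-- `φ` is a faithful normal semifinite weight on the abelian von Neumann algebra `N`. Only the
values of `φ` on the positive cone of `N` matter. (On an abelian algebra every weight is a trace,
and semifiniteness is stated in the form customary for traces.) -/
structure IsFNSWeight (N : VonNeumannAlgebra H) (φ : (H →L[ℂ] H) → ℝ≥0∞) : Prop where
  add : ∀ x ∈ positivePart N, ∀ y ∈ positivePart N, φ (x + y) = φ x + φ y
  smul : ∀ (c : ℝ≥0), ∀ x ∈ positivePart N, φ (((c : ℝ) : ℂ) • x) = c * φ x
  faithful : ∀ x ∈ positivePart N, φ x = 0 → x = 0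
  /-- The weight preserves suprema of bounded increasing nets. -/
  normal : ∀ D : Set (H →L[ℂ] H), D ⊆ positivePart N → D.Nonempty → DirectedOn (· ≤ ·) D →
    ∀ x ∈ N, IsLUB D x → φ x = ⨆ y ∈ D, φ y
  semifinite : ∀ x ∈ positivePart N, x ≠ 0 → ∃ y ∈ positivePart N, y ≤ x ∧ y ≠ 0 ∧ φ y < ∞

/-- The closed subspace `L²(B) = closure (B ξ)` of `H`. -/
def ltwo (B : VonNeumannAlgebra H) (ξ : H) : Submodule ℂ H :=
  (B.toStarSubalgebra.toSubalgebra.toSubmodule.map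
    (ContinuousLinearMap.apply ℂ H ξ).toLinearMap).topologicalClosure

instance ltwoCompleteSpace (B : VonNeumannAlgebra H) (ξ : H) : CompleteSpace (ltwo B ξ) :=
  inferInstanceAs (CompleteSpace (Submodule.topologicalClosure _))

/-- The Jones projection `e_B`, the orthogonal projection of `H` onto `L²(B)`. -/
def jonesProjection (B : VonNeumannAlgebra H) (ξ : H) : H →L[ℂ] H :=
  (ltwo B ξ).starProjection

/-- The basic construction `⟨M, e_B⟩`. -/
def basicConstruction (M B : VonNeumannAlgebra H) (ξ : H) : VonNeumannAlgebra H :=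
  vnGenerated ((M : Set (H →L[ℂ] H)) ∪ {jonesProjection B ξ})

/-- The canonical trace `Tr` on the positive cone of `⟨M, e_B⟩`, i.e. the faithful normal semifinite
trace with `Tr(x e_B y) = τ(x y)`. It is given by `Tr(t) = ∑ᵢ ⟪vᵢ* ξ, t vᵢ* ξ⟫` for any
`vᵢ ∈ ⟨M, e_B⟩` with `∑ᵢ vᵢ* e_B vᵢ = 1`, the `i`-th term being `Tr(e_B vᵢ t vᵢ* e_B)`. As `Tr` is
normal and tracial, this is the supremum of the same sums over all finite families with
`∑ᵢ vᵢ* e_B vᵢ ≤ 1`, which involves no choice. -/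
def canonicalTrace (M B : VonNeumannAlgebra H) (ξ : H) (t : H →L[ℂ] H) : ℝ≥0∞ :=
  ⨆ (n : ℕ) (v : Fin n → (H →L[ℂ] H)) (_ : ∀ i, v i ∈ basicConstruction M B ξ)
    (_ : ∑ i, star (v i) * jonesProjection B ξ * v i ≤ 1),
    ∑ i, vectorWeight (star (v i) ξ) t

/-- The finite family `ζ` of vectors defines a normal positive functional `∑ᵢ ⟪ζᵢ, · ζᵢ⟫` on `N`
which is dominated by the weight `φ`. -/
def IsSubordinate (N : VonNeumannAlgebra H) (φ : (H →L[ℂ] H) → ℝ≥0∞) {n : ℕ}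
    (ζ : Fin n → H) : Prop :=
  ∀ x ∈ positivePart N, ∑ i, vectorWeight (ζ i) x ≤ φ x

end SingleSpace

section Tensor

variable {K H : Type*} [NormedAddCommGroup K] [InnerProductSpace ℂ K]
  [NormedAddCommGroup H] [InnerProductSpace ℂ H]

/-- The Hilbert space tensor product of `K` and `H`. -/
abbrev HilbertTensor (K H : Type*) [NormedAddCommGroup K] [InnerProductSpace ℂ K]
    [NormedAddCommGroup H] [InnerProductSpace ℂ H] : Type _ :=
  UniformSpace.Completion (K ⊗[ℂ] H)

/-- The elementary tensor of two vectors. -/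
def vecTensor (ζ : K) (η : H) : HilbertTensor K H :=
  ((ζ ⊗ₜ[ℂ] η : K ⊗[ℂ] H) : UniformSpace.Completion (K ⊗[ℂ] H))

/-- The elementary tensor `a ⊗ b` of two bounded operators. -/
def opTensor (a : K →L[ℂ] K) (b : H →L[ℂ] H) : HilbertTensor K H →L[ℂ] HilbertTensor K H :=
  (TensorProduct.mapL a b).completion

variable [CompleteSpace K] [CompleteSpace H]

/-- The von Neumann algebra tensor product. -/
def vnTensor (N₁ : VonNeumannAlgebra K) (N₂ : VonNeumannAlgebra H) :
    VonNeumannAlgebra (HilbertTensor K H) :=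
  vnGenerated {x | ∃ a ∈ N₁, ∃ b ∈ N₂, x = opTensor a b}

/-- The tensor product `φ ⊗ ψ` of two normal semifinite traces, on the positive cone of
`N₁ ⊗ N₂`: the supremum of the functionals `ω ⊗ ρ`, where `ω ≤ φ` and `ρ ≤ ψ` are finite sums of
vector functionals. (Normal traces are sums of vector functionals; for `φ = ∑ᵢ ωᵢ` and
`ψ = ∑ⱼ ρⱼ` this is `∑ᵢⱼ ωᵢ ⊗ ρⱼ`, the unique normal semifinite trace with
`(φ ⊗ ψ)(a ⊗ b) = φ(a) ψ(b)`.) -/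
def weightTensor (N₁ : VonNeumannAlgebra K) (φ : (K →L[ℂ] K) → ℝ≥0∞)
    (N₂ : VonNeumannAlgebra H) (ψ : (H →L[ℂ] H) → ℝ≥0∞)
    (x : HilbertTensor K H →L[ℂ] HilbertTensor K H) : ℝ≥0∞ :=
  ⨆ (m : ℕ) (n : ℕ) (ζ : Fin m → K) (η : Fin n → H) (_ : IsSubordinate N₁ φ ζ)
    (_ : IsSubordinate N₂ ψ η), ∑ i, ∑ j, vectorWeight (vecTensor (ζ i) (η j)) x

end Tensor

end GroupoidNormalizers

end

open GroupoidNormalizers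

namespace GroupoidNormalizers

set_option linter.unusedSectionVars false

open Filter Topology

/-! ### Extension of operators from families of vectors, and commutants of corners -/

section Operators

variable {𝓗 : Type*} [NormedAddCommGroup 𝓗] [InnerProductSpace ℂ 𝓗] [CompleteSpace 𝓗]

/-! Write `E = 1 ⊗ e_B` and `Ω = ζ ⊗ ξ`, with `ζ` arbitrary in `K`. Subequivalence gives `V` in `A ⊗
⟨M, e_B⟩` with `V* V = P` and `E V = V`. If `V* = D E` with `D ∈ A ⊗ M`, then `V = E D*` and `P = D
E D*`, so `D*` is the candidate intertwiner. The core of the proof is that `D` exists as a bounded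
operator, which amounts to the domination `‖y V* Ω‖ ≤ ‖y Ω‖` for all `y ∈ A ⊗ M` and all `ζ`.

Domination on central projections. The compression `E (A ⊗ ⟨M, e_B⟩) E = (A ⊗ B) E`
(`exists_vnTensor_compression_eq`) and the traciality of the functional of `Ω` on `A ⊗ M` give a
lower bound for `(Φ ⊗ Tr)(W* W)` by sums of `‖W* Ω‖²` when `E W = W`
(`sum_norm_sq_le_weightTensor`). Taking `W = V r`, with `r` a projection in the center of `q (A ⊗ B)
q`, and cutting `r` by all projections of `A`, the hypothesis on weights becomes an inequality
between two positive elements of `A`, hence `‖r V* Ω‖ ≤ ‖r Ω‖` (`norm_sq_le_of_weightTensor_le`).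

Domination on `A ⊗ M`. The functionals of `Ω` and of `V* Ω` are both invariant under the unitaries
of `A ⊗ B` that commute with `q`: the first by traciality, the second because `P` commutes with
these unitaries, so that `V` intertwines them with elements of `A ⊗ B` (`IsImplementer.inner_conj`).
Averaging `(y q)* (y q)` over this group (`exists_average`) gives an element commuting with `q (A ⊗
B) q`. The hypothesis `B' ∩ M ⊆ B` places it in the center of that corner, where projections suffice
(`IsImplementer.norm_apply_le`).

Construction of the intertwiner. `D (ζ ⊗ m ξ) = (1 ⊗ R_m) V* (ζ ⊗ ξ)`, with `R_m` the right
multiplication by `m`, defines a contraction of `A ⊗ M` (`exists_pullDown`). Its initial projection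
`g` lies in `A ⊗ B` and satisfies `g E = V V*`. If `θ(y) E = V y V*` for `y` in the corner, then `y
D = D θ(y)`. Hence `D D*` commutes with the corner, so it is in `A ⊗ B` by the same relative
commutant argument, and `D* b D = g θ(q b q)` (`IsImplementer.exists_intertwiner`).

As `A` is abelian, no modular theory is needed: an element of `A ⊗ N` is a weak limit of a bounded
net of algebraic tensors built from partitions of unity in `A` (`exists_algebraic_approximant`).
This yields the commutation theorem `mem_vnTensor` and reduces weakly continuous identities to
elementary tensors. -/

theorem inner_star_left (T : 𝓗 →L[ℂ] 𝓗) (x y : 𝓗) : ⟪star T x, y⟫_ℂ = ⟪x, T y⟫_ℂ := by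
  rw [ContinuousLinearMap.star_eq_adjoint, ContinuousLinearMap.adjoint_inner_left]

theorem inner_star_right (T : 𝓗 →L[ℂ] 𝓗) (x y : 𝓗) : ⟪x, star T y⟫_ℂ = ⟪T x, y⟫_ℂ := by
  rw [ContinuousLinearMap.star_eq_adjoint, ContinuousLinearMap.adjoint_inner_right]

theorem smul_mem_vn (S : VonNeumannAlgebra 𝓗) (c : ℂ) {x : 𝓗 →L[ℂ] 𝓗} (hx : x ∈ S) :
    c • x ∈ S :=
  show c • x ∈ S.toStarSubalgebra from S.toStarSubalgebra.smul_mem hx c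

theorem mem_of_forall_commutant {S : VonNeumannAlgebra 𝓗} {x : 𝓗 →L[ℂ] 𝓗}
    (h : ∀ y ∈ S.commutant, y * x = x * y) : x ∈ S := by
  rw [← S.commutant_commutant]
  exact VonNeumannAlgebra.mem_commutant_iff.2 h

theorem vn_isClosed (S : VonNeumannAlgebra 𝓗) : IsClosed (S : Set (𝓗 →L[ℂ] 𝓗)) := by
  rw [← S.centralizer_centralizer]
  exact Set.isClosed_centralizer _

theorem cfc_mem_vn (S : VonNeumannAlgebra 𝓗) {a : 𝓗 →L[ℂ] 𝓗} (ha : a ∈ S)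
    (f : ℝ → ℝ) : cfc f a ∈ S := by
  refine mem_of_forall_commutant fun y hy => ?_
  have hc : Commute a y := VonNeumannAlgebra.mem_commutant_iff.1 hy a ha
  exact (hc.cfc_real f).eq.symm

/-- A map which is bounded on a family of vectors extends to a bounded operator vanishing on
the orthogonal complement of the family. -/
theorem exists_clm_of_norm_sum_le {ι : Type*} (x y : ι → 𝓗) {C : ℝ} (hC : 0 ≤ C)
    (h : ∀ (s : Finset ι) (c : ι → ℂ), ‖∑ i ∈ s, c i • y i‖ ≤ C * ‖∑ i ∈ s, c i • x i‖) :
    ∃ T : 𝓗 →L[ℂ] 𝓗, (∀ i, T (x i) = y i) ∧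
      (∀ z, (∀ i, ⟪x i, z⟫_ℂ = 0) → T z = 0) ∧ ‖T‖ ≤ C := by
  classical
  let X : Submodule ℂ 𝓗 := (Submodule.span ℂ (Set.range x)).topologicalClosure
  have : CompleteSpace X := inferInstanceAs (CompleteSpace (Submodule.topologicalClosure _))
  have hmem : ∀ c : ι →₀ ℂ, Finsupp.linearCombination ℂ x c ∈ X := fun c =>
    Submodule.le_topologicalClosure _ <| by
      rw [← Finsupp.range_linearCombination]; exact ⟨c, rfl⟩
  let e : (ι →₀ ℂ) →ₗ[ℂ] X := (Finsupp.linearCombination ℂ x).codRestrict X hmem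
  let f : (ι →₀ ℂ) →ₗ[ℂ] 𝓗 := Finsupp.linearCombination ℂ y
  have hbound : ∀ c, ‖f c‖ ≤ C * ‖e c‖ := fun c => h c.support c
  have hdense : DenseRange e := by
    intro v
    rw [closure_subtype]
    have hv : (v : 𝓗) ∈ closure (Submodule.span ℂ (Set.range x) : Set 𝓗) := v.2
    convert hv using 2
    ext w
    rw [SetLike.mem_coe, ← Finsupp.range_linearCombination]
    constructor
    · rintro ⟨_, ⟨c, rfl⟩, rfl⟩; exact ⟨c, rfl⟩
    · rintro ⟨c, rfl⟩; exact ⟨e c, ⟨c, rfl⟩, rfl⟩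
  refine ⟨(f.extendOfNorm e).comp X.orthogonalProjectionOnto, fun i => ?_, fun z hz => ?_, ?_⟩
  · have h1 : X.orthogonalProjectionOnto (x i) = e (Finsupp.single i 1) := by
      have hx : x i ∈ X := Submodule.le_topologicalClosure _ (Submodule.subset_span ⟨i, rfl⟩)
      have := Submodule.orthogonalProjectionOnto_mem_subspace_eq_self (K := X) ⟨x i, hx⟩
      rw [this]
      ext
      simp [e]
    rw [ContinuousLinearMap.comp_apply, h1, LinearMap.extendOfNorm_eq hdense ⟨C, hbound⟩]
    simp [f]
  · have : X.orthogonalProjectionOnto z = 0 := by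
      rw [Submodule.orthogonalProjectionOnto_eq_zero_iff]
      rw [show X = (Submodule.span ℂ (Set.range x)).topologicalClosure from rfl,
        Submodule.orthogonal_closure, Submodule.mem_orthogonal]
      intro u hu
      induction hu using Submodule.span_induction with
      | mem u hu => obtain ⟨i, rfl⟩ := hu; exact hz i
      | zero => simp
      | add u v _ _ hu hv => rw [inner_add_left, hu, hv, add_zero]
      | smul c u _ hu => rw [inner_smul_left, hu, mul_zero]
    rw [ContinuousLinearMap.comp_apply, this, map_zero]
  · refine (ContinuousLinearMap.opNorm_comp_le _ _).trans ?_
    calc _ ≤ C * 1 := mul_le_mul (LinearMap.opNorm_extendOfNorm_le hdense hC hbound)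
          (Submodule.orthogonalProjectionOnto_norm_le _) (ContinuousLinearMap.opNorm_nonneg _) hC
      _ = C := mul_one C

/-- An operator agreeing with `0` on the complement of a family and on the family vanishes. -/
theorem eq_zero_of_family {ι : Type*} (x : ι → 𝓗) {T : 𝓗 →L[ℂ] 𝓗} (hx : ∀ i, T (x i) = 0)
    (hz : ∀ z, (∀ i, ⟪x i, z⟫_ℂ = 0) → T z = 0) : T = 0 := by
  let X : Submodule ℂ 𝓗 := (Submodule.span ℂ (Set.range x)).topologicalClosure
  have : CompleteSpace X := inferInstanceAs (CompleteSpace (Submodule.topologicalClosure _))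
  have h1 : X ≤ LinearMap.ker (T : 𝓗 →ₗ[ℂ] 𝓗) := by
    refine Submodule.topologicalClosure_minimal _ ?_ T.isClosed_ker
    rw [Submodule.span_le]
    rintro _ ⟨i, rfl⟩
    exact hx i
  ext v
  have h2 : T (v - X.starProjection v) = 0 := by
    refine hz _ fun i => ?_
    have := Submodule.sub_starProjection_mem_orthogonal (K := X) v
    exact (Submodule.mem_orthogonal _ _).1 this _
      (Submodule.le_topologicalClosure _ (Submodule.subset_span ⟨i, rfl⟩))
  have h3 : T (X.starProjection v) = 0 := h1 (Submodule.starProjection_apply_mem _ _)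
  rw [map_sub, h3, sub_zero] at h2
  simpa using h2

/-- On the orthogonal complement of the family `T` vanishes and `S` maps the complement into itself,
so only the values on the family remain to be compared. -/
theorem commute_of_family {ι : Type*} (x : ι → 𝓗) {T S : 𝓗 →L[ℂ] 𝓗}
    (hz : ∀ z, (∀ i, ⟪x i, z⟫_ℂ = 0) → T z = 0)
    (hS : ∀ i, T (S (x i)) = S (T (x i)))
    (hS' : ∀ z, (∀ i, ⟪x i, z⟫_ℂ = 0) → ∀ i, ⟪x i, S z⟫_ℂ = 0) : T * S = S * T := by
  rw [← sub_eq_zero]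
  refine eq_zero_of_family x (fun i => ?_) fun z hzz => ?_
  · simp [hS i]
  · simp [hz z hzz, hz _ (hS' z hzz)]

theorem exists_sum_four_unitary_mem (S : StarSubalgebra ℂ (𝓗 →L[ℂ] 𝓗))
    (hS : IsClosed (S : Set (𝓗 →L[ℂ] 𝓗))) {x : 𝓗 →L[ℂ] 𝓗} (hx : x ∈ S) :
    ∃ u : Fin 4 → (𝓗 →L[ℂ] 𝓗), ∃ c : Fin 4 → ℂ, x = ∑ i, c i • u i ∧
      ∀ i, u i ∈ S ∧ star (u i) * u i = 1 ∧ u i * star (u i) = 1 := by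
  have := hS
  obtain ⟨u, c, h, -⟩ := CStarAlgebra.exists_sum_four_unitary (⟨x, hx⟩ : S)
  refine ⟨fun i => ((u i : S) : 𝓗 →L[ℂ] 𝓗), c, ?_, fun i => ⟨(u i : S).2, ?_, ?_⟩⟩
  · have := congrArg (Subtype.val) h
    simpa using this
  · have := congrArg (Subtype.val) (Unitary.star_mul_self_of_mem (u i).2)
    exact this
  · have := congrArg (Subtype.val) (Unitary.mul_star_self_of_mem (u i).2)
    exact this

/-- Reduction: an operator in the corner of a projection `q ∈ R` which commutes with `q R q` is of
the form `c' q` with `c' ∈ R'`. -/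
theorem exists_mem_commutant_mul_eq (R : VonNeumannAlgebra 𝓗) {q c : 𝓗 →L[ℂ] 𝓗}
    (hq : IsStarProjection q) (hqR : q ∈ R) (hc : q * c * q = c)
    (hcomm : ∀ x ∈ R, (q * x * q) * c = c * (q * x * q))
    (T : Set (𝓗 →L[ℂ] 𝓗)) (hT : ∀ t ∈ T, t ∈ R.commutant ∧ t * c = c * t ∧ star t ∈ T) :
    ∃ c' ∈ R.commutant, c' * q = c ∧ ∀ t ∈ T, t * c' = c' * t := by
  have hqq : q * q = q := hq.isIdempotentElem
  have hqs : star q = q := hq.isSelfAdjoint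
  -- The conditions on `c` say that it lies in a norm-closed star algebra, so it is a combination of
  -- four unitaries of that algebra, and each of them can be lifted separately.
  let 𝒞 := StarSubalgebra.centralizer ℂ ({y | ∃ x ∈ R, y = q * x * q} ∪ T)
  have h𝒞 : IsClosed (𝒞 : Set (𝓗 →L[ℂ] 𝓗)) := Set.isClosed_centralizer _
  have hc𝒞 : c ∈ 𝒞 := by
    rw [StarSubalgebra.mem_centralizer_iff]
    rintro g (⟨x, hx, rfl⟩ | hg)
    · refine ⟨hcomm x hx, ?_⟩
      have : star (q * x * q) = q * star x * q := by simp [hqs, mul_assoc]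
      rw [this]
      exact hcomm _ (star_mem hx)
    · exact ⟨(hT g hg).2.1, (hT _ (hT g hg).2.2).2.1⟩
  obtain ⟨u, a, hu, hu'⟩ := exists_sum_four_unitary_mem 𝒞 h𝒞 hc𝒞
  suffices H : ∀ u ∈ 𝒞, star u * u = 1 → ∃ u' ∈ R.commutant, u' * q = u * q ∧
      ∀ t ∈ T, t * u' = u' * t by
    choose! f hf1 hf2 hf3 using fun i => H (u i) (hu' i).1 (hu' i).2.1
    refine ⟨∑ i, a i • f i, sum_mem fun i _ => smul_mem_vn _ _ (hf1 i), ?_, fun t ht => ?_⟩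
    · have hcq : c * q = c := by
        conv_lhs => rw [← hc]
        rw [mul_assoc, hqq, hc]
      rw [← hcq, hu, Finset.sum_mul, Finset.sum_mul]
      exact Finset.sum_congr rfl fun i _ => by rw [smul_mul_assoc, smul_mul_assoc, hf2]
    · rw [Finset.mul_sum, Finset.sum_mul]
      exact Finset.sum_congr rfl fun i _ => by rw [smul_mul_assoc, mul_smul_comm, hf3 i t ht]
  intro u hu huu
  rw [StarSubalgebra.mem_centralizer_iff] at hu
  have huR : ∀ x ∈ R, q * x * q * u = u * (q * x * q) := fun x hx => (hu _ (Or.inl ⟨x, hx, rfl⟩)).1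
  have huq : q * u = u * q := by simpa [hqq] using huR 1 (one_mem R)
  -- The lift sends `x q h` to `x q u h`. It preserves inner products because `u` is isometric and
  -- commutes with `q x* x' q`.
  let X : (R × 𝓗) → 𝓗 := fun p => (p.1 : 𝓗 →L[ℂ] 𝓗) (q p.2)
  let Y : (R × 𝓗) → 𝓗 := fun p => (p.1 : 𝓗 →L[ℂ] 𝓗) (q (u p.2))
  have hinner : ∀ p p' : R × 𝓗, ⟪Y p, Y p'⟫_ℂ = ⟪X p, X p'⟫_ℂ := by
    rintro ⟨⟨x, hx⟩, h⟩ ⟨⟨x', hx'⟩, h'⟩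
    have e1 : ∀ k k' : 𝓗, ⟪x (q k), x' (q k')⟫_ℂ = ⟪k, (q * (star x * x') * q) k'⟫_ℂ := by
      intro k k'
      rw [← ContinuousLinearMap.adjoint_inner_right, ← ContinuousLinearMap.adjoint_inner_right,
        ← ContinuousLinearMap.star_eq_adjoint, ← ContinuousLinearMap.star_eq_adjoint, hqs]
      rfl
    change ⟪x (q (u h)), x' (q (u h'))⟫_ℂ = ⟪x (q h), x' (q h')⟫_ℂ
    rw [e1, e1]
    have e2 := huR _ (mul_mem (star_mem hx) hx')
    have e3 : (q * (star x * x') * q) (u h') = u ((q * (star x * x') * q) h') :=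
      DFunLike.congr_fun e2 h'
    rw [e3, ← ContinuousLinearMap.adjoint_inner_right, ← ContinuousLinearMap.star_eq_adjoint]
    have e4 : ∀ k, star u (u k) = k := fun k => DFunLike.congr_fun huu k
    rw [e4]
  have hnorm : ∀ (s : Finset (R × 𝓗)) (c : (R × 𝓗) → ℂ),
      ‖∑ i ∈ s, c i • Y i‖ ≤ 1 * ‖∑ i ∈ s, c i • X i‖ := by
    intro s c
    rw [one_mul, ← sq_le_sq₀ (norm_nonneg _) (norm_nonneg _), ← inner_self_eq_norm_sq (𝕜 := ℂ),
      ← inner_self_eq_norm_sq (𝕜 := ℂ)]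
    simp only [sum_inner, inner_sum, inner_smul_left, inner_smul_right, hinner]
    exact le_rfl
  obtain ⟨u', hu1, hu2, -⟩ := exists_clm_of_norm_sum_le X Y zero_le_one hnorm
  -- An operator acting on the vectors `X` and `Y` through the same map of indices commutes with
  -- `u'`. Elements of `R` act on the first index, elements of `T` on the second.
  have key : ∀ (S : 𝓗 →L[ℂ] 𝓗) (σ σ' : R × 𝓗 → R × 𝓗), (∀ i, S (X i) = X (σ i)) →
      (∀ i, S (Y i) = Y (σ i)) → (∀ i, star S (X i) = X (σ' i)) → u' * S = S * u' := by
    intro S σ σ' h1 h2 h3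
    refine commute_of_family X hu2 (fun i => ?_) fun z hz i => ?_
    · rw [h1, hu1, hu1, h2]
    · rw [← ContinuousLinearMap.adjoint_inner_left, ← ContinuousLinearMap.star_eq_adjoint, h3, hz]
  refine ⟨u', ?_, ?_, fun t ht => ?_⟩
  · rw [VonNeumannAlgebra.mem_commutant_iff]
    intro g hg
    exact (key g (fun p => (⟨g * p.1, mul_mem hg p.1.2⟩, p.2))
      (fun p => (⟨star g * p.1, mul_mem (star_mem hg) p.1.2⟩, p.2))
      (fun i => rfl) (fun i => rfl) (fun i => rfl)).symm
  · ext h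
    have := hu1 (⟨1, one_mem R⟩, h)
    change u' (q h) = (u * q) h
    rw [← huq]
    exact this
  · have ht1 := hT t ht
    have c1 : ∀ x ∈ R, ∀ h, t (x h) = x (t h) := fun x hx h =>
      (DFunLike.congr_fun (VonNeumannAlgebra.mem_commutant_iff.1 ht1.1 x hx) h).symm
    have c2 : ∀ x ∈ R, ∀ h, star t (x h) = x (star t h) := fun x hx h =>
      (DFunLike.congr_fun (VonNeumannAlgebra.mem_commutant_iff.1 (star_mem ht1.1) x hx) h).symm
    have c3 : ∀ h, t (u h) = u (t h) := fun h => DFunLike.congr_fun (hu t (Or.inr ht)).1 h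
    refine (key t (fun p => (p.1, t p.2)) (fun p => (p.1, star t p.2)) ?_ ?_ ?_).symm
    · rintro ⟨⟨x, hx⟩, h⟩
      change t (x (q h)) = x (q (t h))
      rw [c1 x hx, c1 q hqR]
    · rintro ⟨⟨x, hx⟩, h⟩
      change t (x (q (u h))) = x (q (u (t h)))
      rw [c1 x hx, c1 q hqR, c3]
    · rintro ⟨⟨x, hx⟩, h⟩
      change star t (x (q h)) = x (q (star t h))
      rw [c2 x hx, c2 q hqR]

end Operators

/-! ### Elementary tensors, slice maps and the von Neumann tensor product -/

section TensorBasics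

variable {K H : Type*} [NormedAddCommGroup K] [InnerProductSpace ℂ K]
  [NormedAddCommGroup H] [InnerProductSpace ℂ H]

theorem inner_vecTensor (ζ ζ' : K) (η η' : H) :
    ⟪vecTensor ζ η, vecTensor ζ' η'⟫_ℂ = ⟪ζ, ζ'⟫_ℂ * ⟪η, η'⟫_ℂ := by
  rw [vecTensor, vecTensor, UniformSpace.Completion.inner_coe, TensorProduct.inner_tmul]

/-- The bounded operator `η ↦ ζ ⊗ η`. -/
noncomputable def leftTensor (ζ : K) : H →L[ℂ] HilbertTensor K H :=
  UniformSpace.Completion.toComplL ∘L (TensorProduct.mkL ℂ K H ζ)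

/-- The bounded operator `ζ ↦ ζ ⊗ η`. -/
noncomputable def rightTensor (η : H) : K →L[ℂ] HilbertTensor K H :=
  UniformSpace.Completion.toComplL ∘L ((TensorProduct.mkL ℂ K H).flip η)

theorem leftTensor_apply (ζ : K) (η : H) : leftTensor ζ η = vecTensor ζ η := rfl

theorem rightTensor_apply (ζ : K) (η : H) : rightTensor η ζ = vecTensor ζ η := rfl

theorem norm_vecTensor (ζ : K) (η : H) : ‖vecTensor ζ η‖ = ‖ζ‖ * ‖η‖ := by
  rw [vecTensor, UniformSpace.Completion.norm_coe, TensorProduct.norm_tmul]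

theorem vecTensor_sub_left (ζ ζ' : K) (η : H) :
    vecTensor (ζ - ζ') η = vecTensor ζ η - vecTensor ζ' η := map_sub (rightTensor η) ζ ζ'

theorem vecTensor_smul_left (c : ℂ) (ζ : K) (η : H) :
    vecTensor (c • ζ) η = c • vecTensor ζ η := map_smul (rightTensor η) c ζ

@[simp] theorem opTensor_vecTensor (a : K →L[ℂ] K) (b : H →L[ℂ] H) (ζ : K) (η : H) :
    opTensor a b (vecTensor ζ η) = vecTensor (a ζ) (b η) := by
  rw [opTensor, vecTensor, ContinuousLinearMap.completion_apply_coe, TensorProduct.mapL_tmul]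
  rfl

/-- A closed subspace containing all elementary tensors is everything. -/
theorem mem_of_forall_vecTensor {X : Submodule ℂ (HilbertTensor K H)}
    (hX : IsClosed (X : Set (HilbertTensor K H))) (h : ∀ ζ η, vecTensor ζ η ∈ X)
    (v : HilbertTensor K H) : v ∈ X := by
  induction v using UniformSpace.Completion.induction_on with
  | hp => exact hX
  | ih a =>
    induction a using TensorProduct.induction_on with
    | zero => rw [UniformSpace.Completion.coe_zero]; exact X.zero_mem
    | tmul x y => exact h x y
    | add x y hx hy => rw [UniformSpace.Completion.coe_add]; exact X.add_mem hx hy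

theorem ext_vecTensor {F : Type*} [NormedAddCommGroup F] [NormedSpace ℂ F]
    {S T : HilbertTensor K H →L[ℂ] F}
    (h : ∀ ζ η, S (vecTensor ζ η) = T (vecTensor ζ η)) : S = T := by
  ext v
  have := mem_of_forall_vecTensor (X := LinearMap.ker ((S - T) : HilbertTensor K H →ₗ[ℂ] F))
    (S - T).isClosed_ker (fun ζ η => by simp [h ζ η]) v
  simpa [sub_eq_zero] using this

theorem ext_inner_vecTensor {v w : HilbertTensor K H}
    (h : ∀ ζ η, ⟪vecTensor ζ η, v⟫_ℂ = ⟪vecTensor ζ η, w⟫_ℂ) : v = w := by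
  rw [← sub_eq_zero, ← inner_self_eq_zero (𝕜 := ℂ)]
  have hX : IsClosed ((ℂ ∙ (v - w))ᗮ : Set (HilbertTensor K H)) :=
    Submodule.isClosed_orthogonal _
  have := mem_of_forall_vecTensor hX (fun ζ η => by
    rw [Submodule.mem_orthogonal_singleton_iff_inner_left, inner_sub_right, h, sub_self]) (v - w)
  rwa [Submodule.mem_orthogonal_singleton_iff_inner_left] at this

theorem opTensor_mul (a a' : K →L[ℂ] K) (b b' : H →L[ℂ] H) :
    opTensor a b * opTensor a' b' = opTensor (a * a') (b * b') :=
  ext_vecTensor fun ζ η => by simp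

theorem opTensor_one : opTensor (1 : K →L[ℂ] K) (1 : H →L[ℂ] H) = 1 :=
  ext_vecTensor fun ζ η => by simp

theorem norm_opTensor_one_le (b : H →L[ℂ] H) : ‖opTensor (1 : K →L[ℂ] K) b‖ ≤ ‖b‖ := by
  refine ContinuousLinearMap.opNorm_le_bound _ (norm_nonneg _) fun v => ?_
  induction v using UniformSpace.Completion.induction_on with
  | hp => exact isClosed_le (by fun_prop) (by fun_prop)
  | ih a =>
    rw [opTensor, ContinuousLinearMap.completion_apply_coe, UniformSpace.Completion.norm_coe,
      UniformSpace.Completion.norm_coe]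
    refine (TensorProduct.mapL (1 : K →L[ℂ] K) b).le_of_opNorm_le ?_ a
    refine (TensorProduct.norm_mapL_le _ _).trans ?_
    exact mul_le_of_le_one_left (norm_nonneg _) ContinuousLinearMap.norm_id_le

theorem opTensor_sub_right (a : K →L[ℂ] K) (b b' : H →L[ℂ] H) :
    opTensor a (b - b') = opTensor a b - opTensor a b' :=
  ext_vecTensor fun ζ η => by
    have := map_sub (leftTensor (a ζ)) (b η) (b' η)
    simp only [leftTensor_apply] at this
    simpa using this

theorem opTensor_sum_right {ι : Type*} (s : Finset ι) (a : K →L[ℂ] K) (b : ι → (H →L[ℂ] H)) :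
    opTensor a (∑ i ∈ s, b i) = ∑ i ∈ s, opTensor a (b i) :=
  ext_vecTensor fun ζ η => by
    have := map_sum (leftTensor (a ζ)) (fun i => b i η) s
    simp only [leftTensor_apply] at this
    simpa using this

variable [CompleteSpace K] [CompleteSpace H]

theorem star_opTensor (a : K →L[ℂ] K) (b : H →L[ℂ] H) :
    star (opTensor a b) = opTensor (star a) (star b) := by
  refine ext_vecTensor fun ζ η => ext_inner_vecTensor fun ζ' η' => ?_
  rw [ContinuousLinearMap.star_eq_adjoint, ContinuousLinearMap.adjoint_inner_right,
    opTensor_vecTensor, opTensor_vecTensor, inner_vecTensor, inner_vecTensor,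
    ContinuousLinearMap.star_eq_adjoint, ContinuousLinearMap.star_eq_adjoint,
    ContinuousLinearMap.adjoint_inner_right, ContinuousLinearMap.adjoint_inner_right]

/-- The slice `(ω ⊗ id) T` for `ω = ⟪ζ', · ζ⟫`. -/
noncomputable def sliceLeft (ζ' ζ : K) (T : HilbertTensor K H →L[ℂ] HilbertTensor K H) :
    H →L[ℂ] H :=
  ContinuousLinearMap.adjoint (leftTensor ζ') ∘L T ∘L leftTensor ζ

/-- The slice `(id ⊗ ω) T` for `ω = ⟪η', · η⟫`. -/
noncomputable def sliceRight (η' η : H) (T : HilbertTensor K H →L[ℂ] HilbertTensor K H) :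
    K →L[ℂ] K :=
  ContinuousLinearMap.adjoint (rightTensor η') ∘L T ∘L rightTensor η

theorem inner_sliceLeft (ζ' ζ : K) (T : HilbertTensor K H →L[ℂ] HilbertTensor K H) (η' η : H) :
    ⟪η', sliceLeft ζ' ζ T η⟫_ℂ = ⟪vecTensor ζ' η', T (vecTensor ζ η)⟫_ℂ := by
  simp only [sliceLeft, ContinuousLinearMap.comp_apply, ContinuousLinearMap.adjoint_inner_right]
  rfl

theorem inner_sliceRight (η' η : H) (T : HilbertTensor K H →L[ℂ] HilbertTensor K H) (ζ' ζ : K) :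
    ⟪ζ', sliceRight η' η T ζ⟫_ℂ = ⟪vecTensor ζ' η', T (vecTensor ζ η)⟫_ℂ := by
  simp only [sliceRight, ContinuousLinearMap.comp_apply, ContinuousLinearMap.adjoint_inner_right]
  rfl

theorem norm_sliceLeft_le (ζ : K) (hζ : ‖ζ‖ ≤ 1)
    (T : HilbertTensor K H →L[ℂ] HilbertTensor K H) : ‖sliceLeft ζ ζ T‖ ≤ ‖T‖ := by
  have h1 : ‖(leftTensor ζ : H →L[ℂ] HilbertTensor K H)‖ ≤ 1 := by
    refine ContinuousLinearMap.opNorm_le_bound _ zero_le_one fun η => ?_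
    rw [leftTensor_apply, norm_vecTensor]
    exact mul_le_mul_of_nonneg_right hζ (norm_nonneg _)
  refine (ContinuousLinearMap.opNorm_comp_le _ _).trans ?_
  rw [LinearIsometryEquiv.norm_map]
  calc _ ≤ 1 * ‖T ∘L leftTensor ζ‖ :=
        mul_le_mul_of_nonneg_right h1 (ContinuousLinearMap.opNorm_nonneg _)
    _ ≤ 1 * (‖T‖ * 1) := by
        refine mul_le_mul_of_nonneg_left ?_ zero_le_one
        exact (ContinuousLinearMap.opNorm_comp_le _ _).trans
          (mul_le_mul_of_nonneg_left h1 (ContinuousLinearMap.opNorm_nonneg _))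
    _ = ‖T‖ := by ring

theorem inner_opTensor_left (a : K →L[ℂ] K) (b : H →L[ℂ] H) (v w : HilbertTensor K H) :
    ⟪opTensor a b v, w⟫_ℂ = ⟪v, opTensor (star a) (star b) w⟫_ℂ := by
  rw [← star_opTensor, ContinuousLinearMap.star_eq_adjoint,
    ContinuousLinearMap.adjoint_inner_right]

/-- Slicing the first variable turns commutation with `1 ⊗ n` into commutation with `n`, and the
bicommutant theorem concludes. -/
theorem sliceLeft_mem {N : VonNeumannAlgebra H} {T : HilbertTensor K H →L[ℂ] HilbertTensor K H}
    (hT : ∀ n ∈ N.commutant, opTensor 1 n * T = T * opTensor 1 n) (ζ' ζ : K) :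
    sliceLeft ζ' ζ T ∈ N := by
  refine mem_of_forall_commutant fun n hn => ?_
  ext η
  refine ext_inner_left ℂ fun η' => ?_
  have h1 : opTensor 1 n (T (vecTensor ζ η)) = T (vecTensor ζ (n η)) := by
    simpa using DFunLike.congr_fun (hT n hn) (vecTensor ζ η)
  change ⟪η', n (sliceLeft ζ' ζ T η)⟫_ℂ = ⟪η', sliceLeft ζ' ζ T (n η)⟫_ℂ
  rw [inner_sliceLeft, ← inner_star_left, inner_sliceLeft, ← h1, ← inner_star_left (opTensor _ _),
    star_opTensor]
  simp

theorem sliceRight_mem {A : VonNeumannAlgebra K} {T : HilbertTensor K H →L[ℂ] HilbertTensor K H}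
    (hT : ∀ a ∈ A.commutant, opTensor a 1 * T = T * opTensor a 1) (η' η : H) :
    sliceRight η' η T ∈ A := by
  refine mem_of_forall_commutant fun n hn => ?_
  ext ζ
  refine ext_inner_left ℂ fun ζ' => ?_
  have h1 : opTensor n 1 (T (vecTensor ζ η)) = T (vecTensor (n ζ) η) := by
    simpa using DFunLike.congr_fun (hT n hn) (vecTensor ζ η)
  change ⟪ζ', n (sliceRight η' η T ζ)⟫_ℂ = ⟪ζ', sliceRight η' η T (n ζ)⟫_ℂ
  rw [inner_sliceRight, ← inner_star_left, inner_sliceRight, ← h1, ← inner_star_left (opTensor _ _),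
    star_opTensor]
  simp

theorem subset_vnGenerated {𝓗 : Type*} [NormedAddCommGroup 𝓗] [InnerProductSpace ℂ 𝓗]
    [CompleteSpace 𝓗] {S : Set (𝓗 →L[ℂ] 𝓗)} {x : 𝓗 →L[ℂ] 𝓗} (hx : x ∈ S) :
    x ∈ vnGenerated S := by
  change x ∈ StarSubalgebra.centralizer ℂ (StarSubalgebra.centralizer ℂ S : Set (𝓗 →L[ℂ] 𝓗))
  rw [StarSubalgebra.mem_centralizer_iff]
  intro g hg
  have h2 := (StarSubalgebra.mem_centralizer_iff ℂ).1 hg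
  have h3 := (StarSubalgebra.mem_centralizer_iff ℂ).1 (star_mem hg)
  exact ⟨(h2 x hx).1.symm, (h3 x hx).1.symm⟩

theorem commute_of_mem_vnGenerated {𝓗 : Type*} [NormedAddCommGroup 𝓗] [InnerProductSpace ℂ 𝓗]
    [CompleteSpace 𝓗] {S : Set (𝓗 →L[ℂ] 𝓗)} {x y : 𝓗 →L[ℂ] 𝓗} (hx : x ∈ vnGenerated S)
    (hy : ∀ s ∈ S, s * y = y * s ∧ star s * y = y * star s) : y * x = x * y := by
  have hx' : x ∈ StarSubalgebra.centralizer ℂ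
    (StarSubalgebra.centralizer ℂ S : Set (𝓗 →L[ℂ] 𝓗)) := hx
  rw [StarSubalgebra.mem_centralizer_iff] at hx'
  exact (hx' y ((StarSubalgebra.mem_centralizer_iff ℂ).2 hy)).1

theorem vnGenerated_le {𝓗 : Type*} [NormedAddCommGroup 𝓗] [InnerProductSpace ℂ 𝓗]
    [CompleteSpace 𝓗] {S : Set (𝓗 →L[ℂ] 𝓗)} {N : VonNeumannAlgebra 𝓗} (h : S ⊆ N) :
    vnGenerated S ≤ N := fun _ hx =>
  mem_of_forall_commutant fun _ hy => commute_of_mem_vnGenerated hx fun s hs =>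
    ⟨VonNeumannAlgebra.mem_commutant_iff.1 hy s (h hs),
      VonNeumannAlgebra.mem_commutant_iff.1 hy _ (star_mem (h hs))⟩

variable {A : VonNeumannAlgebra K} {N : VonNeumannAlgebra H}

theorem opTensor_mem {a : K →L[ℂ] K} {n : H →L[ℂ] H} (ha : a ∈ A) (hn : n ∈ N) :
    opTensor a n ∈ vnTensor A N := subset_vnGenerated ⟨a, ha, n, hn, rfl⟩

theorem vnTensor_mono {N' : VonNeumannAlgebra H} (h : N ≤ N') : vnTensor A N ≤ vnTensor A N' :=
  vnGenerated_le fun _ ⟨_, ha, _, hb, e⟩ => e ▸ opTensor_mem ha (h hb)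

theorem vnTensor_commute {T y : HilbertTensor K H →L[ℂ] HilbertTensor K H}
    (hT : T ∈ vnTensor A N) (hy : ∀ a ∈ A, ∀ n ∈ N, opTensor a n * y = y * opTensor a n) :
    y * T = T * y := by
  refine commute_of_mem_vnGenerated hT ?_
  rintro _ ⟨a, ha, n, hn, rfl⟩
  refine ⟨hy a ha n hn, ?_⟩
  rw [star_opTensor]
  exact hy _ (star_mem ha) _ (star_mem hn)

theorem vnTensor_commute_opTensor {T : HilbertTensor K H →L[ℂ] HilbertTensor K H}
    (hT : T ∈ vnTensor A N) {a : K →L[ℂ] K} {n : H →L[ℂ] H} (ha : a ∈ A.commutant)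
    (hn : n ∈ N.commutant) : opTensor a n * T = T * opTensor a n := by
  refine vnTensor_commute hT fun a' ha' n' hn' => ?_
  rw [opTensor_mul, opTensor_mul, VonNeumannAlgebra.mem_commutant_iff.1 ha a' ha',
    VonNeumannAlgebra.mem_commutant_iff.1 hn n' hn']

theorem mem_commutant_vnTensor {y : HilbertTensor K H →L[ℂ] HilbertTensor K H}
    (hy : ∀ a ∈ A, ∀ n ∈ N, opTensor a n * y = y * opTensor a n) :
    y ∈ (vnTensor A N).commutant :=
  VonNeumannAlgebra.mem_commutant_iff.2 fun _ hg => (vnTensor_commute hg hy).symm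

end TensorBasics

/-! ### Partitions of unity in an abelian algebra on which finitely many elements are almost scalar
-/

section Partition

variable {K : Type*} [NormedAddCommGroup K] [InnerProductSpace ℂ K] [CompleteSpace K]

theorem re_inner_le_of_le {x y : K →L[ℂ] K} (h : x ≤ y) (κ : K) :
    RCLike.re ⟪κ, x κ⟫_ℂ ≤ RCLike.re ⟪κ, y κ⟫_ℂ := by
  have h1 := ((ContinuousLinearMap.le_def _ _).1 h).re_inner_nonneg_right κ
  simpa [inner_sub_right] using h1

theorem re_inner_nonneg_of_nonneg {x : K →L[ℂ] K} (h : 0 ≤ x) (κ : K) :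
    0 ≤ RCLike.re ⟪κ, x κ⟫_ℂ := by
  simpa using re_inner_le_of_le h κ

theorem le_of_forall_re_inner_le {x y : K →L[ℂ] K} (hx : IsSelfAdjoint x) (hy : IsSelfAdjoint y)
    (h : ∀ κ, RCLike.re ⟪κ, x κ⟫_ℂ ≤ RCLike.re ⟪κ, y κ⟫_ℂ) : x ≤ y := by
  rw [ContinuousLinearMap.le_def, ContinuousLinearMap.isPositive_def']
  refine ⟨hy.sub hx, fun κ => ?_⟩
  rw [ContinuousLinearMap.reApplyInnerSelf_apply, inner_re_symm]
  have := h κ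
  simp only [sub_apply, inner_sub_right, map_sub]
  linarith

theorem norm_sq_eq_re_inner (x : K →L[ℂ] K) (κ : K) :
    ‖x κ‖ ^ 2 = RCLike.re ⟪κ, (star x * x) κ⟫_ℂ := by
  rw [mul_apply_eq_comp, inner_star_right, inner_self_eq_norm_sq]

/-- For a real function `w` the operator `w(a)` is self-adjoint, so `‖w(a) κ‖²` is the quadratic
form of `w²(a)`, and monotonicity of the functional calculus applies. -/
theorem norm_cfc_apply_le {a : K →L[ℂ] K} {u v : ℝ → ℝ}
    (hu : Continuous u) (hv : Continuous v) {ε : ℝ} (hε : 0 ≤ ε)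
    (h : ∀ t ∈ spectrum ℝ a, |u t| ≤ ε * |v t|) (κ : K) :
    ‖cfc u a κ‖ ≤ ε * ‖cfc v a κ‖ := by
  have h1 : ∀ w : ℝ → ℝ, Continuous w → ‖cfc w a κ‖ ^ 2 = RCLike.re ⟪κ, cfc (fun t => w t ^ 2) a κ⟫_ℂ := by
    intro w hw
    rw [norm_sq_eq_re_inner, (cfc_predicate w a : IsSelfAdjoint _).star_eq,
      ← cfc_mul w w a hw.continuousOn hw.continuousOn]
    simp only [pow_two]
  rw [← sq_le_sq₀ (norm_nonneg _) (by positivity), mul_pow, h1 u hu, h1 v hv]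
  have h2 : cfc (fun t => u t ^ 2) a ≤ (ε ^ 2) • cfc (fun t => v t ^ 2) a := by
    rw [← cfc_smul (ε ^ 2) (fun t => v t ^ 2) a (by fun_prop)]
    refine cfc_mono (fun t ht => ?_) (by fun_prop) (by fun_prop)
    have := h t ht
    rw [smul_eq_mul, ← sq_abs (u t), ← sq_abs (v t), ← mul_pow]
    exact pow_le_pow_left₀ (abs_nonneg _) this 2
  have h3 := re_inner_le_of_le h2 κ
  have h4 : ⟪κ, (ε ^ 2 • cfc (fun t => v t ^ 2) a) κ⟫_ℂ
      = ((ε ^ 2 : ℝ) : ℂ) * ⟪κ, cfc (fun t => v t ^ 2) a κ⟫_ℂ := by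
    rw [smul_apply, ← inner_smul_right, Complex.coe_smul]
  rw [h4] at h3
  calc _ ≤ _ := h3
    _ = _ := by rw [RCLike.re_to_complex, Complex.re_ofReal_mul]; rfl

/-- A finite family of self-adjoint elements of `A` whose squares sum up to `1`. -/
structure IsSquarePartition (A : VonNeumannAlgebra K) {ι : Type} [Fintype ι]
    (g : ι → (K →L[ℂ] K)) : Prop where
  mem : ∀ j, g j ∈ A
  selfAdjoint : ∀ j, IsSelfAdjoint (g j)
  sum : ∑ j, g j * g j = 1

/-- On the range of every member of the partition, `a` is a scalar up to `ε`. -/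
def IsAlmostScalarOn {ι : Type} (g : ι → (K →L[ℂ] K)) (ε : ℝ) (a : K →L[ℂ] K) : Prop :=
  ∃ c : ι → ℂ, ∀ j κ, ‖a (g j κ) - c j • g j κ‖ ≤ ε * ‖g j κ‖

theorem IsSquarePartition.prod {A : VonNeumannAlgebra K} (hA : ∀ x ∈ A, ∀ y ∈ A, x * y = y * x)
    {ι ι' : Type} [Fintype ι] [Fintype ι'] {g : ι → (K →L[ℂ] K)} {g' : ι' → (K →L[ℂ] K)}
    (hg : IsSquarePartition A g) (hg' : IsSquarePartition A g') :
    IsSquarePartition A (fun p : ι × ι' => g p.1 * g' p.2) where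
  mem p := mul_mem (hg.mem _) (hg'.mem _)
  selfAdjoint p := by
    rw [IsSelfAdjoint, star_mul, (hg.selfAdjoint _).star_eq, (hg'.selfAdjoint _).star_eq]
    exact hA _ (hg'.mem _) _ (hg.mem _)
  sum := by
    rw [Fintype.sum_prod_type]
    have : ∀ i j, g i * g' j * (g i * g' j) = (g i * g i) * (g' j * g' j) := fun i j => by
      rw [mul_assoc, ← mul_assoc (g' j), hA _ (hg'.mem j) _ (hg.mem i)]
      simp only [mul_assoc]
    simp only [this, ← Finset.mul_sum, hg'.sum, mul_one, hg.sum]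

theorem IsAlmostScalarOn.prod_left {ι ι' : Type} {g : ι → (K →L[ℂ] K)} {g' : ι' → (K →L[ℂ] K)}
    {ε : ℝ} {a : K →L[ℂ] K} (h : IsAlmostScalarOn g ε a) :
    IsAlmostScalarOn (fun p : ι × ι' => g p.1 * g' p.2) ε a := by
  obtain ⟨c, hc⟩ := h
  exact ⟨fun p => c p.1, fun p κ => hc p.1 (g' p.2 κ)⟩

theorem IsAlmostScalarOn.prod_right {A : VonNeumannAlgebra K}
    (hA : ∀ x ∈ A, ∀ y ∈ A, x * y = y * x) {ι ι' : Type} {g : ι → (K →L[ℂ] K)}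
    {g' : ι' → (K →L[ℂ] K)} (hg : ∀ i, g i ∈ A) (hg' : ∀ i, g' i ∈ A)
    {ε : ℝ} {a : K →L[ℂ] K} (h : IsAlmostScalarOn g' ε a) :
    IsAlmostScalarOn (fun p : ι × ι' => g p.1 * g' p.2) ε a := by
  obtain ⟨c, hc⟩ := h
  refine ⟨fun p => c p.2, fun p κ => ?_⟩
  dsimp only
  rw [hA _ (hg _) _ (hg' _)]
  exact hc p.2 (g p.1 κ)

theorem exists_squarePartition_selfAdjoint (A : VonNeumannAlgebra K) {a : K →L[ℂ] K} (ha : a ∈ A)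
    (hsa : IsSelfAdjoint a) {ε : ℝ} (hε : 0 < ε) :
    ∃ (m : ℕ) (g : Fin m → (K →L[ℂ] K)), IsSquarePartition A g ∧ IsAlmostScalarOn g ε a := by
  set c : ℝ := ‖a‖ with hc
  -- `φ k` rises linearly from `0` at `(k - 1) ε - c` to `1` at `k ε - c`, so `φ k - φ (k + 1)` is a
  -- tent of half-width `ε` around `k ε - c`. The tents telescope to `1` on `[-c, c]`; the `+ 1` in
  -- the bound for `m` makes `φ m` vanish there.
  let φ : ℕ → ℝ → ℝ := fun k t => max 0 (min 1 ((t + c) / ε + 1 - k))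
  obtain ⟨m, hm⟩ := exists_nat_ge ((c + c) / ε + 1)
  let u : ℕ → ℝ → ℝ := fun k t => φ k t - φ (k + 1) t
  have hφ : ∀ k, Continuous (φ k) := fun k => by fun_prop
  have hu : ∀ k, Continuous (u k) := fun k => (hφ k).sub (hφ (k + 1))
  have hu0 : ∀ k t, 0 ≤ u k t := fun k t => by
    refine sub_nonneg.2 (max_le_max le_rfl (min_le_min le_rfl ?_))
    push_cast
    linarith
  have hus : ∀ k t, u k t ≠ 0 → |t - (k * ε - c)| ≤ ε := by
    intro k t hk
    by_contra hcon
    rw [not_le, lt_abs] at hcon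
    refine hk ?_
    have e1 : (t + c) / ε - k = (t - (k * ε - c)) / ε := by field_simp; ring
    simp only [u, φ]
    push_cast
    rcases hcon with h | h
    · have : 1 < (t + c) / ε - k := by rw [e1, lt_div_iff₀ hε]; linarith
      rw [min_eq_left (by linarith), min_eq_left (by linarith), sub_self]
    · have : (t + c) / ε - k < -1 := by rw [e1, div_lt_iff₀ hε]; linarith
      rw [max_eq_left (min_le_of_right_le (by linarith)),
        max_eq_left (min_le_of_right_le (by linarith)), sub_self]
  have hsum : ∀ t ∈ spectrum ℝ a, ∑ k ∈ Finset.range m, u k t = 1 := by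
    intro t ht
    have htc : |t| ≤ c := by
      have h1 := spectrum.norm_le_norm_mul_of_mem ht
      have h2 : ‖(1 : K →L[ℂ] K)‖ ≤ 1 := ContinuousLinearMap.norm_id_le
      rw [Real.norm_eq_abs] at h1
      exact h1.trans (mul_le_of_le_one_right (norm_nonneg _) h2)
    rw [abs_le] at htc
    rw [Finset.sum_range_sub']
    simp only [φ]
    have h1 : 0 ≤ (t + c) / ε := div_nonneg (by linarith) hε.le
    have h2 : (t + c) / ε ≤ (c + c) / ε := div_le_div_of_nonneg_right (by linarith) hε.le
    rw [min_eq_left (by push_cast; linarith), max_eq_right zero_le_one,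
      max_eq_left (min_le_of_right_le (by linarith)), sub_zero]
  have hsq : ∀ k, Continuous fun t => √(u k t) := fun k => (hu k).sqrt
  refine ⟨m, fun k => cfc (fun t => √(u k t)) a, ⟨fun k => cfc_mem_vn A ha _,
    fun k => cfc_predicate _ a, ?_⟩, fun k => ((k * ε - c : ℝ) : ℂ), fun k κ => ?_⟩
  · have h1 : ∀ k : Fin m, cfc (fun t => √(u k t)) a * cfc (fun t => √(u k t)) a = cfc (u k) a := by
      intro k
      rw [← cfc_mul _ _ a (hsq k).continuousOn (hsq k).continuousOn]
      congr 1
      funext t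
      exact Real.mul_self_sqrt (hu0 k t)
    rw [Finset.sum_congr rfl fun k _ => h1 k, Fin.sum_univ_eq_sum_range (fun k => cfc (u k) a) m,
      ← cfc_sum _ _ _ (fun k _ => (hu k).continuousOn), ← cfc_one ℝ a]
    refine cfc_congr fun t ht => ?_
    simpa using hsum t ht
  · have h1 : a (cfc (fun t => √(u k t)) a κ) - ((k * ε - c : ℝ) : ℂ) • cfc (fun t => √(u k t)) a κ
        = cfc (fun t => (t - (k * ε - c)) * √(u k t)) a κ := by
      rw [cfc_mul (fun t => t - (k * ε - c)) _ a (by fun_prop) (hsq k).continuousOn,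
        cfc_sub (fun t => t) (fun _ => (k * ε - c : ℝ)) a continuousOn_id continuousOn_const,
        cfc_id' ℝ a, cfc_const (k * ε - c : ℝ) a,
        mul_apply_eq_comp, sub_apply, Algebra.algebraMap_eq_smul_one,
        smul_apply, one_apply_eq_self, Complex.coe_smul]
    rw [h1]
    refine norm_cfc_apply_le (by fun_prop) (hsq k) hε.le (fun t _ => ?_) κ
    rw [abs_mul]
    by_cases h0 : u k t = 0
    · simp [h0]
    · exact mul_le_mul_of_nonneg_right (hus k t h0) (abs_nonneg _)

theorem IsAlmostScalarOn.add_I_smul {ι : Type} {g : ι → (K →L[ℂ] K)} {ε : ℝ} {a b : K →L[ℂ] K}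
    (ha : IsAlmostScalarOn g (ε / 2) a) (hb : IsAlmostScalarOn g (ε / 2) b) :
    IsAlmostScalarOn g ε (a + Complex.I • b) := by
  obtain ⟨c, hc⟩ := ha
  obtain ⟨d, hd⟩ := hb
  refine ⟨fun j => c j + Complex.I * d j, fun j κ => ?_⟩
  have e : (a + Complex.I • b) (g j κ) - (c j + Complex.I * d j) • g j κ
      = (a (g j κ) - c j • g j κ) + Complex.I • (b (g j κ) - d j • g j κ) := by
    simp only [add_apply, smul_apply, add_smul, smul_sub,
      mul_smul]
    abel
  rw [e]
  refine (norm_add_le _ _).trans ?_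
  rw [norm_smul, Complex.norm_I, one_mul]
  linarith [hc j κ, hd j κ]

/-- Real and imaginary parts are handled separately with precision `ε / 2`. Products of partitions
refine all the factors, and commutativity of `A` keeps them self-adjoint with squares summing to
`1`. -/
theorem exists_squarePartition {A : VonNeumannAlgebra K} (hA : ∀ x ∈ A, ∀ y ∈ A, x * y = y * x)
    {α : Type*} (F : Finset α) (f : α → (K →L[ℂ] K)) (hf : ∀ i, f i ∈ A) {ε : ℝ} (hε : 0 < ε) :
    ∃ (ι : Type) (_ : Fintype ι) (g : ι → (K →L[ℂ] K)), IsSquarePartition A g ∧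
      ∀ i ∈ F, IsAlmostScalarOn g ε (f i) := by
  classical
  induction F using Finset.induction_on with
  | empty =>
    exact ⟨Unit, inferInstance, fun _ => 1, ⟨fun _ => one_mem A, fun _ => IsSelfAdjoint.one _,
      by simp⟩, by simp⟩
  | insert i F _ ih =>
    obtain ⟨ι, _, g, hg, hgF⟩ := ih
    have hre : (realPart (f i) : K →L[ℂ] K) ∈ A := by
      rw [realPart_apply_coe]
      have := smul_mem_vn A ((2⁻¹ : ℝ) : ℂ) (add_mem (hf i) (star_mem (hf i)))
      rwa [Complex.coe_smul] at this
    have him : (imaginaryPart (f i) : K →L[ℂ] K) ∈ A := by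
      rw [imaginaryPart_apply_coe]
      have := smul_mem_vn A (-Complex.I) (smul_mem_vn A ((2⁻¹ : ℝ) : ℂ)
        (sub_mem (hf i) (star_mem (hf i))))
      rwa [Complex.coe_smul] at this
    obtain ⟨m, g₁, hg₁, h₁⟩ := exists_squarePartition_selfAdjoint A hre (realPart (f i)).2
      (half_pos hε)
    obtain ⟨n, g₂, hg₂, h₂⟩ := exists_squarePartition_selfAdjoint A him (imaginaryPart (f i)).2
      (half_pos hε)
    refine ⟨_, inferInstance, _, (hg₁.prod hA hg₂).prod hA hg, fun j hj => ?_⟩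
    rcases Finset.mem_insert.1 hj with rfl | hj
    · rw [← realPart_add_I_smul_imaginaryPart (f j)]
      refine IsAlmostScalarOn.add_I_smul h₁.prod_left.prod_left ?_
      exact (IsAlmostScalarOn.prod_right hA hg₁.mem hg₂.mem h₂).prod_left
    · exact IsAlmostScalarOn.prod_right hA (hg₁.prod hA hg₂).mem hg.mem (hgF j hj)

end Partition

/-! ### Bounded algebraic approximation and the commutation theorem for abelian `A` -/

section Approximation

variable {K H : Type*} [NormedAddCommGroup K] [InnerProductSpace ℂ K] [CompleteSpace K]
  [NormedAddCommGroup H] [InnerProductSpace ℂ H] [CompleteSpace H]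

/-- A bounded net of operators converging weakly to zero on a set of vectors with dense span. -/
theorem isClosed_setOf_tendsto_zero {𝓗 F α : Type*} [NormedAddCommGroup 𝓗] [NormedSpace ℂ 𝓗]
    [NormedAddCommGroup F] [NormedSpace ℂ F]
    {l : Filter α} (T : α → 𝓗 → F) {C : ℝ}
    (hT : ∀ i x y, ‖T i x - T i y‖ ≤ C * ‖x - y‖) :
    IsClosed {x | Tendsto (fun i => T i x) l (𝓝 0)} := by
  rw [← closure_subset_iff_isClosed]
  intro x hx
  rw [Set.mem_ofPred_eq, Metric.tendsto_nhds]
  intro ε hε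
  obtain ⟨y, hy, hxy⟩ := Metric.mem_closure_iff.1 hx (ε / 2 / (|C| + 1)) (by positivity)
  have h1 := Metric.tendsto_nhds.1 hy (ε / 2) (half_pos hε)
  filter_upwards [h1] with i hi
  rw [dist_zero_right] at hi ⊢
  have h2 : ‖T i x - T i y‖ < ε / 2 := by
    refine (hT i x y).trans_lt ?_
    rw [dist_eq_norm, lt_div_iff₀ (by positivity)] at hxy
    calc C * ‖x - y‖ ≤ (|C| + 1) * ‖x - y‖ :=
          mul_le_mul_of_nonneg_right (by linarith [le_abs_self C]) (norm_nonneg _)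
      _ < ε / 2 := by linarith
  calc ‖T i x‖ = ‖(T i x - T i y) + T i y‖ := by rw [sub_add_cancel]
    _ ≤ ‖T i x - T i y‖ + ‖T i y‖ := norm_add_le _ _
    _ < ε := by linarith

theorem tendsto_inner_zero_of_vecTensor {α : Type*} {l : Filter α}
    (T : α → (HilbertTensor K H →L[ℂ] HilbertTensor K H)) {C : ℝ} (hT : ∀ i, ‖T i‖ ≤ C)
    (h : ∀ ζ' η' ζ η, Tendsto (fun i => ⟪vecTensor ζ' η', T i (vecTensor ζ η)⟫_ℂ) l (𝓝 0))
    (v w : HilbertTensor K H) : Tendsto (fun i => ⟪v, T i w⟫_ℂ) l (𝓝 0) := by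
  have step1 : ∀ ζ' η' w, Tendsto (fun i => ⟪vecTensor ζ' η', T i w⟫_ℂ) l (𝓝 0) := by
    intro ζ' η' w
    let X : Submodule ℂ (HilbertTensor K H) :=
      { carrier := {w | Tendsto (fun i => ⟪vecTensor ζ' η', T i w⟫_ℂ) l (𝓝 0)}
        add_mem' := fun {a b} ha hb => by
          simpa [inner_add_right] using Tendsto.add ha hb
        zero_mem' := by simpa using tendsto_const_nhds
        smul_mem' := fun c a ha => by
          simpa [inner_smul_right] using Tendsto.const_mul c ha }
    refine mem_of_forall_vecTensor (X := X) ?_ (fun ζ η => h ζ' η' ζ η) w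
    refine isClosed_setOf_tendsto_zero (fun i w => ⟪vecTensor ζ' η', T i w⟫_ℂ)
      (C := ‖(vecTensor ζ' η' : HilbertTensor K H)‖ * C) fun i x y => ?_
    rw [← inner_sub_right, ← map_sub, mul_assoc]
    refine (norm_inner_le_norm _ _).trans (mul_le_mul_of_nonneg_left ?_ (norm_nonneg _))
    exact (T i).le_of_opNorm_le (hT i) _
  let X : Submodule ℂ (HilbertTensor K H) :=
    { carrier := {v | Tendsto (fun i => ⟪v, T i w⟫_ℂ) l (𝓝 0)}
      add_mem' := fun {a b} ha hb => by
        simpa [inner_add_left] using Tendsto.add ha hb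
      zero_mem' := by simpa using tendsto_const_nhds
      smul_mem' := fun c a ha => by
        simpa [inner_smul_left] using Tendsto.const_mul (starRingEnd ℂ c) ha }
  refine mem_of_forall_vecTensor (X := X) ?_ (fun ζ η => step1 ζ η w) v
  refine isClosed_setOf_tendsto_zero (fun i v => ⟪v, T i w⟫_ℂ) (C := C * ‖w‖) fun i x y => ?_
  rw [← inner_sub_left, mul_comm (C * ‖w‖)]
  exact (norm_inner_le_norm _ _).trans (mul_le_mul_of_nonneg_left
    ((T i).le_of_opNorm_le (hT i) _) (norm_nonneg _))

theorem IsSquarePartition.sum_norm_sq {𝓗 : Type*} [NormedAddCommGroup 𝓗] [InnerProductSpace ℂ 𝓗]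
    [CompleteSpace 𝓗] {ι : Type} [Fintype ι] {g : ι → (𝓗 →L[ℂ] 𝓗)}
    (hsa : ∀ j, IsSelfAdjoint (g j)) (hsum : ∑ j, g j * g j = 1) (v : 𝓗) :
    ∑ j, ‖g j v‖ ^ 2 = ‖v‖ ^ 2 := by
  have h : ∀ j, ‖g j v‖ ^ 2 = RCLike.re ⟪v, (g j * g j) v⟫_ℂ := fun j => by
    rw [norm_sq_eq_re_inner, (hsa j).star_eq]
  simp only [h]
  rw [← map_sum, ← inner_sum, ← sum_apply, hsum, one_apply_eq_self,
    inner_self_eq_norm_sq]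

theorem sum_mul_le_of_sum_sq {ι : Type*} (s : Finset ι) (x y : ι → ℝ) {a b : ℝ} (ha : 0 ≤ a)
    (hb : 0 ≤ b) (hx : ∑ j ∈ s, x j ^ 2 = a ^ 2) (hy : ∑ j ∈ s, y j ^ 2 = b ^ 2) :
    ∑ j ∈ s, x j * y j ≤ a * b := by
  have := Finset.sum_mul_sq_le_sq_mul_sq s x y
  rw [hx, hy, ← mul_pow] at this
  exact (abs_le_of_sq_le_sq' this (by positivity)).2

/-- The approximant is `∑ gⱼ² ⊗ tⱼ`, where `tⱼ` is the slice of `T` at a unit vector `gⱼ κⱼ`. Since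
the `gⱼ²` sum to `1`, Cauchy–Schwarz bounds its norm by `‖T‖`. For a pair in `F` the corresponding
slice of `T` in `A` is a scalar `cⱼ` up to `ε` on the range of `gⱼ`; replacing it by `cⱼ` costs `ε`
in `tⱼ` and another `ε` in `T`, whence `2 ε`. -/
theorem exists_algebraic_approximant {A : VonNeumannAlgebra K} {N : VonNeumannAlgebra H}
    (hA : ∀ x ∈ A, ∀ y ∈ A, x * y = y * x)
    {T : HilbertTensor K H →L[ℂ] HilbertTensor K H}
    (hTA : ∀ a ∈ A.commutant, opTensor a 1 * T = T * opTensor a 1)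
    (hTN : ∀ n ∈ N.commutant, opTensor 1 n * T = T * opTensor 1 n)
    (F : Finset (H × H)) {ε : ℝ} (hε : 0 < ε) :
    ∃ T' : HilbertTensor K H →L[ℂ] HilbertTensor K H, ‖T'‖ ≤ ‖T‖ ∧
      T' ∈ Submodule.span ℂ {x | ∃ a ∈ A, ∃ n ∈ N, x = opTensor a n} ∧
      ∀ p ∈ F, ∀ ζ' ζ, ‖⟪vecTensor ζ' p.1, (T' - T) (vecTensor ζ p.2)⟫_ℂ‖ ≤
        2 * ε * (‖ζ'‖ * ‖ζ‖) := by
  obtain ⟨ι, _, g, hg, hgF⟩ := exists_squarePartition hA F (fun p => sliceRight p.1 p.2 T)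
    (fun p => sliceRight_mem hTA p.1 p.2) hε
  -- A zero member of the partition contributes nothing, so its slice may be taken at the zero
  -- vector.
  have hκ : ∀ j, ∃ κ : K, ‖g j κ‖ = 1 ∨ g j = 0 := by
    intro j
    by_cases h0 : g j = 0
    · exact ⟨0, Or.inr h0⟩
    · obtain ⟨κ, hκ⟩ : ∃ κ, g j κ ≠ 0 := by
        by_contra hcon
        push Not at hcon
        exact h0 (ContinuousLinearMap.ext hcon)
      refine ⟨((‖g j κ‖⁻¹ : ℝ) : ℂ) • κ, Or.inl ?_⟩
      rw [map_smul, norm_smul]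
      simp [hκ]
  choose κ hκ using hκ
  let t : ι → (H →L[ℂ] H) := fun j => sliceLeft (g j (κ j)) (g j (κ j)) T
  have ht : ∀ j, ‖t j‖ ≤ ‖T‖ := fun j => norm_sliceLeft_le _ (by
    rcases hκ j with h | h
    · exact h.le
    · simp [h]) T
  have htN : ∀ j, t j ∈ N := fun j => sliceLeft_mem hTN _ _
  have hsq : ∀ v : HilbertTensor K H, ∑ j, ‖opTensor (g j) 1 v‖ ^ 2 = ‖v‖ ^ 2 := by
    refine IsSquarePartition.sum_norm_sq (fun j => ?_) ?_
    · rw [IsSelfAdjoint, star_opTensor, (hg.selfAdjoint j).star_eq, star_one]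
    · refine ext_vecTensor fun ζ η => ?_
      rw [sum_apply, one_apply_eq_self]
      simp only [mul_apply_eq_comp, opTensor_vecTensor, one_apply_eq_self]
      have h1 := congrArg (rightTensor η) (DFunLike.congr_fun hg.sum ζ)
      rw [sum_apply, map_sum] at h1
      simpa only [rightTensor_apply, mul_apply_eq_comp, one_apply_eq_self] using h1
  have hinner : ∀ v w : HilbertTensor K H, ⟪v, (∑ j, opTensor (g j * g j) (t j)) w⟫_ℂ =
      ∑ j, ⟪opTensor (g j) 1 v, opTensor 1 (t j) (opTensor (g j) 1 w)⟫_ℂ := by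
    intro v w
    rw [sum_apply, inner_sum]
    refine Finset.sum_congr rfl fun j _ => ?_
    rw [inner_opTensor_left, ← mul_apply_eq_comp, ← mul_apply_eq_comp, opTensor_mul, opTensor_mul,
      (hg.selfAdjoint j).star_eq]
    simp
  refine ⟨∑ j, opTensor (g j * g j) (t j), ?_, ?_, ?_⟩
  · refine ContinuousLinearMap.opNorm_le_bound _ (ContinuousLinearMap.opNorm_nonneg _) fun w => ?_
    set v := (∑ j, opTensor (g j * g j) (t j)) w with hv
    by_cases hv0 : ‖v‖ = 0
    · rw [hv0]; positivity
    have h1 : ‖v‖ * ‖v‖ ≤ ‖v‖ * (‖T‖ * ‖w‖) := by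
      calc ‖v‖ * ‖v‖ = ‖⟪v, v⟫_ℂ‖ := by
            rw [inner_self_eq_norm_sq_to_K, norm_pow, RCLike.norm_ofReal, abs_norm, pow_two]
        _ = ‖∑ j, ⟪opTensor (g j) 1 v, opTensor 1 (t j) (opTensor (g j) 1 w)⟫_ℂ‖ := by
          rw [← hinner]
        _ ≤ ∑ j, ‖T‖ * (‖opTensor (g j) 1 v‖ * ‖opTensor (g j) 1 w‖) := by
          refine norm_sum_le_of_le _ fun j _ => (norm_inner_le_norm _ _).trans ?_
          have h2 : ‖opTensor (1 : K →L[ℂ] K) (t j)‖ ≤ ‖T‖ := by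
            refine (norm_opTensor_one_le _).trans (ht j)
          calc _ ≤ ‖opTensor (g j) 1 v‖ * (‖T‖ * ‖opTensor (g j) 1 w‖) :=
                mul_le_mul_of_nonneg_left ((opTensor 1 (t j)).le_of_opNorm_le h2 _) (norm_nonneg _)
            _ = _ := by ring
        _ ≤ ‖T‖ * (‖v‖ * ‖w‖) := by
          rw [← Finset.mul_sum]
          exact mul_le_mul_of_nonneg_left (sum_mul_le_of_sum_sq _ _ _ (norm_nonneg _)
            (norm_nonneg _) (hsq v) (hsq w)) (ContinuousLinearMap.opNorm_nonneg _)
        _ = _ := by ring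
    exact le_of_mul_le_mul_left h1 (lt_of_le_of_ne (norm_nonneg _) (Ne.symm hv0))
  · exact Submodule.sum_mem _ fun j _ => Submodule.subset_span
      ⟨_, mul_mem (hg.mem j) (hg.mem j), _, htN j, rfl⟩
  · rintro ⟨η', η⟩ hp ζ' ζ
    obtain ⟨c, hc⟩ := hgF _ hp
    set a := sliceRight η' η T with ha
    have haA : a ∈ A := sliceRight_mem hTA _ _
    dsimp only at hc ⊢
    rw [sub_apply, inner_sub_right, ← inner_sliceRight η' η T, ← ha, sum_apply, inner_sum]
    have e1 : ⟪ζ', a ζ⟫_ℂ = ∑ j, ⟪g j ζ', a (g j ζ)⟫_ℂ := by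
      have : a ζ = ∑ j, g j (a (g j ζ)) := by
        have h1 : ∀ j, g j (a (g j ζ)) = a ((g j * g j) ζ) := fun j => by
          have := DFunLike.congr_fun (hA _ (hg.mem j) _ haA) (g j ζ)
          simpa using this
        simp only [h1]
        rw [← map_sum, ← sum_apply, hg.sum, one_apply_eq_self]
      rw [this, inner_sum]
      refine Finset.sum_congr rfl fun j _ => ?_
      rw [← inner_star_left, (hg.selfAdjoint j).star_eq]
    have e2 : ∀ j, ⟪vecTensor ζ' η', opTensor (g j * g j) (t j) (vecTensor ζ η)⟫_ℂ =
        ⟪g j (κ j), a (g j (κ j))⟫_ℂ * ⟪g j ζ', g j ζ⟫_ℂ := by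
      intro j
      rw [opTensor_vecTensor, inner_vecTensor, inner_sliceLeft, ← inner_sliceRight,
        mul_apply_eq_comp, ← inner_star_left, (hg.selfAdjoint j).star_eq, mul_comm]
    rw [e1, ← Finset.sum_sub_distrib]
    have bound : ∀ j, ‖⟪vecTensor ζ' η', opTensor (g j * g j) (t j) (vecTensor ζ η)⟫_ℂ -
        ⟪g j ζ', a (g j ζ)⟫_ℂ‖ ≤ 2 * ε * (‖g j ζ'‖ * ‖g j ζ‖) := by
      intro j
      rw [e2]
      rcases hκ j with h | h
      · have e3 : ⟪g j (κ j), a (g j (κ j))⟫_ℂ * ⟪g j ζ', g j ζ⟫_ℂ - ⟪g j ζ', a (g j ζ)⟫_ℂ =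
            ⟪g j (κ j), a (g j (κ j)) - c j • g j (κ j)⟫_ℂ * ⟪g j ζ', g j ζ⟫_ℂ -
            ⟪g j ζ', a (g j ζ) - c j • g j ζ⟫_ℂ := by
          rw [inner_sub_right, inner_sub_right, inner_smul_right, inner_smul_right,
            inner_self_eq_norm_sq_to_K, h]
          simp
          ring
        rw [e3]
        refine (norm_sub_le _ _).trans ?_
        have b1 : ‖⟪g j (κ j), a (g j (κ j)) - c j • g j (κ j)⟫_ℂ‖ ≤ ε := by
          refine (norm_inner_le_norm _ _).trans ?_
          have := hc j (κ j)
          rw [h] at this ⊢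
          linarith
        have b2 : ‖⟪g j ζ', a (g j ζ) - c j • g j ζ⟫_ℂ‖ ≤ ‖g j ζ'‖ * (ε * ‖g j ζ‖) :=
          (norm_inner_le_norm _ _).trans (mul_le_mul_of_nonneg_left (hc j ζ) (norm_nonneg _))
        have b3 : ‖⟪g j (κ j), a (g j (κ j)) - c j • g j (κ j)⟫_ℂ * ⟪g j ζ', g j ζ⟫_ℂ‖ ≤
            ε * (‖g j ζ'‖ * ‖g j ζ‖) := by
          rw [norm_mul]
          exact mul_le_mul b1 (norm_inner_le_norm _ _) (norm_nonneg _) hε.le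
        linarith
      · simp [h]
    refine (norm_sum_le_of_le _ fun j _ => bound j).trans ?_
    rw [← Finset.mul_sum]
    exact mul_le_mul_of_nonneg_left (sum_mul_le_of_sum_sq _ _ _ (norm_nonneg _) (norm_nonneg _)
      (IsSquarePartition.sum_norm_sq hg.selfAdjoint hg.sum ζ')
      (IsSquarePartition.sum_norm_sq hg.selfAdjoint hg.sum ζ)) (by positivity)

/-- For abelian `A`, a weakly continuous linear identity which holds for the elementary tensors
`a ⊗ n` with `a ∈ A`, `n ∈ N` holds for every operator commuting with `A' ⊗ 1` and `1 ⊗ N'` respectively. -/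
theorem inner_eq_of_forall_opTensor {A : VonNeumannAlgebra K} {N : VonNeumannAlgebra H}
    (hA : ∀ x ∈ A, ∀ y ∈ A, x * y = y * x)
    {T : HilbertTensor K H →L[ℂ] HilbertTensor K H}
    (hTA : ∀ a ∈ A.commutant, opTensor a 1 * T = T * opTensor a 1)
    (hTN : ∀ n ∈ N.commutant, opTensor 1 n * T = T * opTensor 1 n)
    {v₁ w₁ v₂ w₂ : HilbertTensor K H}
    (h : ∀ a ∈ A, ∀ n ∈ N, ⟪v₁, opTensor a n w₁⟫_ℂ = ⟪v₂, opTensor a n w₂⟫_ℂ) :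
    ⟪v₁, T w₁⟫_ℂ = ⟪v₂, T w₂⟫_ℂ := by
  classical
  -- A net indexed by finite sets of pairs of vectors and by precision. It converges weakly to `T`
  -- on elementary tensors, and everywhere because it is bounded.
  choose S hS1 hS2 hS3 using fun i : Finset (H × H) × ℕ =>
    exists_algebraic_approximant hA hTA hTN i.1 (ε := 1 / ((i.2 : ℝ) + 1)) (by positivity)
  have hlim : ∀ v w, Tendsto (fun i => ⟪v, (S i - T) w⟫_ℂ) atTop (𝓝 0) := by
    refine tendsto_inner_zero_of_vecTensor (fun i => S i - T) (C := ‖T‖ + ‖T‖)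
      (fun i => (norm_sub_le (S i) T).trans (by linarith [hS1 i])) fun ζ' η' ζ η => ?_
    have h0 : Tendsto (fun i : Finset (H × H) × ℕ => 2 * (1 / ((i.2 : ℝ) + 1)) * (‖ζ'‖ * ‖ζ‖))
        atTop (𝓝 0) := by
      have h1 : Tendsto (fun i : Finset (H × H) × ℕ => 1 / ((i.2 : ℝ) + 1)) atTop (𝓝 0) := by
        have := tendsto_one_div_add_atTop_nhds_zero_nat (𝕜 := ℝ)
        rw [← prod_atTop_atTop_eq]
        exact this.comp tendsto_snd
      simpa using (h1.const_mul 2).mul_const (‖ζ'‖ * ‖ζ‖)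
    refine squeeze_zero_norm' ?_ h0
    filter_upwards [eventually_ge_atTop (({(η', η)} : Finset (H × H)), 0)] with i hi
    exact hS3 i (η', η) (hi.1 (Finset.mem_singleton_self _)) ζ' ζ
  have heq : ∀ i, ⟪v₁, S i w₁⟫_ℂ = ⟪v₂, S i w₂⟫_ℂ := by
    intro i
    have hi := hS2 i
    generalize S i = X at hi ⊢
    induction hi using Submodule.span_induction with
    | mem x hx => obtain ⟨a, ha, n, hn, rfl⟩ := hx; exact h a ha n hn
    | zero => simp
    | add x y _ _ hx hy => simp only [add_apply, inner_add_right, hx, hy]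
    | smul c x _ hx => simp only [smul_apply, inner_smul_right, hx]
  have hconst : ∀ i, ⟪v₂, (S i - T) w₂⟫_ℂ - ⟪v₁, (S i - T) w₁⟫_ℂ =
      ⟪v₁, T w₁⟫_ℂ - ⟪v₂, T w₂⟫_ℂ := by
    intro i
    simp only [sub_apply, inner_sub_right, heq i]
    ring
  have := (hlim v₂ w₂).sub (hlim v₁ w₁)
  simp only [hconst, sub_zero] at this
  exact sub_eq_zero.1 (tendsto_nhds_unique tendsto_const_nhds this)

/-- The nontrivial half of the commutation theorem for abelian `A`: commuting with a fixed element
of `(A ⊗ N)'` is a weakly continuous identity, and it holds on the elementary tensors `a ⊗ n`. -/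
theorem mem_vnTensor {A : VonNeumannAlgebra K} {N : VonNeumannAlgebra H}
    (hA : ∀ x ∈ A, ∀ y ∈ A, x * y = y * x)
    {T : HilbertTensor K H →L[ℂ] HilbertTensor K H}
    (hTA : ∀ a ∈ A.commutant, opTensor a 1 * T = T * opTensor a 1)
    (hTN : ∀ n ∈ N.commutant, opTensor 1 n * T = T * opTensor 1 n) :
    T ∈ vnTensor A N := by
  refine mem_of_forall_commutant fun y hy => ?_
  ext w
  refine ext_inner_left ℂ fun v => ?_
  rw [mul_apply_eq_comp, mul_apply_eq_comp, ← inner_star_left]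
  refine inner_eq_of_forall_opTensor hA hTA hTN fun a ha n hn => ?_
  rw [inner_star_left, ← mul_apply_eq_comp, ← mul_apply_eq_comp,
    VonNeumannAlgebra.mem_commutant_iff.1 hy _ (opTensor_mem ha hn)]

end Approximation

/-! ### The standard representation, right multiplications and compression by the Jones projection
-/

section Standard

variable {H : Type*} [NormedAddCommGroup H] [InnerProductSpace ℂ H] [CompleteSpace H]

theorem starProjection_commute {U : Submodule ℂ H} [CompleteSpace U] {T : H →L[ℂ] H}
    (hT : ∀ u ∈ U, T u ∈ U) (hT' : ∀ u ∈ U, star T u ∈ U) :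
    U.starProjection * T = T * U.starProjection := by
  ext v
  rw [mul_apply_eq_comp, mul_apply_eq_comp]
  refine Submodule.eq_starProjection_of_mem_of_inner_eq_zero
    (hT _ (Submodule.starProjection_apply_mem _ _)) fun w hw => ?_
  rw [← map_sub, ← inner_star_right]
  exact Submodule.starProjection_inner_eq_zero _ _ (hT' w hw)

variable {M B : VonNeumannAlgebra H} {ξ : H}

theorem IsStandardTracial.norm_star_apply (hM : IsStandardTracial M ξ) {x : H →L[ℂ] H}
    (hx : x ∈ M) : ‖star x ξ‖ = ‖x ξ‖ := by
  have h := hM.tracial (star x) (star_mem hx) x hx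
  have h1 : ‖x ξ‖ ^ 2 = ‖star x ξ‖ ^ 2 := by
    rw [norm_sq_eq_re_inner, norm_sq_eq_re_inner, star_star, h]
  exact ((sq_eq_sq₀ (norm_nonneg _) (norm_nonneg _)).1 h1).symm

/-- `R` is the right multiplication by `m` on `L²(M)`. -/
structure IsRightMul (M : VonNeumannAlgebra H) (ξ : H) (m R : H →L[ℂ] H) : Prop where
  mem : R ∈ M.commutant
  apply : R ξ = m ξ
  star_apply : star R ξ = star m ξ

theorem IsRightMul.apply_apply {m R : H →L[ℂ] H} (h : IsRightMul M ξ m R) {x : H →L[ℂ] H}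
    (hx : x ∈ M) : R (x ξ) = x (m ξ) := by
  rw [← h.apply, ← mul_apply_eq_comp, ← mul_apply_eq_comp,
    VonNeumannAlgebra.mem_commutant_iff.1 h.mem x hx]

theorem IsRightMul.star {m R : H →L[ℂ] H} (h : IsRightMul M ξ m R) :
    IsRightMul M ξ (star m) (star R) :=
  ⟨star_mem h.mem, h.star_apply, by rw [star_star, star_star, h.apply]⟩

theorem IsStandardTracial.dense_span (hM : IsStandardTracial M ξ) {h k : H}
    (hk : ∀ x ∈ M, ⟪x ξ, h⟫_ℂ = ⟪x ξ, k⟫_ℂ) : h = k := by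
  refine hM.cyclic.eq_of_inner_right (𝕜 := ℂ) ?_
  rintro v ⟨x, hx, rfl⟩
  exact hk x hx

theorem IsStandardTracial.ext (hM : IsStandardTracial M ξ) {S T : H →L[ℂ] H}
    (h : ∀ x ∈ M, S (x ξ) = T (x ξ)) : S = T := by
  refine ContinuousLinearMap.ext fun v => ?_
  have hv : v ∈ closure {η : H | ∃ x ∈ M, η = x ξ} := hM.cyclic v
  refine closure_minimal (t := {v | S v = T v}) ?_ (isClosed_eq (by fun_prop) (by fun_prop)) hv
  rintro _ ⟨x, hx, rfl⟩
  exact h x hx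

/-- The map `x ξ ↦ x m ξ` is bounded since traciality gives `‖x m ξ‖ = ‖m* x* ξ‖ ≤ ‖m‖ ‖x* ξ‖ = ‖m‖
‖x ξ‖`. Traciality also identifies its adjoint with the map attached to `m*`. -/
theorem IsStandardTracial.exists_isRightMul (hM : IsStandardTracial M ξ) {m : H →L[ℂ] H}
    (hm : m ∈ M) : ∃ R, IsRightMul M ξ m R := by
  have key : ∀ m ∈ M, ∃ R : H →L[ℂ] H, ∀ x ∈ M, R (x ξ) = x (m ξ) := by
    intro m hm
    obtain ⟨R, hR, -, -⟩ := exists_clm_of_norm_sum_le (ι := M)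
      (fun x => (x : H →L[ℂ] H) ξ) (fun x => (x : H →L[ℂ] H) (m ξ)) (norm_nonneg m) (by
        intro s c
        set y : H →L[ℂ] H := ∑ i ∈ s, c i • (i : H →L[ℂ] H) with hy
        have hyM : y ∈ M := sum_mem fun i _ => smul_mem_vn M _ i.2
        have e : ∀ v, y v = ∑ i ∈ s, c i • (i : H →L[ℂ] H) v := fun v => by
          rw [hy, sum_apply]; rfl
        rw [← e, ← e, ← mul_apply_eq_comp, ← hM.norm_star_apply (mul_mem hyM hm),
          ← hM.norm_star_apply hyM, star_mul, mul_apply_eq_comp, ← norm_star m]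
        exact (star m).le_opNorm _)
    exact ⟨R, fun x hx => hR ⟨x, hx⟩⟩
  obtain ⟨R, hR⟩ := key m hm
  obtain ⟨R', hR'⟩ := key (star m) (star_mem hm)
  have hstar : star R = R' := by
    refine hM.ext fun x hx => hM.dense_span fun y hy => ?_
    rw [inner_star_right, hR y hy, hR' x hx]
    have h1 := hM.tracial m hm (star x * y) (mul_mem (star_mem hx) hy)
    have h2 := congrArg (starRingEnd ℂ) h1
    simp only [mul_apply_eq_comp, inner_conj_symm] at h2
    have e1 : ⟪y (m ξ), x ξ⟫_ℂ = ⟪(star x) (y (m ξ)), ξ⟫_ℂ := (inner_star_left _ _ _).symm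
    have e2 : ⟪y ξ, x (star m ξ)⟫_ℂ = ⟪m (star x (y ξ)), ξ⟫_ℂ := by
      rw [← inner_star_right m, inner_star_left x]
    rw [e1, e2, h2]
  refine ⟨R, ?_, by simpa using hR 1 (one_mem M), ?_⟩
  · rw [VonNeumannAlgebra.mem_commutant_iff]
    intro g hg
    refine hM.ext fun x hx => ?_
    have h1 := hR (g * x) (mul_mem hg hx)
    simp only [mul_apply_eq_comp] at h1 ⊢
    rw [h1, hR x hx]
  · rw [hstar]
    simpa using hR' 1 (one_mem M)

theorem apply_mem_ltwo {b : H →L[ℂ] H} (hb : b ∈ B) : b ξ ∈ ltwo B ξ :=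
  Submodule.le_topologicalClosure _ ⟨b, hb, rfl⟩

theorem coe_ltwo : (ltwo B ξ : Set H) = closure {η : H | ∃ b ∈ B, η = b ξ} := by
  rw [ltwo, Submodule.topologicalClosure_coe]
  congr 1
  ext η
  constructor
  · rintro ⟨b, hb, rfl⟩; exact ⟨b, hb, rfl⟩
  · rintro ⟨b, hb, rfl⟩; exact ⟨b, hb, rfl⟩

theorem ltwo_le {X : Submodule ℂ H} (hX : IsClosed (X : Set H)) (h : ∀ b ∈ B, b ξ ∈ X) :
    ltwo B ξ ≤ X := by
  refine Submodule.topologicalClosure_minimal _ ?_ hX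
  rintro _ ⟨b, hb, rfl⟩
  exact h b hb

theorem maps_ltwo {T : H →L[ℂ] H} (h : ∀ b ∈ B, T (b ξ) ∈ ltwo B ξ) :
    ∀ u ∈ ltwo B ξ, T u ∈ ltwo B ξ := by
  have hX : IsClosed ((ltwo B ξ).comap (T : H →ₗ[ℂ] H) : Set H) :=
    (Submodule.isClosed_topologicalClosure _).preimage T.continuous
  exact ltwo_le hX h

theorem jonesProjection_isStarProjection (B : VonNeumannAlgebra H) (ξ : H) :
    IsStarProjection (jonesProjection B ξ) := isStarProjection_starProjection

theorem star_jonesProjection (B : VonNeumannAlgebra H) (ξ : H) :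
    star (jonesProjection B ξ) = jonesProjection B ξ :=
  (jonesProjection_isStarProjection B ξ).isSelfAdjoint

theorem jonesProjection_mul_self (B : VonNeumannAlgebra H) (ξ : H) :
    jonesProjection B ξ * jonesProjection B ξ = jonesProjection B ξ :=
  (jonesProjection_isStarProjection B ξ).isIdempotentElem

theorem jonesProjection_apply_mem (h : H) : jonesProjection B ξ h ∈ ltwo B ξ :=
  Submodule.starProjection_apply_mem _ _

theorem jonesProjection_eq {h : H} (hh : h ∈ ltwo B ξ) : jonesProjection B ξ h = h :=
  Submodule.starProjection_eq_self_iff.2 hh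

theorem jonesProjection_apply_self : jonesProjection B ξ ξ = ξ :=
  jonesProjection_eq (by simpa using apply_mem_ltwo (one_mem B))

theorem jonesProjection_mem_commutant : jonesProjection B ξ ∈ B.commutant := by
  rw [VonNeumannAlgebra.mem_commutant_iff]
  intro g hg
  refine (starProjection_commute (maps_ltwo fun b hb => ?_) (maps_ltwo fun b hb => ?_)).symm
  · exact apply_mem_ltwo (mul_mem hg hb)
  · exact apply_mem_ltwo (mul_mem (star_mem hg) hb)

/-- Right multiplications by `b` and `b*` preserve `L²(B)`, so they commute with the Jones
projection as well as with `M`. -/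
theorem IsRightMul.mem_commutant_basicConstruction {b R : H →L[ℂ] H} (hBM : B ≤ M) (hb : b ∈ B)
    (h : IsRightMul M ξ b R) : R ∈ (basicConstruction M B ξ).commutant := by
  have hR : ∀ c ∈ M, R * c = c * R := fun c hc =>
    (VonNeumannAlgebra.mem_commutant_iff.1 h.mem c hc).symm
  have he : jonesProjection B ξ * R = R * jonesProjection B ξ := by
    refine starProjection_commute (maps_ltwo fun c hc => ?_) (maps_ltwo fun c hc => ?_)
    · rw [h.apply_apply (hBM hc)]
      exact apply_mem_ltwo (mul_mem hc hb)
    · rw [h.star.apply_apply (hBM hc)]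
      exact apply_mem_ltwo (mul_mem hc (star_mem hb))
  rw [VonNeumannAlgebra.mem_commutant_iff]
  intro g hg
  refine (commute_of_mem_vnGenerated hg ?_).symm
  rintro s (hs | hs)
  · exact ⟨(hR s hs).symm, (hR _ (star_mem hs)).symm⟩
  · rw [Set.mem_singleton_iff] at hs
    rw [hs, star_jonesProjection]
    exact ⟨he, he⟩

theorem mem_basicConstruction {x : H →L[ℂ] H} (hx : x ∈ M) : x ∈ basicConstruction M B ξ :=
  subset_vnGenerated (Or.inl hx)

theorem jonesProjection_mem_basicConstruction :
    jonesProjection B ξ ∈ basicConstruction M B ξ :=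
  subset_vnGenerated (Or.inr rfl)

/-- On `L²(B)`, an operator commuting with right multiplications by `B` commutes with the
compression of the commutant of `B`. -/
theorem commute_compression (hM : IsStandardTracial M ξ) (hBM : B ≤ M) {ρ s : H →L[ℂ] H}
    (hρ : jonesProjection B ξ * ρ * jonesProjection B ξ = ρ)
    (hρR : ∀ b ∈ B, ∀ R, IsRightMul M ξ b R → R * ρ = ρ * R) (hs : s ∈ B.commutant) :
    (jonesProjection B ξ * s * jonesProjection B ξ) * ρ =
      ρ * (jonesProjection B ξ * s * jonesProjection B ξ) := by
  set e := jonesProjection B ξ with he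
  have hee : ∀ v, e (e v) = e v := fun v => DFunLike.congr_fun (jonesProjection_mul_self B ξ) v
  have hes : ∀ v w, ⟪e v, w⟫_ℂ = ⟪v, e w⟫_ℂ := fun v w => by
    rw [← inner_star_left, he, star_jonesProjection]
  have heb : ∀ b ∈ B, e (b ξ) = b ξ := fun b hb => jonesProjection_eq (apply_mem_ltwo hb)
  have heB : ∀ b ∈ B, ∀ v, e (b v) = b (e v) := fun b hb v =>
    (DFunLike.congr_fun
      (VonNeumannAlgebra.mem_commutant_iff.1 jonesProjection_mem_commutant b hb) v).symm
  have hsB : ∀ b ∈ B, ∀ v, s (b v) = b (s v) := fun b hb v =>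
    (DFunLike.congr_fun (VonNeumannAlgebra.mem_commutant_iff.1 hs b hb) v).symm
  have hsB' : ∀ b ∈ B, ∀ v, star s (b v) = b (star s v) := fun b hb v =>
    (DFunLike.congr_fun (VonNeumannAlgebra.mem_commutant_iff.1 (star_mem hs) b hb) v).symm
  have hext : ∀ h k : H, e h = h → e k = k → (∀ b ∈ B, ⟪b ξ, h⟫_ℂ = ⟪b ξ, k⟫_ℂ) → h = k := by
    intro h k hh hk hb
    have h1 : ltwo B ξ ≤ (ℂ ∙ (h - k))ᗮ := ltwo_le (Submodule.isClosed_orthogonal _) fun b hb' => by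
      rw [Submodule.mem_orthogonal_singleton_iff_inner_left, inner_sub_right, hb b hb', sub_self]
    have h2 : h - k ∈ ltwo B ξ := by
      have : e (h - k) = h - k := by rw [map_sub, hh, hk]
      rw [← this]
      exact jonesProjection_apply_mem _
    have h3 := h1 h2
    rw [Submodule.mem_orthogonal_singleton_iff_inner_left, inner_self_eq_zero, sub_eq_zero] at h3
    exact h3
  have hmem : e (s ξ) ∈ closure {η : H | ∃ b ∈ B, η = b ξ} := by
    have h1 : e (s ξ) ∈ ltwo B ξ := jonesProjection_apply_mem _
    rw [← coe_ltwo]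
    exact h1
  -- The operator `e s e` sends `b ξ` to `b (e s ξ)`, so it is a right multiplication by the vector
  -- `e s ξ`, which need not come from a bounded element. It is approximated by `σ n ξ` with `σ n ∈
  -- B`; right multiplication by `σ n` is bounded and commutes with `ρ`.
  obtain ⟨u, hu, hulim⟩ := mem_closure_iff_seq_limit.1 hmem
  choose σ hσB hσ using hu
  have hσlim : Tendsto (fun n => σ n ξ) atTop (𝓝 (e (s ξ))) := by
    simpa only [← hσ] using hulim
  have hcau : CauchySeq (fun n => star (σ n) ξ) := by
    have h1 := hσlim.cauchySeq
    rw [Metric.cauchySeq_iff] at h1 ⊢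
    intro ε hε
    obtain ⟨N, hN⟩ := h1 ε hε
    refine ⟨N, fun m hm n hn => ?_⟩
    have h2 := hN m hm n hn
    rw [dist_eq_norm] at h2 ⊢
    have h3 := hM.norm_star_apply (sub_mem (hBM (hσB m)) (hBM (hσB n)))
    rw [star_sub, sub_apply, sub_apply] at h3
    rwa [h3]
  obtain ⟨t, ht⟩ := cauchySeq_tendsto_of_complete hcau
  have het : e t = t := by
    refine tendsto_nhds_unique ?_ ht
    have h1 : Tendsto (fun n => e (star (σ n) ξ)) atTop (𝓝 (e t)) :=
      (e.continuous.tendsto t).comp ht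
    exact h1.congr fun n => heb _ (star_mem (hσB n))
  -- The adjoints are approximated by the same sequence: `(σ n)* ξ` converges to `e s* ξ`.
  have htt : t = e (star s ξ) := by
    refine hext _ _ het (hee _) fun y hy => ?_
    have h1 : Tendsto (fun n => ⟪y ξ, star (σ n) ξ⟫_ℂ) atTop (𝓝 ⟪y ξ, t⟫_ℂ) :=
      (tendsto_const_nhds).inner ht
    have h2 : Tendsto (fun n => ⟪σ n ξ, star y ξ⟫_ℂ) atTop (𝓝 ⟪e (s ξ), star y ξ⟫_ℂ) :=
      hσlim.inner tendsto_const_nhds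
    have h3 : ∀ n, ⟪y ξ, star (σ n) ξ⟫_ℂ = ⟪σ n ξ, star y ξ⟫_ℂ := by
      intro n
      have := congrArg (starRingEnd ℂ) (hM.tracial _ (hBM (hσB n)) y (hBM hy))
      simp only [mul_apply_eq_comp, inner_conj_symm] at this
      rw [inner_star_right, inner_star_right, this]
    simp only [h3] at h1
    rw [tendsto_nhds_unique h1 h2, hes, heb _ (star_mem hy), ← hes, heb y hy, inner_star_right,
      ← hsB y hy, inner_star_right]
  refine sub_eq_zero.1 ?_
  set X := (e * s * e) * ρ - ρ * (e * s * e) with hX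
  have hρe : ∀ v, e (ρ v) = ρ v := fun v => by
    conv_lhs => rw [← hρ]
    conv_rhs => rw [← hρ]
    exact hee _
  have hρe' : ∀ v, ρ (e v) = ρ v := fun v => by
    conv_lhs => rw [← hρ]
    conv_rhs => rw [← hρ]
    simp only [mul_apply_eq_comp, hee]
  -- In the matrix coefficients of `ρ`, right multiplication by `σ n` passes to the other vector as
  -- right multiplication by `(σ n)*`; both sides have limits.
  have main : ∀ b ∈ B, ∀ c ∈ B, ⟪c ξ, (e * s * e) (ρ (b ξ))⟫_ℂ = ⟪c ξ, ρ ((e * s * e) (b ξ))⟫_ℂ := by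
    intro b hb c hc
    choose R hR using fun n => hM.exists_isRightMul (hBM (hσB n))
    have h1 : Tendsto (fun n => ⟪c ξ, ρ (b (σ n ξ))⟫_ℂ) atTop (𝓝 ⟪c ξ, ρ ((e * s * e) (b ξ))⟫_ℂ) := by
      have e1 : (e * s * e) (b ξ) = b (e (s ξ)) := by
        simp only [mul_apply_eq_comp, heb b hb, hsB b hb, heB b hb]
      rw [e1]
      exact tendsto_const_nhds.inner (((ρ * b).continuous.tendsto _).comp hσlim)
    have h2 : Tendsto (fun n => ⟪c (star (σ n) ξ), ρ (b ξ)⟫_ℂ) atTop (𝓝 ⟪c t, ρ (b ξ)⟫_ℂ) :=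
      ((c.continuous.tendsto _).comp ht).inner tendsto_const_nhds
    have h3 : ∀ n, ⟪c ξ, ρ (b (σ n ξ))⟫_ℂ = ⟪c (star (σ n) ξ), ρ (b ξ)⟫_ℂ := by
      intro n
      rw [← (hR n).apply_apply (hBM hb), ← (hR n).star.apply_apply (hBM hc), inner_star_left]
      have := DFunLike.congr_fun (hρR _ (hσB n) _ (hR n)) (b ξ)
      simp only [mul_apply_eq_comp] at this
      rw [this]
    simp only [h3] at h1
    rw [tendsto_nhds_unique h1 h2, htt, ← heB c hc, ← hsB' c hc, hes, inner_star_left, hρe]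
    simp only [mul_apply_eq_comp, hρe]
    rw [← hes, heb c hc]
  have hXe : ∀ v, X (e v) = X v := fun v => by
    simp only [hX, sub_apply, mul_apply_eq_comp, hρe', hee]
  have hXe' : ∀ v, e (X v) = X v := fun v => by
    simp only [hX, sub_apply, mul_apply_eq_comp, hρe, hee, map_sub]
  have h0 : ltwo B ξ ≤ LinearMap.ker (X : H →ₗ[ℂ] H) := ltwo_le X.isClosed_ker fun b hb => by
    refine hext _ _ (hXe' _) (map_zero _) fun c hc => ?_
    have := main b hb c hc
    simp only [ContinuousLinearMap.coe_coe, hX, sub_apply, inner_sub_right, inner_zero_right]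
    exact sub_eq_zero.2 this
  ext v
  rw [← hXe v]
  exact h0 (jonesProjection_apply_mem v)

theorem jonesProjection_self (hM : IsStandardTracial M ξ) : jonesProjection M ξ = 1 :=
  hM.ext fun _ hx => jonesProjection_eq (apply_mem_ltwo hx)

/-- The operators commuting with all right multiplications are the left multiplications. -/
theorem IsStandardTracial.mem_of_commute_isRightMul (hM : IsStandardTracial M ξ) {T : H →L[ℂ] H}
    (hT : ∀ m ∈ M, ∀ R, IsRightMul M ξ m R → R * T = T * R) : T ∈ M := by
  refine mem_of_forall_commutant fun y hy => ?_
  have := commute_compression (B := M) hM le_rfl (ρ := T) (s := y)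
  simp only [jonesProjection_self hM, one_mul, mul_one] at this
  exact this trivial hT hy

/-- This is `e ⟨M, e⟩ e ⊆ B e`. The compressed element commutes with right multiplications by `B`,
hence with `e B' e`; reduction for the algebra `B'` and its projection `e` lifts it to `B'' = B`. -/
theorem exists_compression_eq (hM : IsStandardTracial M ξ) (hBM : B ≤ M) {X : H →L[ℂ] H}
    (hX : X ∈ basicConstruction M B ξ) :
    ∃ b ∈ B, b * jonesProjection B ξ = jonesProjection B ξ * X * jonesProjection B ξ := by
  have hee := jonesProjection_mul_self B ξ
  have hcorner : jonesProjection B ξ * (jonesProjection B ξ * X * jonesProjection B ξ) *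
      jonesProjection B ξ = jonesProjection B ξ * X * jonesProjection B ξ := by
    simp only [mul_assoc, hee]
    simp only [← mul_assoc, hee]
  have hcomm : ∀ s ∈ B.commutant, jonesProjection B ξ * s * jonesProjection B ξ *
      (jonesProjection B ξ * X * jonesProjection B ξ) =
      jonesProjection B ξ * X * jonesProjection B ξ *
      (jonesProjection B ξ * s * jonesProjection B ξ) := fun s hs => by
    refine commute_compression hM hBM hcorner (fun b hb R hR => ?_) hs
    have h1 := VonNeumannAlgebra.mem_commutant_iff.1 (hR.mem_commutant_basicConstruction hBM hb)
    exact (h1 _ (mul_mem (mul_mem jonesProjection_mem_basicConstruction hX)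
      jonesProjection_mem_basicConstruction)).symm
  obtain ⟨b, hb, hbe, -⟩ := exists_mem_commutant_mul_eq B.commutant
    (jonesProjection_isStarProjection B ξ) jonesProjection_mem_commutant hcorner hcomm ∅ (by simp)
  rw [VonNeumannAlgebra.commutant_commutant] at hb
  exact ⟨b, hb, hbe⟩

end Standard

/-! ### Traciality, relative commutants and compressions in `A ⊗ M` -/

section TensorTrace

variable {K H : Type*} [NormedAddCommGroup K] [InnerProductSpace ℂ K] [CompleteSpace K]
  [NormedAddCommGroup H] [InnerProductSpace ℂ H] [CompleteSpace H]
  {A : VonNeumannAlgebra K} {M B N : VonNeumannAlgebra H} {ξ : H}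

theorem vnTensor_commute_left {T : HilbertTensor K H →L[ℂ] HilbertTensor K H}
    (hT : T ∈ vnTensor A N) {a : K →L[ℂ] K} (ha : a ∈ A.commutant) :
    opTensor a 1 * T = T * opTensor a 1 :=
  vnTensor_commute_opTensor hT ha (one_mem _)

theorem vnTensor_commute_right {T : HilbertTensor K H →L[ℂ] HilbertTensor K H}
    (hT : T ∈ vnTensor A N) {n : H →L[ℂ] H} (hn : n ∈ N.commutant) :
    opTensor 1 n * T = T * opTensor 1 n :=
  vnTensor_commute_opTensor hT (one_mem _) hn

theorem inner_eq_of_mem_vnTensor (hA : ∀ x ∈ A, ∀ y ∈ A, x * y = y * x)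
    {T : HilbertTensor K H →L[ℂ] HilbertTensor K H} (hT : T ∈ vnTensor A N)
    {v₁ w₁ v₂ w₂ : HilbertTensor K H}
    (h : ∀ a ∈ A, ∀ n ∈ N, ⟪v₁, opTensor a n w₁⟫_ℂ = ⟪v₂, opTensor a n w₂⟫_ℂ) :
    ⟪v₁, T w₁⟫_ℂ = ⟪v₂, T w₂⟫_ℂ :=
  inner_eq_of_forall_opTensor hA (fun _ ha => vnTensor_commute_left hT ha)
    (fun _ hn => vnTensor_commute_right hT hn) h

theorem mem_commutant_of_abelian (hA : ∀ x ∈ A, ∀ y ∈ A, x * y = y * x) {a : K →L[ℂ] K}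
    (ha : a ∈ A) : a ∈ A.commutant :=
  VonNeumannAlgebra.mem_commutant_iff.2 fun g hg => hA g hg a ha

/-- Both sides are weakly continuous in `x` and in `y` separately, so elementary tensors suffice;
there the identity is the trace property of `ξ` and commutativity of `A`. Any `ζ` will do. -/
theorem vnTensor_tracial (hA : ∀ x ∈ A, ∀ y ∈ A, x * y = y * x) (hM : IsStandardTracial M ξ)
    {x y : HilbertTensor K H →L[ℂ] HilbertTensor K H} (hx : x ∈ vnTensor A M)
    (hy : y ∈ vnTensor A M) (ζ : K) :
    ⟪vecTensor ζ ξ, (x * y) (vecTensor ζ ξ)⟫_ℂ = ⟪vecTensor ζ ξ, (y * x) (vecTensor ζ ξ)⟫_ℂ := by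
  rw [mul_apply_eq_comp, mul_apply_eq_comp, ← inner_star_left y]
  refine inner_eq_of_mem_vnTensor hA hx fun a ha m hm => ?_
  rw [inner_star_left, ← inner_star_left (opTensor a m)]
  refine inner_eq_of_mem_vnTensor hA hy fun a' ha' m' hm' => ?_
  rw [inner_star_left, ← mul_apply_eq_comp, ← mul_apply_eq_comp, opTensor_mul, opTensor_mul,
    opTensor_vecTensor, opTensor_vecTensor, inner_vecTensor, inner_vecTensor,
    hM.tracial m hm m' hm', hA a ha a' ha']

theorem vnTensor_norm_star_apply (hA : ∀ x ∈ A, ∀ y ∈ A, x * y = y * x)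
    (hM : IsStandardTracial M ξ) {x : HilbertTensor K H →L[ℂ] HilbertTensor K H}
    (hx : x ∈ vnTensor A M) (ζ : K) : ‖star x (vecTensor ζ ξ)‖ = ‖x (vecTensor ζ ξ)‖ := by
  have h1 : ‖star x (vecTensor ζ ξ)‖ ^ 2 = ‖x (vecTensor ζ ξ)‖ ^ 2 := by
    rw [norm_sq_eq_re_inner, norm_sq_eq_re_inner, star_star,
      vnTensor_tracial hA hM hx (star_mem hx)]
  exact (sq_eq_sq₀ (norm_nonneg _) (norm_nonneg _)).1 h1

theorem ext_vecTensor_mul (hM : IsStandardTracial M ξ)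
    {S T : HilbertTensor K H →L[ℂ] HilbertTensor K H}
    (h : ∀ ζ, ∀ m ∈ M, S (vecTensor ζ (m ξ)) = T (vecTensor ζ (m ξ))) : S = T := by
  refine ext_vecTensor fun ζ η => ?_
  have hη : η ∈ closure {η : H | ∃ x ∈ M, η = x ξ} := hM.cyclic η
  refine closure_minimal (t := {η | S (vecTensor ζ η) = T (vecTensor ζ η)}) ?_ ?_ hη
  · rintro _ ⟨x, hx, rfl⟩
    exact h ζ x hx
  · exact isClosed_eq (S.continuous.comp (leftTensor ζ).continuous)
      (T.continuous.comp (leftTensor ζ).continuous)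

/-- The vectors `ζ ⊗ ξ` are jointly separating: operators `1 ⊗ R_m`, with `R_m` a right
multiplication, commute with `x` and carry `ζ ⊗ ξ` to `ζ ⊗ m ξ`. -/
theorem vnTensor_eq_zero (hM : IsStandardTracial M ξ)
    {x : HilbertTensor K H →L[ℂ] HilbertTensor K H} (hx : x ∈ vnTensor A M)
    (h : ∀ ζ, x (vecTensor ζ ξ) = 0) : x = 0 := by
  refine ext_vecTensor_mul hM fun ζ m hm => ?_
  obtain ⟨R, hR⟩ := hM.exists_isRightMul hm
  have h1 := DFunLike.congr_fun (vnTensor_commute_right hx hR.mem) (vecTensor ζ ξ)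
  simp only [mul_apply_eq_comp, opTensor_vecTensor, one_apply_eq_self, hR.apply, h, map_zero] at h1
  rw [← h1]
  rfl

theorem sliceLeft_apply_commute {T : HilbertTensor K H →L[ℂ] HilbertTensor K H} {n : H →L[ℂ] H}
    (h : ∀ ζ' ζ, n * sliceLeft ζ' ζ T = sliceLeft ζ' ζ T * n) :
    opTensor 1 n * T = T * opTensor 1 n := by
  refine ext_vecTensor fun ζ η => ext_inner_vecTensor fun ζ' η' => ?_
  have h3 := congrArg (fun v => ⟪η', v⟫_ℂ) (DFunLike.congr_fun (h ζ' ζ) η)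
  simp only [mul_apply_eq_comp] at h3
  rw [inner_sliceLeft, ← inner_star_left n, inner_sliceLeft] at h3
  rw [mul_apply_eq_comp, mul_apply_eq_comp, ← inner_star_left, star_opTensor]
  simpa using h3

theorem mem_vnTensor_of_commute_isRightMul (hA : ∀ x ∈ A, ∀ y ∈ A, x * y = y * x)
    (hM : IsStandardTracial M ξ) {T : HilbertTensor K H →L[ℂ] HilbertTensor K H}
    (hTA : ∀ a ∈ A.commutant, opTensor a 1 * T = T * opTensor a 1)
    (hTM : ∀ m ∈ M, ∀ R, IsRightMul M ξ m R → opTensor 1 R * T = T * opTensor 1 R) :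
    T ∈ vnTensor A M := by
  have hslice : ∀ ζ' ζ, sliceLeft ζ' ζ T ∈ M := fun ζ' ζ =>
    hM.mem_of_commute_isRightMul fun m hm R hR => by
      ext η
      refine ext_inner_left ℂ fun η' => ?_
      have h1 := DFunLike.congr_fun (hTM m hm R hR) (vecTensor ζ η)
      simp only [mul_apply_eq_comp, opTensor_vecTensor, one_apply_eq_self] at h1
      rw [mul_apply_eq_comp, mul_apply_eq_comp, inner_sliceLeft, ← inner_star_left,
        inner_sliceLeft, ← h1, ← inner_star_left (opTensor _ _), star_opTensor]
      simp
  exact mem_vnTensor hA hTA fun n hn => sliceLeft_apply_commute fun ζ' ζ =>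
    (VonNeumannAlgebra.mem_commutant_iff.1 hn _ (hslice ζ' ζ)).symm

/-- The relative commutant of `A ⊗ B` in `A ⊗ M` lies in `A ⊗ B`. -/
theorem vnTensor_relCommutant_le (hA : ∀ x ∈ A, ∀ y ∈ A, x * y = y * x)
    (hB : relCommutant B M ≤ B) {c : HilbertTensor K H →L[ℂ] HilbertTensor K H}
    (hc : c ∈ vnTensor A M) (hcB : c ∈ (vnTensor A B).commutant) : c ∈ vnTensor A B := by
  -- Slicing reduces the claim to the hypothesis `B' ∩ M ⊆ B`.
  have hslice : ∀ ζ' ζ, sliceLeft ζ' ζ c ∈ B := fun ζ' ζ => by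
    refine hB ⟨?_, sliceLeft_mem (fun n hn => vnTensor_commute_right hc hn) ζ' ζ⟩
    refine sliceLeft_mem (N := B.commutant) (fun n hn => ?_) ζ' ζ
    rw [VonNeumannAlgebra.commutant_commutant] at hn
    exact VonNeumannAlgebra.mem_commutant_iff.1 hcB _ (opTensor_mem (one_mem A) hn)
  refine mem_vnTensor hA (fun a ha => vnTensor_commute_left hc ha) fun n hn =>
    sliceLeft_apply_commute fun ζ' ζ => ?_
  exact (VonNeumannAlgebra.mem_commutant_iff.1 hn _ (hslice ζ' ζ)).symm

/-- Reduction writes `c = c' q` with `c' ∈ (A ⊗ B)'`. Keeping track of `(A ⊗ M)'` as a set of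
operators that still commute with `c'` puts `c'` in `A ⊗ M`, so in the relative commutant, which
lies in `A ⊗ B`. -/
theorem mem_vnTensor_of_commute_corner (hA : ∀ x ∈ A, ∀ y ∈ A, x * y = y * x) (hBM : B ≤ M)
    (hB : relCommutant B M ≤ B) {q c : HilbertTensor K H →L[ℂ] HilbertTensor K H}
    (hq : IsStarProjection q) (hqB : q ∈ vnTensor A B) (hc : c ∈ vnTensor A M)
    (hqc : q * c * q = c)
    (hcomm : ∀ x ∈ vnTensor A B, (q * x * q) * c = c * (q * x * q)) : c ∈ vnTensor A B := by
  have hle : vnTensor A B ≤ vnTensor A M := vnTensor_mono hBM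
  have hT' : ∀ t ∈ (vnTensor A M).commutant, t ∈ (vnTensor A B).commutant ∧ t * c = c * t ∧
      star t ∈ (vnTensor A M).commutant := fun t ht =>
    ⟨VonNeumannAlgebra.mem_commutant_iff.2 fun g hg =>
      VonNeumannAlgebra.mem_commutant_iff.1 ht g (hle hg),
      (VonNeumannAlgebra.mem_commutant_iff.1 ht c hc).symm, star_mem ht⟩
  obtain ⟨c', hc', hcq, hT⟩ := exists_mem_commutant_mul_eq (vnTensor A B) hq hqB hqc hcomm
    ((vnTensor A M).commutant : Set _) hT'
  have hc'M : c' ∈ vnTensor A M := mem_of_forall_commutant hT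
  rw [← hcq]
  exact mul_mem (vnTensor_relCommutant_le hA hB hc'M hc') hqB

theorem opTensor_jones_mem_commutant :
    opTensor 1 (jonesProjection B ξ) ∈ (vnTensor A B).commutant :=
  mem_commutant_vnTensor fun a _ b hb => by
    rw [opTensor_mul, opTensor_mul, one_mul, mul_one,
      VonNeumannAlgebra.mem_commutant_iff.1 jonesProjection_mem_commutant b hb]

theorem opTensor_jones_isStarProjection :
    IsStarProjection (opTensor (1 : K →L[ℂ] K) (jonesProjection B ξ)) :=
  ⟨by rw [IsIdempotentElem, opTensor_mul, jonesProjection_mul_self, one_mul],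
    by rw [IsSelfAdjoint, star_opTensor, star_jonesProjection, star_one]⟩

/-- `E (A ⊗ ⟨M, e⟩) E = (A ⊗ B) E` for `E = 1 ⊗ e`. -/
theorem exists_vnTensor_compression_eq (hA : ∀ x ∈ A, ∀ y ∈ A, x * y = y * x)
    (hM : IsStandardTracial M ξ) (hBM : B ≤ M)
    {X : HilbertTensor K H →L[ℂ] HilbertTensor K H}
    (hX : X ∈ vnTensor A (basicConstruction M B ξ)) :
    ∃ b ∈ vnTensor A B, b * opTensor 1 (jonesProjection B ξ) =
      opTensor 1 (jonesProjection B ξ) * X * opTensor 1 (jonesProjection B ξ) := by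
  set E : HilbertTensor K H →L[ℂ] HilbertTensor K H := opTensor 1 (jonesProjection B ξ) with hE
  have hEp : IsStarProjection E := opTensor_jones_isStarProjection
  have hEE : E * E = E := hEp.isIdempotentElem
  have hEs : star E = E := hEp.isSelfAdjoint
  have hEB : E ∈ (vnTensor A B).commutant := opTensor_jones_mem_commutant
  have hcorner : E * (E * X * E) * E = E * X * E := by
    simp only [mul_assoc, hEE]
    simp only [← mul_assoc, hEE]
  have hcomm : ∀ s ∈ (vnTensor A B).commutant, E * s * E * (E * X * E) = E * X * E * (E * s * E) := by
    intro s hs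
    have e1 : E * s * E * (E * X * E) = (E * s * E) * X * E := by
      simp only [mul_assoc]
      rw [← mul_assoc E E, hEE]
    have e2 : E * X * E * (E * s * E) = E * X * (E * s * E) := by
      simp only [mul_assoc]
      rw [← mul_assoc E E, hEE]
    rw [e1, e2]
    ext w
    refine ext_inner_left ℂ fun v => ?_
    change ⟪v, (E * s * E) (X (E w))⟫_ℂ = ⟪v, E (X ((E * s * E) w))⟫_ℂ
    rw [← inner_star_left, ← inner_star_left E]
    -- The identity is weakly continuous in `X`. On `a ⊗ n` the compression is `(a ⊗ b) E` with `b ∈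
    -- B`, and both `s` and `E` commute with `a ⊗ b`.
    refine inner_eq_of_mem_vnTensor hA hX fun a ha n hn => ?_
    rw [inner_star_left, inner_star_left]
    obtain ⟨b, hb, hbe⟩ := exists_compression_eq hM hBM hn
    have h1 : E * opTensor a n * E = opTensor a b * E := by
      rw [hE, opTensor_mul, opTensor_mul, opTensor_mul, hbe, one_mul, mul_one]
    have hab : opTensor a b ∈ vnTensor A B := opTensor_mem ha hb
    have h2 : opTensor a b * E = E * opTensor a b := VonNeumannAlgebra.mem_commutant_iff.1 hEB _ hab
    have h3 : opTensor a b * s = s * opTensor a b := VonNeumannAlgebra.mem_commutant_iff.1 hs _ hab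
    have h4 : (E * s * E) * opTensor a n * E = E * opTensor a n * (E * s * E) := by
      calc (E * s * E) * opTensor a n * E = E * s * (E * opTensor a n * E) := by
            simp only [mul_assoc]
        _ = E * (s * opTensor a b) * E := by rw [h1]; simp only [mul_assoc]
        _ = (E * opTensor a b) * s * E := by rw [← h3]; simp only [mul_assoc]
        _ = opTensor a b * E * (s * E) := by rw [← h2]; simp only [mul_assoc]
        _ = E * opTensor a n * E * (s * E) := by rw [← h1]
        _ = _ := by simp only [mul_assoc]
    exact congrArg (fun x => ⟪v, x⟫_ℂ) (DFunLike.congr_fun h4 w)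
  obtain ⟨b, hb, hbe, -⟩ := exists_mem_commutant_mul_eq (vnTensor A B).commutant hEp hEB hcorner
    hcomm ∅ (by simp)
  rw [VonNeumannAlgebra.commutant_commutant] at hb
  exact ⟨b, hb, hbe⟩

end TensorTrace

/-! ### Averaging over a unitary group by the element of minimal norm -/

section Averaging

variable {𝓗 : Type*} [NormedAddCommGroup 𝓗] [InnerProductSpace ℂ 𝓗] [CompleteSpace 𝓗]

theorem exists_min_norm_of_convex {S : Set 𝓗} (hne : S.Nonempty) (hcl : IsClosed S)
    (hconv : Convex ℝ S) : ∃ h ∈ S, (∀ w ∈ S, ‖h‖ ≤ ‖w‖) ∧ ∀ w ∈ S, ‖w‖ ≤ ‖h‖ → w = h := by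
  let _ : InnerProductSpace ℝ 𝓗 := InnerProductSpace.complexToReal
  obtain ⟨h, hh, hmin⟩ := exists_norm_eq_iInf_of_complete_convex hne hcl.isComplete hconv (0 : 𝓗)
  have hle : ∀ w ∈ S, ‖h‖ ≤ ‖w‖ := by
    intro w hw
    have h1 : (⨅ w : S, ‖(0 : 𝓗) - w‖) ≤ ‖(0 : 𝓗) - w‖ :=
      ciInf_le ⟨0, by rintro _ ⟨w, rfl⟩; exact norm_nonneg _⟩ (⟨w, hw⟩ : S)
    rw [← hmin] at h1
    simpa using h1
  refine ⟨h, hh, hle, fun w hw hwh => ?_⟩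
  have hmid : (2⁻¹ : ℝ) • w + (2⁻¹ : ℝ) • h ∈ S := hconv hw hh (by norm_num) (by norm_num) (by norm_num)
  have h1 := hle _ hmid
  rw [← smul_add, norm_smul, Real.norm_of_nonneg (by norm_num)] at h1
  have h2 := parallelogram_law_with_norm ℝ w h
  have h3 : ‖w - h‖ = 0 := by
    have h4 := norm_nonneg h
    have h5 := norm_nonneg w
    nlinarith [norm_nonneg (w - h), norm_nonneg (w + h)]
  exact sub_eq_zero.1 (norm_eq_zero.1 h3)

theorem convex_setOf_conj_mem (S : Set (𝓗 →L[ℂ] 𝓗)) (v : 𝓗 →L[ℂ] 𝓗) :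
    Convex ℝ {y | v * y * star v ∈ convexHull ℝ S} := by
  intro a ha b hb s t hs ht hst
  have h1 : v * (s • a + t • b) * star v = s • (v * a * star v) + t • (v * b * star v) := by
    simp [mul_add, add_mul]
  change v * (s • a + t • b) * star v ∈ convexHull ℝ S
  rw [h1]
  exact convex_convexHull ℝ _ ha hb hs ht hst

theorem conj_mem_convexHull {S : Set (𝓗 →L[ℂ] 𝓗)} {v : 𝓗 →L[ℂ] 𝓗}
    (h : ∀ y ∈ S, v * y * star v ∈ convexHull ℝ S) :
    ∀ y ∈ convexHull ℝ S, v * y * star v ∈ convexHull ℝ S := by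
  intro y hy
  have h1 := convexHull_min (t := {y | v * y * star v ∈ convexHull ℝ S}) (fun y hy => by
    rw [Set.mem_ofPred_eq]; exact h y hy) (convex_setOf_conj_mem S v) hy
  rwa [Set.mem_ofPred_eq] at h1

theorem convex_setOf_mul_eq_zero (d : 𝓗 →L[ℂ] 𝓗) : Convex ℝ {y : 𝓗 →L[ℂ] 𝓗 | d * y = 0} := by
  intro a ha b hb s t _ _ _
  change d * (s • a + t • b) = 0
  change d * a = 0 at ha
  change d * b = 0 at hb
  rw [mul_add, mul_smul_comm, mul_smul_comm, ha, hb, smul_zero, smul_zero, add_zero]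

/-- Averaging a positive element over a group of unitaries, with respect to a trace vector. -/
theorem exists_average {𝔐 : VonNeumannAlgebra 𝓗} {Ω : 𝓗}
    (htr : ∀ x ∈ 𝔐, ∀ y ∈ 𝔐, ⟪Ω, (x * y) Ω⟫_ℂ = ⟪Ω, (y * x) Ω⟫_ℂ)
    {𝒢 : Set (𝓗 →L[ℂ] 𝓗)} (h𝒢M : ∀ u ∈ 𝒢, u ∈ 𝔐)
    (h𝒢u : ∀ u ∈ 𝒢, star u * u = 1 ∧ u * star u = 1) (h𝒢1 : 1 ∈ 𝒢)
    (h𝒢mul : ∀ u ∈ 𝒢, ∀ v ∈ 𝒢, u * v ∈ 𝒢)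
    {x : 𝓗 →L[ℂ] 𝓗} (hx : x ∈ 𝔐) (hx0 : 0 ≤ x) {g : 𝓗}
    (hg : g ∈ closure {v | ∃ X ∈ 𝔐.commutant, v = X Ω})
    (hgx : ∀ u ∈ 𝒢, ⟪g, (u * x * star u) g⟫_ℂ = ⟪g, x g⟫_ℂ) :
    ∃ c ∈ 𝔐, 0 ≤ c ∧ (∀ u ∈ 𝒢, u * c = c * u) ∧ ⟪Ω, c Ω⟫_ℂ = ⟪Ω, x Ω⟫_ℂ ∧
      ⟪g, c g⟫_ℂ = ⟪g, x g⟫_ℂ ∧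
      ∀ d : 𝓗 →L[ℂ] 𝓗, (∀ u ∈ 𝒢, d * u = u * d) → d * x = 0 → d * c = 0 := by
  classical
  have hnstar : ∀ z ∈ 𝔐, ‖star z Ω‖ = ‖z Ω‖ := fun z hz => by
    have h1 : ‖star z Ω‖ ^ 2 = ‖z Ω‖ ^ 2 := by
      rw [norm_sq_eq_re_inner, norm_sq_eq_re_inner, star_star, htr z hz _ (star_mem hz)]
    exact (sq_eq_sq₀ (norm_nonneg _) (norm_nonneg _)).1 h1
  have hunorm : ∀ u ∈ 𝒢, ∀ v, ‖u v‖ = ‖v‖ := fun u hu v => by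
    have h1 : ‖u v‖ ^ 2 = ‖v‖ ^ 2 := by
      rw [norm_sq_eq_re_inner, (h𝒢u u hu).1, one_apply_eq_self, inner_self_eq_norm_sq]
    exact (sq_eq_sq₀ (norm_nonneg _) (norm_nonneg _)).1 h1
  have hconjnorm : ∀ u ∈ 𝒢, ∀ z ∈ 𝔐, ‖(u * z * star u) Ω‖ = ‖z Ω‖ := fun u hu z hz => by
    rw [mul_assoc, mul_apply_eq_comp, hunorm u hu, ← hnstar _ (mul_mem hz (star_mem (h𝒢M u hu))),
      star_mul, star_star, mul_apply_eq_comp, hunorm u hu, hnstar z hz]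
  have hcomm : ∀ y ∈ 𝔐, ∀ X ∈ 𝔐.commutant, ∀ v, y (X v) = X (y v) := fun y hy X hX v =>
    DFunLike.congr_fun (VonNeumannAlgebra.mem_commutant_iff.1 hX y hy) v
  -- the subspace generated by the commutant
  let U₀ : Submodule ℂ 𝓗 :=
    { carrier := {v | ∃ X ∈ 𝔐.commutant, v = X Ω}
      add_mem' := by
        rintro _ _ ⟨X, hX, rfl⟩ ⟨Y, hY, rfl⟩; exact ⟨X + Y, add_mem hX hY, rfl⟩
      zero_mem' := ⟨0, zero_mem _, rfl⟩
      smul_mem' := by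
        rintro c _ ⟨X, hX, rfl⟩; exact ⟨c • X, smul_mem_vn _ c hX, rfl⟩ }
  let U : Submodule ℂ 𝓗 := U₀.topologicalClosure
  have : CompleteSpace U := inferInstanceAs (CompleteSpace (Submodule.topologicalClosure _))
  have hU : ∀ X ∈ 𝔐.commutant, X Ω ∈ U := fun X hX =>
    Submodule.le_topologicalClosure _ ⟨X, hX, rfl⟩
  have hUle : ∀ {W : Submodule ℂ 𝓗}, IsClosed (W : Set 𝓗) →
      (∀ X ∈ 𝔐.commutant, X Ω ∈ W) → U ≤ W := fun hW h =>
    Submodule.topologicalClosure_minimal _ (by rintro _ ⟨X, hX, rfl⟩; exact h X hX) hW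
  have hUmap : ∀ T : 𝓗 →L[ℂ] 𝓗, (∀ X ∈ 𝔐.commutant, T (X Ω) ∈ U) → ∀ v ∈ U, T v ∈ U :=
    fun T hT => hUle (W := U.comap (T : 𝓗 →ₗ[ℂ] 𝓗))
      ((Submodule.isClosed_topologicalClosure _).preimage T.continuous) hT
  set z := U.starProjection with hz
  have hzz : IsStarProjection z := isStarProjection_starProjection
  have hzs : star z = z := hzz.isSelfAdjoint
  have hz1 : ∀ v ∈ U, z v = v := fun v hv => Submodule.starProjection_eq_self_iff.2 hv
  have hzU : ∀ v, z v ∈ U := fun v => Submodule.starProjection_apply_mem _ _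
  have hzM : z ∈ 𝔐 := mem_of_forall_commutant fun X hX =>
    (starProjection_commute
      (hUmap _ fun Y hY => hU _ (mul_mem hX hY))
      (hUmap _ fun Y hY => hU _ (mul_mem (star_mem hX) hY))).symm
  have hΩU : Ω ∈ U := by simpa using hU 1 (one_mem _)
  -- By traciality `‖(1 - z) y Ω‖ = ‖y* (1 - z) Ω‖ = 0`, so `𝔐 Ω` lies in the closure of `𝔐' Ω`.
  have hMΩ : ∀ y ∈ 𝔐, y Ω ∈ U := by
    intro y hy
    have h1 : ‖((1 - z) * y) Ω‖ ^ 2 = 0 := by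
      rw [← hnstar _ (mul_mem (sub_mem (one_mem _) hzM) hy), norm_sq_eq_re_inner, star_star,
        star_mul, star_sub, star_one, hzs]
      have h2 : (1 - z) * (1 - z) = 1 - z := hzz.one_sub.isIdempotentElem
      rw [mul_assoc, ← mul_assoc y, htr _ (sub_mem (one_mem _) hzM) _
        (mul_mem (mul_mem hy (star_mem hy)) (sub_mem (one_mem _) hzM)), mul_assoc (y * star y), h2,
        mul_apply_eq_comp, sub_apply, one_apply_eq_self, hz1 Ω hΩU, sub_self, map_zero,
        inner_zero_right, map_zero]
    have h2 : ((1 - z) * y) Ω = 0 := norm_eq_zero.1 (pow_eq_zero_iff two_ne_zero |>.1 h1)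
    rw [mul_apply_eq_comp, sub_apply, one_apply_eq_self, sub_eq_zero] at h2
    rw [h2]
    exact hzU _
  have hMU : ∀ y ∈ 𝔐, ∀ v ∈ U, y v ∈ U := fun y hy => hUmap y fun X hX => by
    rw [hcomm y hy X hX]
    exact hUmap X (fun Y hY => hU _ (mul_mem hX hY)) _ (hMΩ y hy)
  -- the convex hull of the orbit
  set C := convexHull ℝ {y | ∃ u ∈ 𝒢, y = u * x * star u} with hC
  have hxC : x ∈ C := subset_convexHull ℝ _ ⟨1, h𝒢1, by simp⟩
  have hCind : ∀ {W : Set (𝓗 →L[ℂ] 𝓗)}, Convex ℝ W → (∀ u ∈ 𝒢, u * x * star u ∈ W) →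
      ∀ y ∈ C, y ∈ W := fun hW h => convexHull_min (by rintro _ ⟨u, hu, rfl⟩; exact h u hu) hW
  have hrsmul : ∀ (r : ℝ) (y : 𝓗 →L[ℂ] 𝓗), r • y = (r : ℂ) • y := fun r y =>
    (Complex.coe_smul r y).symm
  have hCM : ∀ y ∈ C, y ∈ 𝔐 := hCind
    (fun a ha b hb s t _ _ _ => by
      rw [hrsmul, hrsmul]; exact add_mem (smul_mem_vn _ _ ha) (smul_mem_vn _ _ hb))
    fun u hu => mul_mem (mul_mem (h𝒢M u hu) hx) (star_mem (h𝒢M u hu))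
  have hC0 : ∀ y ∈ C, 0 ≤ y := hCind (convex_Ici (𝕜 := ℝ) (0 : 𝓗 →L[ℂ] 𝓗))
    fun u _ => star_right_conjugate_nonneg hx0 u
  have hCnorm : ∀ y ∈ C, ‖y‖ ≤ ‖x‖ := fun y hy => by
    have := hCind (W := Metric.closedBall 0 ‖x‖) (convex_closedBall _ _) (fun u hu => by
      rw [mem_closedBall_zero_iff]
      refine ContinuousLinearMap.opNorm_le_bound _ (norm_nonneg _) fun v => ?_
      have h1 : ‖star u v‖ = ‖v‖ := by
        rw [← hunorm u hu (star u v), ← mul_apply_eq_comp, (h𝒢u u hu).2, one_apply_eq_self]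
      rw [mul_apply_eq_comp, mul_apply_eq_comp, hunorm u hu, ← h1]
      exact x.le_opNorm _) y hy
    rwa [mem_closedBall_zero_iff] at this
  have hCinner : ∀ k : 𝓗, (∀ u ∈ 𝒢, ⟪k, (u * x * star u) k⟫_ℂ = ⟪k, x k⟫_ℂ) → ∀ y ∈ C,
      ⟪k, y k⟫_ℂ = ⟪k, x k⟫_ℂ := fun k hk => hCind (W := {y | ⟪k, y k⟫_ℂ = ⟪k, x k⟫_ℂ})
    (fun a ha b hb s t _ _ hst => by
      change ⟪k, (s • a + t • b) k⟫_ℂ = ⟪k, x k⟫_ℂ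
      rw [hrsmul, hrsmul, add_apply, smul_apply, smul_apply, inner_add_right, inner_smul_right,
        inner_smul_right, ha, hb, ← add_mul, ← Complex.ofReal_add, hst, Complex.ofReal_one,
        one_mul]) hk
  have horbit : ∀ u ∈ 𝒢, u * x * star u ∈ C := fun u hu => subset_convexHull ℝ _ ⟨u, hu, rfl⟩
  have hCconj : ∀ v ∈ 𝒢, ∀ y ∈ C, v * y * star v ∈ C := fun v hv => conj_mem_convexHull (by
    rintro _ ⟨u, hu, rfl⟩
    have h1 : v * (u * x * star u) * star v = v * u * x * star (v * u) := by
      rw [star_mul]; simp only [mul_assoc]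
    rw [h1]
    exact horbit _ (h𝒢mul v hv u hu))
  have hCd : ∀ d : 𝓗 →L[ℂ] 𝓗, (∀ u ∈ 𝒢, d * u = u * d) → d * x = 0 → ∀ y ∈ C, d * y = 0 :=
    fun d hd hdx => hCind (convex_setOf_mul_eq_zero d) fun u hu => by
      change d * (u * x * star u) = 0
      rw [mul_assoc, ← mul_assoc d, hd u hu, mul_assoc, ← mul_assoc d, hdx, zero_mul, mul_zero]
  -- the minimal element
  set S := closure (Set.image (fun y : 𝓗 →L[ℂ] 𝓗 => y Ω) C) with hS
  have hSconv : Convex ℝ S := by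
    refine Convex.closure ?_
    exact (convex_convexHull ℝ _).is_linear_image ⟨fun a b => rfl, fun a b => rfl⟩
  obtain ⟨h, hh, -, hhuniq⟩ := exists_min_norm_of_convex (S := S)
    ⟨x Ω, subset_closure ⟨x, hxC, rfl⟩⟩ isClosed_closure hSconv
  obtain ⟨w, hw, hwlim⟩ := mem_closure_iff_seq_limit.1 hh
  choose y hyC hyw using hw
  have hylim : Tendsto (fun n => y n Ω) atTop (𝓝 h) := by
    have : (fun n => y n Ω) = w := funext hyw
    rwa [this]
  -- Conjugation by `v` preserves the norms `‖a Ω‖` for `a ∈ 𝔐`. The conjugated sequence therefore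
  -- converges to a point of `S` of the same norm as `h`, and the minimal vector is unique.
  have hyconj : ∀ v ∈ 𝒢, Tendsto (fun n => (v * y n * star v) Ω) atTop (𝓝 h) := by
    intro v hv
    have hcau : CauchySeq (fun n => (v * y n * star v) Ω) := by
      have h1 := hylim.cauchySeq
      rw [Metric.cauchySeq_iff] at h1 ⊢
      intro ε hε
      obtain ⟨N, hN⟩ := h1 ε hε
      refine ⟨N, fun m hm n hn => ?_⟩
      have h2 := hN m hm n hn
      rw [dist_eq_norm] at h2 ⊢
      have h3 := hconjnorm v hv _ (sub_mem (hCM _ (hyC m)) (hCM _ (hyC n)))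
      rw [mul_sub, sub_mul, sub_apply, sub_apply] at h3
      rwa [h3]
    obtain ⟨h', hh'⟩ := cauchySeq_tendsto_of_complete hcau
    have h1 : h' ∈ S := mem_closure_of_tendsto hh'
      (Eventually.of_forall fun n => ⟨_, hCconj v hv _ (hyC n), rfl⟩)
    have h2 : ‖h'‖ = ‖h‖ := by
      refine tendsto_nhds_unique hh'.norm ?_
      exact hylim.norm.congr fun n => (hconjnorm v hv _ (hCM _ (hyC n))).symm
    rwa [← hhuniq h' h1 h2.le]
  -- the operator
  let xf : 𝔐.commutant → 𝓗 := fun X => (X : 𝓗 →L[ℂ] 𝓗) Ω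
  obtain ⟨c, hc1, hc2, hc3⟩ := exists_clm_of_norm_sum_le xf
    (fun X => (X : 𝓗 →L[ℂ] 𝓗) h) (norm_nonneg x) (by
      intro s a
      set Y : 𝓗 →L[ℂ] 𝓗 := ∑ i ∈ s, a i • (i : 𝓗 →L[ℂ] 𝓗) with hY
      have hYM : Y ∈ 𝔐.commutant := sum_mem fun i _ => smul_mem_vn _ _ i.2
      have e : ∀ v, Y v = ∑ i ∈ s, a i • (i : 𝓗 →L[ℂ] 𝓗) v := fun v => by
        rw [hY, sum_apply]; rfl
      change ‖∑ i ∈ s, a i • (i : 𝓗 →L[ℂ] 𝓗) h‖ ≤ ‖x‖ * ‖∑ i ∈ s, a i • (i : 𝓗 →L[ℂ] 𝓗) Ω‖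
      rw [← e, ← e]
      refine le_of_tendsto (((Y.continuous.tendsto h).comp hylim).norm)
        (Eventually.of_forall fun n => ?_)
      rw [Function.comp_apply, ← hcomm _ (hCM _ (hyC n)) Y hYM]
      exact (y n).le_of_opNorm_le (hCnorm _ (hyC n)) _)
  have hcX : ∀ X ∈ 𝔐.commutant, c (X Ω) = X h := fun X hX => hc1 ⟨X, hX⟩
  have hcΩ : c Ω = h := by simpa using hcX 1 (one_mem _)
  have hcM : c ∈ 𝔐 := by
    refine mem_of_forall_commutant fun X hX => ?_
    refine (commute_of_family xf hc2 (fun Y => ?_) fun v hv Y => ?_).symm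
    · have h1 := hcX _ (mul_mem hX Y.2)
      have h2 := hcX _ Y.2
      simp only [mul_apply_eq_comp] at h1
      change c (X ((Y : 𝓗 →L[ℂ] 𝓗) Ω)) = X (c ((Y : 𝓗 →L[ℂ] 𝓗) Ω))
      rw [h1, h2]
    · rw [← inner_star_left]
      exact hv ⟨star X * Y, mul_mem (star_mem hX) Y.2⟩
  have horth : ∀ v, (∀ X : 𝔐.commutant, ⟪xf X, v⟫_ℂ = 0) → ∀ u ∈ U, ⟪u, v⟫_ℂ = 0 := by
    intro v hv u hu
    have h1 : U ≤ (ℂ ∙ v)ᗮ := hUle (Submodule.isClosed_orthogonal _) fun X hX => by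
      rw [Submodule.mem_orthogonal_singleton_iff_inner_left]
      exact hv ⟨X, hX⟩
    exact Submodule.mem_orthogonal_singleton_iff_inner_left.1 (h1 hu)
  -- The averages converge strongly to `c` only on `U`. This is why `g` is required to lie in the
  -- closure of `𝔐' Ω`, and it is how positivity, invariance and the annihilation by `d` pass to the
  -- limit.
  have hclim : ∀ v ∈ U, Tendsto (fun n => y n v) atTop (𝓝 (c v)) := by
    intro v hv
    have hcl : IsClosed {v | Tendsto (fun n => (y n - c) v) atTop (𝓝 0)} :=
      isClosed_setOf_tendsto_zero (fun n v => (y n - c) v) (C := ‖x‖ + ‖x‖) fun n v w => by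
        rw [← map_sub]
        refine (y n - c).le_of_opNorm_le ((norm_sub_le _ _).trans ?_) _
        linarith [hCnorm _ (hyC n)]
    have h1 : v ∈ {v | Tendsto (fun n => (y n - c) v) atTop (𝓝 0)} := by
      refine closure_minimal (s := (U₀ : Set 𝓗)) ?_ hcl hv
      rintro _ ⟨X, hX, rfl⟩
      have h2 : Tendsto (fun n => X (y n Ω) - X h) atTop (𝓝 0) := by
        rw [tendsto_sub_nhds_zero_iff]
        exact (X.continuous.tendsto h).comp hylim
      refine h2.congr fun n => ?_
      rw [sub_apply, hcX X hX, hcomm _ (hCM _ (hyC n)) X hX]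
    exact tendsto_sub_nhds_zero_iff.1 h1
  have hczv : ∀ v, c (v - z v) = 0 := fun v => hc2 _ fun X =>
    (Submodule.mem_orthogonal _ _).1 (Submodule.sub_starProjection_mem_orthogonal v) _
      (hU X X.2)
  refine ⟨c, hcM, ?_, fun u hu => ?_, ?_, ?_, fun d hd hdx => ?_⟩
  · rw [ContinuousLinearMap.nonneg_iff_isPositive, ContinuousLinearMap.isPositive_iff_complex]
    intro v
    have h1 : c v = c (z v) := by
      have := hczv v
      rwa [map_sub, sub_eq_zero] at this
    have h2 : ⟪c v, v⟫_ℂ = ⟪c (z v), z v⟫_ℂ := by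
      rw [h1, ← inner_star_left z, hzs, hz1 _ (hMU c hcM _ (hzU v))]
    have h3 : Tendsto (fun n => ⟪y n (z v), z v⟫_ℂ) atTop (𝓝 ⟪c (z v), z v⟫_ℂ) :=
      (hclim _ (hzU v)).inner tendsto_const_nhds
    have h4 : ∀ n, (RCLike.re ⟪y n (z v), z v⟫_ℂ : ℂ) = ⟪y n (z v), z v⟫_ℂ ∧
        0 ≤ RCLike.re ⟪y n (z v), z v⟫_ℂ := fun n =>
      (ContinuousLinearMap.isPositive_iff_complex _).1
        ((ContinuousLinearMap.nonneg_iff_isPositive _).1 (hC0 _ (hyC n))) (z v)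
    have h5 : Tendsto (fun n => RCLike.re ⟪y n (z v), z v⟫_ℂ) atTop
        (𝓝 (RCLike.re ⟪c (z v), z v⟫_ℂ)) := (RCLike.continuous_re.tendsto _).comp h3
    rw [h2]
    refine ⟨?_, ge_of_tendsto h5 (Eventually.of_forall fun n => (h4 n).2)⟩
    refine tendsto_nhds_unique ?_ h3
    have h6 := (Complex.continuous_ofReal.tendsto _).comp h5
    exact h6.congr fun n => (h4 n).1
  · have hD : u * c * star u - c = 0 := by
      have hDM : u * c * star u - c ∈ 𝔐 :=
        sub_mem (mul_mem (mul_mem (h𝒢M u hu) hcM) (star_mem (h𝒢M u hu))) hcM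
      have hDΩ : (u * c * star u - c) Ω = 0 := by
        rw [sub_apply, sub_eq_zero, hcΩ]
        refine tendsto_nhds_unique ?_ (hyconj u hu)
        exact (u.continuous.tendsto _).comp (hclim _ (hMΩ _ (star_mem (h𝒢M u hu))))
      refine eq_zero_of_family xf (fun X => ?_) fun v hv => ?_
      · change (u * c * star u - c) ((X : 𝓗 →L[ℂ] 𝓗) Ω) = 0
        rw [hcomm _ hDM X X.2, hDΩ, map_zero]
      · have h1 : c (star u v) = 0 := hc2 _ fun X => by
          rw [inner_star_right]
          exact horth v hv _ (hMU u (h𝒢M u hu) _ (hU X X.2))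
        rw [sub_apply, hc2 v hv, mul_apply_eq_comp, mul_apply_eq_comp, h1, map_zero, sub_zero]
    have h1 : u * c * star u = c := sub_eq_zero.1 hD
    calc u * c = u * c * (star u * u) := by rw [(h𝒢u u hu).1, mul_one]
      _ = (u * c * star u) * u := by simp only [mul_assoc]
      _ = c * u := by rw [h1]
  · rw [hcΩ]
    have h1 : Tendsto (fun n => ⟪Ω, y n Ω⟫_ℂ) atTop (𝓝 ⟪Ω, h⟫_ℂ) := tendsto_const_nhds.inner hylim
    refine tendsto_nhds_unique h1 (tendsto_const_nhds.congr fun n => ?_)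
    refine (hCinner Ω (fun u hu => ?_) _ (hyC n)).symm
    rw [mul_assoc, htr u (h𝒢M u hu) _ (mul_mem hx (star_mem (h𝒢M u hu))), mul_assoc,
      (h𝒢u u hu).1, mul_one]
  · have h1 : Tendsto (fun n => ⟪g, y n g⟫_ℂ) atTop (𝓝 ⟪g, c g⟫_ℂ) :=
      tendsto_const_nhds.inner (hclim g hg)
    exact tendsto_nhds_unique h1 (tendsto_const_nhds.congr fun n =>
      (hCinner g hgx _ (hyC n)).symm)
  · refine eq_zero_of_family xf (fun X => ?_) fun v hv => ?_
    · have h1 : Tendsto (fun n => d (y n ((X : 𝓗 →L[ℂ] 𝓗) Ω))) atTop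
          (𝓝 (d (c ((X : 𝓗 →L[ℂ] 𝓗) Ω)))) := (d.continuous.tendsto _).comp (hclim _ (hU X X.2))
      refine tendsto_nhds_unique h1 (tendsto_const_nhds.congr fun n => ?_)
      have := DFunLike.congr_fun (hCd d hd hdx _ (hyC n)) ((X : 𝓗 →L[ℂ] 𝓗) Ω)
      simpa using this.symm
    · rw [mul_apply_eq_comp, hc2 v hv, map_zero]

end Averaging

/-! ### Dominated vectors as images under contractions of `A ⊗ M` -/

section PullDown

variable {K H : Type*} [NormedAddCommGroup K] [InnerProductSpace ℂ K] [CompleteSpace K]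
  [NormedAddCommGroup H] [InnerProductSpace ℂ H] [CompleteSpace H]
  {A : VonNeumannAlgebra K} {M : VonNeumannAlgebra H} {ξ : H}

theorem vecTensor_mem_closure (hM : Dense {η : H | ∃ x ∈ M, η = x ξ}) {ζ κ : K}
    (hκ : κ ∈ ltwo A ζ) (η : H) :
    vecTensor κ η ∈ closure {v | ∃ y ∈ vnTensor A M, v = y (vecTensor ζ ξ)} := by
  have hκ' : κ ∈ closure {κ | ∃ a ∈ A, κ = a ζ} := by rw [← coe_ltwo]; exact hκ
  have h1 : ∀ a ∈ A, ∀ η : H,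
      vecTensor (a ζ) η ∈ closure {v | ∃ y ∈ vnTensor A M, v = y (vecTensor ζ ξ)} := by
    intro a ha η
    refine closure_minimal (s := {η : H | ∃ x ∈ M, η = x ξ}) (t := leftTensor (a ζ) ⁻¹' closure
      {v | ∃ y ∈ vnTensor A M, v = y (vecTensor ζ ξ)}) ?_
      (isClosed_closure.preimage (leftTensor (a ζ)).continuous) (hM η)
    rintro _ ⟨m, hm, rfl⟩
    exact subset_closure ⟨_, opTensor_mem ha hm, by rw [opTensor_vecTensor]; rfl⟩
  refine closure_minimal (s := {κ | ∃ a ∈ A, κ = a ζ}) (t := rightTensor η ⁻¹' closure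
      {v | ∃ y ∈ vnTensor A M, v = y (vecTensor ζ ξ)}) ?_
      (isClosed_closure.preimage (rightTensor η).continuous) hκ'
  rintro _ ⟨a, ha, rfl⟩
  exact h1 a ha η

/-- The projection `p` onto the closure of `A ζ` lies in `A'`, so `p ⊗ 1` fixes `Y (ζ ⊗ ξ)`. Every
vector in the range of `p ⊗ 1` is a limit of vectors `y (ζ ⊗ ξ)` with `y ∈ A ⊗ M`. -/
theorem mem_closure_of_commute (hM : Dense {η : H | ∃ x ∈ M, η = x ξ})
    {Y : HilbertTensor K H →L[ℂ] HilbertTensor K H}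
    (hYA : ∀ a ∈ A.commutant, opTensor a 1 * Y = Y * opTensor a 1) (ζ : K) :
    Y (vecTensor ζ ξ) ∈ closure {v | ∃ y ∈ vnTensor A M, v = y (vecTensor ζ ξ)} := by
  let W₀ : Submodule ℂ (HilbertTensor K H) :=
    { carrier := {v | ∃ y ∈ vnTensor A M, v = y (vecTensor ζ ξ)}
      add_mem' := by
        rintro _ _ ⟨X, hX, rfl⟩ ⟨Y, hY, rfl⟩; exact ⟨X + Y, add_mem hX hY, rfl⟩
      zero_mem' := ⟨0, zero_mem _, rfl⟩
      smul_mem' := by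
        rintro c _ ⟨X, hX, rfl⟩; exact ⟨c • X, smul_mem_vn _ c hX, rfl⟩ }
  let W := W₀.topologicalClosure
  set p := jonesProjection A ζ with hp
  have h1 := DFunLike.congr_fun (hYA p jonesProjection_mem_commutant) (vecTensor ζ ξ)
  rw [mul_apply_eq_comp, mul_apply_eq_comp, opTensor_vecTensor, one_apply_eq_self, hp,
    jonesProjection_apply_self] at h1
  rw [← h1]
  have h2 := mem_of_forall_vecTensor (K := K) (H := H)
    (X := W.comap (opTensor p (1 : H →L[ℂ] H)).toLinearMap)
    ((Submodule.isClosed_topologicalClosure W₀).preimage (opTensor p (1 : H →L[ℂ] H)).continuous)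
    (fun κ η => by
      change opTensor p 1 (vecTensor κ η) ∈ W
      rw [opTensor_vecTensor]
      exact vecTensor_mem_closure hM (jonesProjection_apply_mem _) _)
    (Y (vecTensor ζ ξ))
  exact h2

theorem norm_le_of_mem_closure {𝓗 : Type*} [NormedAddCommGroup 𝓗] [InnerProductSpace ℂ 𝓗]
    {S : Set 𝓗} {u : 𝓗} (hu : u ∈ closure S) {C : ℝ} (hC : 0 ≤ C)
    (h : ∀ v ∈ S, ‖⟪v, u⟫_ℂ‖ ≤ C * ‖v‖) :
    ‖u‖ ≤ C := by
  have h1 : ‖⟪u, u⟫_ℂ‖ ≤ C * ‖u‖ := closure_minimal (t := {v | ‖⟪v, u⟫_ℂ‖ ≤ C * ‖v‖}) h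
    (isClosed_le (by fun_prop) (by fun_prop)) hu
  rw [inner_self_eq_norm_sq_to_K, norm_pow, RCLike.norm_ofReal, abs_norm, pow_two] at h1
  by_cases h0 : ‖u‖ = 0
  · rwa [h0]
  · exact le_of_mul_le_mul_right h1 (lt_of_le_of_ne (norm_nonneg _) (Ne.symm h0))

theorem star_sum_apply {𝓗 : Type*} [NormedAddCommGroup 𝓗] [InnerProductSpace ℂ 𝓗]
    [CompleteSpace 𝓗] {ι : Type*} (s : Finset ι) (f : ι → 𝓗 →L[ℂ] 𝓗) (v : 𝓗) :
    star (∑ i ∈ s, f i) v = ∑ i ∈ s, star (f i) v := by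
  rw [star_sum, sum_apply]

theorem opTensor_one_commute (b : K →L[ℂ] K) (R : H →L[ℂ] H) (v : HilbertTensor K H) :
    opTensor b 1 (opTensor 1 R v) = opTensor 1 R (opTensor b 1 v) := by
  rw [← mul_apply_eq_comp, opTensor_mul, ← mul_apply_eq_comp (opTensor 1 R), opTensor_mul]
  simp

/-- Put `X = ∑ aᵢ ⊗ mᵢ` and `X' = ∑ aᵢ ⊗ Rᵢ`. Commutativity of `A` places `X'` in `(A ⊗ M)'`, and
`X`, `X'` and their adjoints agree at `Ω = ζ ⊗ ξ`. Hence `⟪y Ω, X' Y Ω⟫ = ⟪X* Ω, y* Y Ω⟫`, which is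
at most `‖X Ω‖ ‖y Ω‖` by domination and traciality; such `y Ω` approximate `X' Y Ω`. -/
theorem norm_sum_apply_le_of_cyclic (hA : ∀ x ∈ A, ∀ y ∈ A, x * y = y * x)
    (hM : IsStandardTracial M ξ) {Y : HilbertTensor K H →L[ℂ] HilbertTensor K H}
    (hYA : ∀ a ∈ A.commutant, opTensor a 1 * Y = Y * opTensor a 1) {ζ : K}
    (hY : ∀ y ∈ vnTensor A M, ‖y (Y (vecTensor ζ ξ))‖ ≤ ‖y (vecTensor ζ ξ)‖)
    {ι : Type*} (s : Finset ι) (a : ι → (K →L[ℂ] K)) (m R : ι → (H →L[ℂ] H))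
    (ha : ∀ i, a i ∈ A) (hm : ∀ i, m i ∈ M) (hR : ∀ i, IsRightMul M ξ (m i) (R i)) :
    ‖∑ i ∈ s, opTensor (a i) (R i) (Y (vecTensor ζ ξ))‖ ≤
      ‖∑ i ∈ s, vecTensor (a i ζ) (m i ξ)‖ := by
  set X : HilbertTensor K H →L[ℂ] HilbertTensor K H := ∑ i ∈ s, opTensor (a i) (m i) with hX
  have hXM : X ∈ vnTensor A M := sum_mem fun i _ => opTensor_mem (ha i) (hm i)
  have hXΩ : X (vecTensor ζ ξ) = ∑ i ∈ s, vecTensor (a i ζ) (m i ξ) := by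
    rw [hX, sum_apply]
    exact Finset.sum_congr rfl fun i _ => opTensor_vecTensor _ _ _ _
  set X' : HilbertTensor K H →L[ℂ] HilbertTensor K H := ∑ i ∈ s, opTensor (a i) (R i) with hX'
  have hX'M : X' ∈ (vnTensor A M).commutant := sum_mem fun i _ =>
    VonNeumannAlgebra.mem_commutant_iff.2 fun g hg =>
      (vnTensor_commute_opTensor hg (mem_commutant_of_abelian hA (ha i)) (hR i).mem).symm
  have hX'Ω : X' (vecTensor ζ ξ) = X (vecTensor ζ ξ) := by
    rw [hXΩ, hX', sum_apply]
    exact Finset.sum_congr rfl fun i _ => by rw [opTensor_vecTensor, (hR i).apply]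
  have hX'Ω' : star X' (vecTensor ζ ξ) = star X (vecTensor ζ ξ) := by
    refine (star_sum_apply s _ _).trans (Eq.trans ?_ (star_sum_apply s _ _).symm)
    exact Finset.sum_congr rfl fun i _ => by
      rw [star_opTensor, star_opTensor, opTensor_vecTensor, opTensor_vecTensor, (hR i).star_apply]
  have hu : ∑ i ∈ s, opTensor (a i) (R i) (Y (vecTensor ζ ξ)) = X' (Y (vecTensor ζ ξ)) := by
    rw [hX', sum_apply]
  rw [hu, ← hXΩ]
  have hcl : X' (Y (vecTensor ζ ξ)) ∈
      closure {v | ∃ y ∈ vnTensor A M, v = y (vecTensor ζ ξ)} := by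
    refine closure_minimal (s := {v | ∃ y ∈ vnTensor A M, v = y (vecTensor ζ ξ)})
      (t := X' ⁻¹' closure {v | ∃ y ∈ vnTensor A M, v = y (vecTensor ζ ξ)}) ?_
      (isClosed_closure.preimage X'.continuous) (mem_closure_of_commute hM.cyclic hYA ζ)
    rintro _ ⟨y, hy, rfl⟩
    refine subset_closure ⟨y * X, mul_mem hy hXM, ?_⟩
    rw [mul_apply_eq_comp, ← hX'Ω, ← mul_apply_eq_comp, ← mul_apply_eq_comp,
      VonNeumannAlgebra.mem_commutant_iff.1 hX'M y hy]
  refine norm_le_of_mem_closure hcl (norm_nonneg _) ?_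
  rintro _ ⟨y, hy, rfl⟩
  have h1 : ⟪y (vecTensor ζ ξ), X' (Y (vecTensor ζ ξ))⟫_ℂ =
      ⟪star X (vecTensor ζ ξ), star y (Y (vecTensor ζ ξ))⟫_ℂ := by
    rw [← inner_star_left X', ← hX'Ω', inner_star_right, ← mul_apply_eq_comp,
      ← mul_apply_eq_comp, VonNeumannAlgebra.mem_commutant_iff.1 (star_mem hX'M) y hy]
  rw [h1]
  refine (norm_inner_le_norm _ _).trans ?_
  rw [vnTensor_norm_star_apply hA hM hXM, ← vnTensor_norm_star_apply hA hM hy]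
  exact mul_le_mul_of_nonneg_left (hY _ (star_mem hy)) (norm_nonneg _)

theorem norm_sq_eq_add_of_isStarProjection {𝓗 : Type*} [NormedAddCommGroup 𝓗]
    [InnerProductSpace ℂ 𝓗] [CompleteSpace 𝓗] {p : 𝓗 →L[ℂ] 𝓗} (hp : IsStarProjection p) (v : 𝓗) :
    ‖v‖ ^ 2 = ‖p v‖ ^ 2 + ‖(1 - p) v‖ ^ 2 := by
  rw [norm_sq_eq_re_inner p, norm_sq_eq_re_inner (1 - p), hp.isSelfAdjoint.star_eq,
    hp.one_sub.isSelfAdjoint.star_eq, hp.isIdempotentElem.eq, hp.one_sub.isIdempotentElem.eq,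
    ← map_add, ← inner_add_right, ← add_apply, add_sub_cancel, one_apply_eq_self,
    inner_self_eq_norm_sq]

/-- Induction on the number of vectors. The projection onto the closure of `A ζⱼ` lies in `A'` and
splits both sides by Pythagoras: on its range all vectors are limits of some `a ζⱼ`, the cyclic
case, and on the complement the `j`-th vector disappears. -/
theorem norm_sum_apply_le (hA : ∀ x ∈ A, ∀ y ∈ A, x * y = y * x)
    (hM : IsStandardTracial M ξ) {Y : HilbertTensor K H →L[ℂ] HilbertTensor K H}
    (hYA : ∀ a ∈ A.commutant, opTensor a 1 * Y = Y * opTensor a 1)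
    (hY : ∀ ζ, ∀ y ∈ vnTensor A M, ‖y (Y (vecTensor ζ ξ))‖ ≤ ‖y (vecTensor ζ ξ)‖)
    {ι : Type*} (s : Finset ι) (ζ : ι → K) (m R : ι → (H →L[ℂ] H))
    (hm : ∀ i, m i ∈ M) (hR : ∀ i, IsRightMul M ξ (m i) (R i)) :
    ‖∑ i ∈ s, opTensor 1 (R i) (Y (vecTensor (ζ i) ξ))‖ ≤
      ‖∑ i ∈ s, vecTensor (ζ i) (m i ξ)‖ := by
  classical
  induction s using Finset.induction_on generalizing ζ with
  | empty => simp
  | insert j s hj ih =>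
    set p := jonesProjection A (ζ j) with hp
    have hpp : IsStarProjection p := jonesProjection_isStarProjection A (ζ j)
    have hpA : p ∈ A.commutant := jonesProjection_mem_commutant
    let L : (ι → K) → HilbertTensor K H := fun κ =>
      ∑ i ∈ insert j s, opTensor 1 (R i) (Y (vecTensor (κ i) ξ))
    let Q : (ι → K) → HilbertTensor K H := fun κ => ∑ i ∈ insert j s, vecTensor (κ i) (m i ξ)
    have hLc : Continuous L := continuous_finsetSum _ fun i _ =>
      (opTensor 1 (R i)).continuous.comp (Y.continuous.comp
        ((rightTensor ξ).continuous.comp (continuous_apply i)))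
    have hQc : Continuous Q := continuous_finsetSum _ fun i _ =>
      (rightTensor (m i ξ)).continuous.comp (continuous_apply i)
    have hL : ∀ b ∈ A.commutant, ∀ κ, opTensor b 1 (L κ) = L fun i => b (κ i) := by
      intro b hb κ
      rw [map_sum]
      refine Finset.sum_congr rfl fun i _ => ?_
      have h1 := DFunLike.congr_fun (hYA b hb) (vecTensor (κ i) ξ)
      rw [mul_apply_eq_comp, mul_apply_eq_comp, opTensor_vecTensor, one_apply_eq_self] at h1
      rw [← h1, opTensor_one_commute]
    have hQ : ∀ b ∈ A.commutant, ∀ κ, opTensor b 1 (Q κ) = Q fun i => b (κ i) := by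
      intro b hb κ
      rw [map_sum]
      exact Finset.sum_congr rfl fun i _ => by rw [opTensor_vecTensor]; rfl
    have hpT : IsStarProjection (opTensor p (1 : H →L[ℂ] H)) :=
      ⟨by rw [IsIdempotentElem, opTensor_mul, hpp.isIdempotentElem.eq, one_mul],
        by rw [IsSelfAdjoint, star_opTensor, hpp.isSelfAdjoint.star_eq, star_one]⟩
    have hpT' : 1 - opTensor p (1 : H →L[ℂ] H) = opTensor (1 - p) 1 := by
      refine ext_vecTensor fun κ η => ?_
      simp [vecTensor_sub_left]
    change ‖L ζ‖ ≤ ‖Q ζ‖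
    rw [← sq_le_sq₀ (norm_nonneg _) (norm_nonneg _), norm_sq_eq_add_of_isStarProjection hpT (L ζ),
      norm_sq_eq_add_of_isStarProjection hpT (Q ζ), hpT', hL p hpA, hQ p hpA,
      hL _ (sub_mem (one_mem _) hpA), hQ _ (sub_mem (one_mem _) hpA)]
    have hzero : (1 - p) (ζ j) = 0 := by
      rw [sub_apply, one_apply_eq_self, hp, jonesProjection_apply_self, sub_self]
    refine add_le_add (pow_le_pow_left₀ (norm_nonneg _) ?_ 2)
      (pow_le_pow_left₀ (norm_nonneg _) ?_ 2)
    · have hmem : (fun i => p (ζ i)) ∈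
          closure (Set.univ.pi fun _ : ι => {κ | ∃ a ∈ A, κ = a (ζ j)}) := by
        rw [closure_pi_set]
        intro i _
        rw [← coe_ltwo]
        exact jonesProjection_apply_mem _
      refine closure_minimal (t := {κ | ‖L κ‖ ≤ ‖Q κ‖}) ?_
        (isClosed_le hLc.norm hQc.norm) hmem
      intro κ hκ
      choose a ha haκ using fun i => hκ i (Set.mem_univ i)
      have h1 : L κ = ∑ i ∈ insert j s, opTensor (a i) (R i) (Y (vecTensor (ζ j) ξ)) := by
        refine Finset.sum_congr rfl fun i _ => ?_
        have h1 := DFunLike.congr_fun (hYA (a i) (mem_commutant_of_abelian hA (ha i)))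
          (vecTensor (ζ j) ξ)
        rw [mul_apply_eq_comp, mul_apply_eq_comp, opTensor_vecTensor, one_apply_eq_self] at h1
        rw [haκ, ← h1, ← mul_apply_eq_comp, opTensor_mul, one_mul, mul_one]
      have h2 : Q κ = ∑ i ∈ insert j s, vecTensor (a i (ζ j)) (m i ξ) :=
        Finset.sum_congr rfl fun i _ => by rw [haκ]
      change ‖L κ‖ ≤ ‖Q κ‖
      rw [h1, h2]
      exact norm_sum_apply_le_of_cyclic hA hM hYA (hY (ζ j)) _ a m R ha hm hR
    · have h1 : L (fun i => (1 - p) (ζ i)) =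
          ∑ i ∈ s, opTensor 1 (R i) (Y (vecTensor ((1 - p) (ζ i)) ξ)) := by
        simp only [L]
        rw [Finset.sum_insert hj, hzero, ← rightTensor_apply (0 : K), map_zero, map_zero, map_zero,
          zero_add]
      have h2 : Q (fun i => (1 - p) (ζ i)) = ∑ i ∈ s, vecTensor ((1 - p) (ζ i)) (m i ξ) := by
        simp only [Q]
        rw [Finset.sum_insert hj, hzero, ← rightTensor_apply (0 : K), map_zero, zero_add]
      rw [h1, h2]
      exact ih _

/-- An operator in the commutant of `A' ⊗ 1` which is dominated by the identity on the trace
vectors `ζ ⊗ ξ`, with respect to `A ⊗ M`, agrees on them with a contraction of `A ⊗ M`. -/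
theorem exists_pullDown (hA : ∀ x ∈ A, ∀ y ∈ A, x * y = y * x)
    (hM : IsStandardTracial M ξ) {Y : HilbertTensor K H →L[ℂ] HilbertTensor K H}
    (hYA : ∀ a ∈ A.commutant, opTensor a 1 * Y = Y * opTensor a 1)
    (hY : ∀ ζ, ∀ y ∈ vnTensor A M, ‖y (Y (vecTensor ζ ξ))‖ ≤ ‖y (vecTensor ζ ξ)‖) :
    ∃ D ∈ vnTensor A M, ‖D‖ ≤ 1 ∧ ∀ ζ, D (vecTensor ζ ξ) = Y (vecTensor ζ ξ) := by
  choose r hr using fun m : M => hM.exists_isRightMul m.2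
  -- The definition `D (ζ ⊗ m ξ) = (1 ⊗ R_m) Y (ζ ⊗ ξ)` is forced, since an element of `A ⊗ M`
  -- commutes with `1 ⊗ R_m`.
  obtain ⟨D, hD, -, hD1⟩ := exists_clm_of_norm_sum_le (ι := K × M)
    (fun p => (vecTensor p.1 ((p.2 : H →L[ℂ] H) ξ) : HilbertTensor K H))
    (fun p => opTensor 1 (r p.2) (Y (vecTensor p.1 ξ))) zero_le_one (by
      intro s c
      have h1 := norm_sum_apply_le hA hM hYA hY s (fun p => c p • p.1)
        (fun p => (p.2 : H →L[ℂ] H)) (fun p => r p.2) (fun p => p.2.2) (fun p => hr p.2)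
      simp only [vecTensor_smul_left, map_smul] at h1
      rwa [one_mul])
  have hD' : ∀ ζ, ∀ m ∈ M, ∀ R, IsRightMul M ξ m R →
      D (vecTensor ζ (m ξ)) = opTensor 1 R (Y (vecTensor ζ ξ)) := by
    intro ζ m hm R hR
    have h1 : R = r ⟨m, hm⟩ := hM.ext fun x hx => by
      rw [hR.apply_apply hx, (hr ⟨m, hm⟩).apply_apply hx]
    rw [h1]
    exact hD (ζ, ⟨m, hm⟩)
  refine ⟨D, ?_, hD1, fun ζ => ?_⟩
  · refine mem_vnTensor_of_commute_isRightMul hA hM (fun a ha => ?_) fun m hm R hR => ?_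
    · refine ext_vecTensor_mul hM fun ζ m hm => ?_
      obtain ⟨R, hR⟩ := hM.exists_isRightMul hm
      have h1 := DFunLike.congr_fun (hYA a ha) (vecTensor ζ ξ)
      rw [mul_apply_eq_comp, mul_apply_eq_comp, opTensor_vecTensor, one_apply_eq_self] at h1
      rw [mul_apply_eq_comp, mul_apply_eq_comp, opTensor_vecTensor, one_apply_eq_self,
        hD' _ m hm R hR, hD' _ m hm R hR, ← h1, opTensor_one_commute]
    · refine ext_vecTensor_mul hM fun ζ n hn => ?_
      obtain ⟨S, hS⟩ := hM.exists_isRightMul hn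
      have hRS : IsRightMul M ξ (n * m) (R * S) := by
        refine ⟨mul_mem hR.mem hS.mem, ?_, ?_⟩
        · rw [mul_apply_eq_comp, mul_apply_eq_comp, hS.apply, hR.apply_apply hn]
        · rw [star_mul, star_mul, mul_apply_eq_comp, mul_apply_eq_comp, hR.star_apply,
            hS.star.apply_apply (star_mem hm)]
      have h1 := hD' ζ _ (mul_mem hn hm) _ hRS
      rw [mul_apply_eq_comp] at h1
      rw [mul_apply_eq_comp, mul_apply_eq_comp, opTensor_vecTensor, one_apply_eq_self,
        hR.apply_apply hn, h1, hD' _ n hn S hS, ← mul_apply_eq_comp, opTensor_mul, one_mul]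
  · have h1 : IsRightMul M ξ 1 1 := ⟨one_mem _, rfl, rfl⟩
    have h2 := hD' ζ 1 (one_mem M) 1 h1
    rw [opTensor_one] at h2
    simpa using h2

end PullDown

/-! ### Spectral projections and dyadic expansion of a positive operator -/

section Spectral

variable {𝓗 : Type*} [NormedAddCommGroup 𝓗] [InnerProductSpace ℂ 𝓗] [CompleteSpace 𝓗]

/-- The projection onto the closure of the range of an operator. -/
noncomputable def rangeProjection (a : 𝓗 →L[ℂ] 𝓗) : 𝓗 →L[ℂ] 𝓗 :=
  haveI : CompleteSpace (LinearMap.range a.toLinearMap).topologicalClosure :=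
    (Submodule.isClosed_topologicalClosure _).completeSpace_coe
  (LinearMap.range a.toLinearMap).topologicalClosure.starProjection

theorem rangeProjection_isStarProjection (a : 𝓗 →L[ℂ] 𝓗) :
    IsStarProjection (rangeProjection a) := by
  have : CompleteSpace (LinearMap.range a.toLinearMap).topologicalClosure :=
    (Submodule.isClosed_topologicalClosure _).completeSpace_coe
  exact isStarProjection_starProjection

theorem rangeProjection_mul (a : 𝓗 →L[ℂ] 𝓗) : rangeProjection a * a = a := by
  have : CompleteSpace (LinearMap.range a.toLinearMap).topologicalClosure :=
    (Submodule.isClosed_topologicalClosure _).completeSpace_coe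
  ext v
  exact Submodule.starProjection_eq_self_iff.2
    (Submodule.le_topologicalClosure _ (LinearMap.mem_range_self a.toLinearMap v))

theorem mul_rangeProjection_eq_zero {a y : 𝓗 →L[ℂ] 𝓗} (h : y * a = 0) :
    y * rangeProjection a = 0 := by
  have : CompleteSpace (LinearMap.range a.toLinearMap).topologicalClosure :=
    (Submodule.isClosed_topologicalClosure _).completeSpace_coe
  have h1 : (LinearMap.range a.toLinearMap).topologicalClosure ≤ LinearMap.ker y.toLinearMap := by
    refine Submodule.topologicalClosure_minimal _ ?_ y.isClosed_ker
    rintro _ ⟨v, rfl⟩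
    exact DFunLike.congr_fun h v
  ext v
  exact h1 (Submodule.starProjection_apply_mem _ v)

theorem rangeProjection_commute {a y : 𝓗 →L[ℂ] 𝓗} (h : y * a = a * y)
    (h' : star y * a = a * star y) : y * rangeProjection a = rangeProjection a * y := by
  have : CompleteSpace (LinearMap.range a.toLinearMap).topologicalClosure :=
    (Submodule.isClosed_topologicalClosure _).completeSpace_coe
  have key : ∀ T : 𝓗 →L[ℂ] 𝓗, T * a = a * T →
      ∀ u ∈ (LinearMap.range a.toLinearMap).topologicalClosure,
        T u ∈ (LinearMap.range a.toLinearMap).topologicalClosure := by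
    intro T hT u hu
    refine Submodule.topologicalClosure_minimal (t := (LinearMap.range
      a.toLinearMap).topologicalClosure.comap T.toLinearMap) _ ?_
      ((Submodule.isClosed_topologicalClosure _).preimage T.continuous) hu
    rintro _ ⟨v, rfl⟩
    exact Submodule.le_topologicalClosure _ ⟨T v, (DFunLike.congr_fun hT v).symm⟩
  exact (starProjection_commute (key y h) (key (star y) h')).symm

/-- The spectral projection of a self-adjoint operator for the half-line `(c, ∞)`, together with
the positive and negative parts of the operator around `c`. -/
theorem exists_spectral_cut {z : 𝓗 →L[ℂ] 𝓗} (hz : IsSelfAdjoint z) (c : ℝ) :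
    ∃ s p n : 𝓗 →L[ℂ] 𝓗, IsStarProjection s ∧ 0 ≤ p ∧ 0 ≤ n ∧ s * p = p ∧ p * s = p ∧
      s * n = 0 ∧ n * s = 0 ∧ z = c • (1 : 𝓗 →L[ℂ] 𝓗) + p - n ∧
      (∀ y, y * z = z * y → star y * z = z * star y → y * s = s * y) ∧
      (0 < c → ∀ y, y * z = 0 → y * s = 0) := by
  set p := cfc (fun t : ℝ => max (t - c) 0) z with hp
  set n := cfc (fun t : ℝ => max (c - t) 0) z with hn
  have hp0 : 0 ≤ p := cfc_nonneg fun t _ => le_max_right _ _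
  have hn0 : 0 ≤ n := cfc_nonneg fun t _ => le_max_right _ _
  have hnp : n * p = 0 := by
    rw [hn, hp, ← cfc_mul _ _ z]
    have : (fun t : ℝ => max (c - t) 0 * max (t - c) 0) = fun _ => 0 := by
      ext t
      rcases le_total t c with h | h
      · rw [max_eq_right (sub_nonpos.2 h), mul_zero]
      · rw [max_eq_right (sub_nonpos.2 h), zero_mul]
    rw [this, cfc_const_zero]
  have hzeq : z = c • (1 : 𝓗 →L[ℂ] 𝓗) + p - n := by
    have h1 : c • (1 : 𝓗 →L[ℂ] 𝓗) = cfc (fun _ : ℝ => c) z := by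
      rw [cfc_const c z, Algebra.algebraMap_eq_smul_one]
    rw [h1, hp, hn, ← cfc_add .., ← cfc_sub ..]
    conv_lhs => rw [← cfc_id ℝ z]
    refine cfc_congr fun t _ => ?_
    rcases le_total t c with h | h
    · simp only [id, max_eq_right (sub_nonpos.2 h), max_eq_left (sub_nonneg.2 h)]; ring
    · simp only [id, max_eq_right (sub_nonpos.2 h), max_eq_left (sub_nonneg.2 h)]; ring
  have hs := rangeProjection_isStarProjection p
  have hns : n * rangeProjection p = 0 := mul_rangeProjection_eq_zero hnp
  have hpsa : star p = p := (IsSelfAdjoint.of_nonneg hp0).star_eq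
  have hnsa : star n = n := (IsSelfAdjoint.of_nonneg hn0).star_eq
  have hps : p * rangeProjection p = p := by
    have := congrArg star (rangeProjection_mul p)
    rwa [star_mul, hs.isSelfAdjoint.star_eq, hpsa] at this
  have hsn : rangeProjection p * n = 0 := by
    have := congrArg star hns
    rwa [star_mul, hs.isSelfAdjoint.star_eq, hnsa, star_zero] at this
  refine ⟨rangeProjection p, p, n, hs, hp0, hn0, rangeProjection_mul p, hps, hsn, hns, hzeq, ?_,
    ?_⟩
  · intro y hy hy'
    exact rangeProjection_commute (Commute.cfc_real (show Commute z y from hy.symm) _).symm.eq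
      (Commute.cfc_real (show Commute z (star y) from hy'.symm) _).symm.eq
  · intro hc y hy
    have hsp := rangeProjection_mul p
    generalize rangeProjection p = s at hs hps hsp hsn hns
    have hss : s * s = s := hs.isIdempotentElem.eq
    have hst : star s = s := hs.isSelfAdjoint.star_eq
    have hzs : z * s = c • s + p := by
      rw [hzeq, sub_mul, add_mul, hns, hps, smul_mul_assoc, one_mul, sub_zero]
    have hsz : s * z = c • s + p := by
      rw [hzeq, mul_sub, mul_add, hsn, hsp, mul_smul_comm, mul_one, sub_zero]
    have h1 : y * s * z = 0 := by rw [mul_assoc, hsz, ← hzs, ← mul_assoc, hy, zero_mul]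
    -- Two positive terms with sum `y s z y* = 0`; hence both vanish, and `c > 0` gives `y s = 0`.
    have h2 : c • (y * s * star (y * s)) + y * p * star y = 0 := by
      calc _ = y * s * z * star y := by
            rw [mul_assoc y s z, hsz, star_mul, hst, mul_add, add_mul, mul_smul_comm,
              smul_mul_assoc, mul_assoc y s (s * star y), ← mul_assoc s s, hss, ← mul_assoc]
        _ = 0 := by rw [h1, zero_mul]
    have h3 : 0 ≤ y * p * star y := star_right_conjugate_nonneg hp0 y
    have h4 : c • (y * s * star (y * s)) = -(y * p * star y) := eq_neg_of_add_eq_zero_left h2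
    have h5 : y * s * star (y * s) = 0 := by
      refine le_antisymm ?_ (mul_star_self_nonneg _)
      have : y * s * star (y * s) = c⁻¹ • (c • (y * s * star (y * s))) := by
        rw [smul_smul, inv_mul_cancel₀ hc.ne', one_smul]
      rw [this, h4]
      exact smul_nonpos_of_nonneg_of_nonpos (inv_nonneg.2 hc.le) (neg_nonpos.2 h3)
    exact CStarRing.mul_star_self_eq_zero_iff _ |>.1 h5

/-- `x` commutes with everything that commutes with `z`, and is supported where `z` is. -/
def IsAffiliated (z x : 𝓗 →L[ℂ] 𝓗) : Prop :=
  (∀ y, y * z = z * y → star y * z = z * star y → y * x = x * y) ∧ ∀ y, y * z = 0 → y * x = 0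

/-- One binary digit of `z`: `s` is its spectral projection for `(1/2, ∞)`, and the remainder `z' =
2 z - s` again lies between `0` and `1`. -/
theorem exists_projection_halving {z : 𝓗 →L[ℂ] 𝓗} (hz0 : 0 ≤ z) (hz1 : z ≤ 1) :
    ∃ s z', IsStarProjection s ∧ IsAffiliated z s ∧ IsAffiliated z z' ∧ 0 ≤ z' ∧ z' ≤ 1 ∧
      z = (2⁻¹ : ℝ) • (s + z') := by
  obtain ⟨s, p, n, hs, hp, hn, hsp, hps, hsn, hns, hzeq, hcomm, hsupp⟩ :=
    exists_spectral_cut (IsSelfAdjoint.of_nonneg hz0) (2⁻¹ : ℝ)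
  have hss : s * s = s := hs.isIdempotentElem.eq
  have hst : star s = s := hs.isSelfAdjoint.star_eq
  have hzs : z * s = (2⁻¹ : ℝ) • s + p := by
    rw [hzeq, sub_mul, add_mul, hns, hps, smul_mul_assoc, one_mul, sub_zero]
  have hsz : s * z = (2⁻¹ : ℝ) • s + p := by
    rw [hzeq, mul_sub, mul_add, hsn, hsp, mul_smul_comm, mul_one, sub_zero]
  have haff : IsAffiliated z s := ⟨hcomm, hsupp (by norm_num)⟩
  refine ⟨s, (2 : ℝ) • z - s, hs, haff, ⟨fun y h h' => ?_, fun y h => ?_⟩, ?_, ?_, ?_⟩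
  · rw [mul_sub, sub_mul, haff.1 y h h', mul_smul_comm, smul_mul_assoc, h]
  · rw [mul_sub, mul_smul_comm, h, haff.2 y h, smul_zero, sub_zero]
  · have h1 : (2 : ℝ) • z - s = (2 : ℝ) • (p + (1 - s) * z * star (1 - s)) := by
      rw [star_sub, star_one, hst, sub_mul, one_mul, hsz, mul_sub, mul_one, sub_mul, hzs, add_mul,
        smul_mul_assoc, hss, hps]
      module
    rw [h1]
    exact smul_nonneg (by norm_num) (add_nonneg hp (star_right_conjugate_nonneg hz0 _))
  · have h1 : 1 - ((2 : ℝ) • z - s) = (2 : ℝ) • (n + s * (1 - z) * star s) := by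
      rw [hst, mul_sub, sub_mul, mul_one, hss, mul_assoc, hzs, mul_add, mul_smul_comm, hss, hsp]
      nth_rewrite 1 [hzeq]
      rw [smul_sub, smul_add, smul_smul, smul_add, smul_sub, smul_add, smul_smul]
      norm_num
      module
    rw [← sub_nonneg, h1]
    exact smul_nonneg (by norm_num)
      (add_nonneg hn (star_right_conjugate_nonneg (sub_nonneg.2 hz1) _))
  · module

theorem IsAffiliated.trans {z x w : 𝓗 →L[ℂ] 𝓗} (h : IsAffiliated z x) (h' : IsAffiliated x w) :
    IsAffiliated z w := by
  refine ⟨fun y hy hy' => h'.1 y (h.1 y hy hy') (h.1 (star y) hy' ?_), fun y hy => h'.2 y (h.2 y hy)⟩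
  rw [star_star]; exact hy

/-- Each binary digit satisfies the inequality by hypothesis and halves the error left by the
remainder; with no digits the error is `⟪g, z g⟫ ≤ ‖g‖²`. -/
theorem re_inner_le_add_of_projections {g Ω : 𝓗} (n : ℕ) : ∀ {z : 𝓗 →L[ℂ] 𝓗}, 0 ≤ z → z ≤ 1 →
    (∀ s, IsStarProjection s → IsAffiliated z s →
      RCLike.re ⟪g, s g⟫_ℂ ≤ RCLike.re ⟪Ω, s Ω⟫_ℂ) →
    RCLike.re ⟪g, z g⟫_ℂ ≤ RCLike.re ⟪Ω, z Ω⟫_ℂ + (2⁻¹ : ℝ) ^ n * ‖g‖ ^ 2 := by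
  induction n with
  | zero =>
    intro z hz0 hz1 _
    have h1 := re_inner_le_of_le hz1 g
    rw [one_apply_eq_self, inner_self_eq_norm_sq] at h1
    have h2 := re_inner_nonneg_of_nonneg hz0 Ω
    rw [pow_zero, one_mul]
    linarith
  | succ n ih =>
    intro z hz0 hz1 h
    obtain ⟨s, z', hs, hzs, hzz', hz'0, hz'1, hzeq⟩ := exists_projection_halving hz0 hz1
    have h1 := h s hs hzs
    have h2 := ih hz'0 hz'1 fun t ht htz => h t ht (hzz'.trans htz)
    have h3 : ∀ v : 𝓗, RCLike.re ⟪v, z v⟫_ℂ =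
        2⁻¹ * (RCLike.re ⟪v, s v⟫_ℂ + RCLike.re ⟪v, z' v⟫_ℂ) := by
      intro v
      rw [hzeq, smul_apply, add_apply, inner_smul_right_eq_smul, inner_add_right]
      rw [RCLike.smul_re, map_add]
    rw [h3, h3, pow_succ]
    linarith

/-- An inequality between vector functionals extends from spectral projections to positive
operators. -/
theorem re_inner_le_of_projections {g Ω : 𝓗} {z : 𝓗 →L[ℂ] 𝓗} (hz : 0 ≤ z)
    (h : ∀ s, IsStarProjection s → IsAffiliated z s →
      RCLike.re ⟪g, s g⟫_ℂ ≤ RCLike.re ⟪Ω, s Ω⟫_ℂ) :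
    RCLike.re ⟪g, z g⟫_ℂ ≤ RCLike.re ⟪Ω, z Ω⟫_ℂ := by
  -- Rescaling into the unit interval; the `+ 1` covers `z = 0`.
  set c : ℝ := (‖z‖ + 1)⁻¹ with hc
  have hz' : 0 < ‖z‖ + 1 := by positivity
  have hc0 : 0 < c := inv_pos.2 hz'
  have hcz1 : c • z ≤ 1 := by
    have h1 : z ≤ algebraMap ℝ _ ‖z‖ := IsSelfAdjoint.le_algebraMap_norm_self (.of_nonneg hz)
    have h2 : algebraMap ℝ (𝓗 →L[ℂ] 𝓗) ‖z‖ ≤ algebraMap ℝ _ (‖z‖ + 1) :=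
      algebraMap_mono _ (by linarith)
    calc c • z ≤ c • algebraMap ℝ _ (‖z‖ + 1) := smul_le_smul_of_nonneg_left (h1.trans h2) hc0.le
      _ = 1 := by
        rw [Algebra.algebraMap_eq_smul_one, smul_smul, hc, inv_mul_cancel₀ hz'.ne', one_smul]
  have haff : ∀ s, IsAffiliated (c • z) s → IsAffiliated z s := by
    refine fun s hs => ⟨fun y h1 h2 => hs.1 y ?_ ?_, fun y h1 => hs.2 y ?_⟩
    · rw [mul_smul_comm, h1, smul_mul_assoc]
    · rw [mul_smul_comm, h2, smul_mul_assoc]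
    · rw [mul_smul_comm, h1, smul_zero]
  have h1 : RCLike.re ⟪g, (c • z) g⟫_ℂ ≤ RCLike.re ⟪Ω, (c • z) Ω⟫_ℂ := by
    have h2 : Tendsto (fun n : ℕ => RCLike.re ⟪Ω, (c • z) Ω⟫_ℂ + (2⁻¹ : ℝ) ^ n * ‖g‖ ^ 2) atTop
        (𝓝 (RCLike.re ⟪Ω, (c • z) Ω⟫_ℂ + 0 * ‖g‖ ^ 2)) :=
      tendsto_const_nhds.add ((tendsto_pow_atTop_nhds_zero_of_lt_one (by norm_num)
        (by norm_num)).mul_const _)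
    rw [zero_mul, add_zero] at h2
    exact ge_of_tendsto' h2 fun n => re_inner_le_add_of_projections n
      (smul_nonneg hc0.le hz) hcz1 fun s hs hs' => h s hs (haff s hs')
  rw [smul_apply, smul_apply, inner_smul_right_eq_smul, inner_smul_right_eq_smul, RCLike.smul_re,
    RCLike.smul_re] at h1
  exact le_of_mul_le_mul_left h1 hc0

theorem IsAffiliated.mem {S : VonNeumannAlgebra 𝓗} {z x : 𝓗 →L[ℂ] 𝓗} (h : IsAffiliated z x)
    (hz : z ∈ S) : x ∈ S :=
  mem_of_forall_commutant fun y hy => h.1 y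
    (VonNeumannAlgebra.mem_commutant_iff.1 hy z hz).symm
    (VonNeumannAlgebra.mem_commutant_iff.1 (star_mem hy) z hz).symm

theorem IsAffiliated.mem_centerOf_corner {S : VonNeumannAlgebra 𝓗} {q z x : 𝓗 →L[ℂ] 𝓗}
    (hq : IsStarProjection q) (hx : IsSelfAdjoint x) (h : IsAffiliated z x)
    (hzS : z ∈ S) (hqz : q * z = z) (hz : ∀ y ∈ corner q S, y * z = z * y) :
    x ∈ centerOf (corner q S) := by
  have h1 : q * x = x := by
    have := h.2 (1 - q) (by rw [sub_mul, one_mul, hqz, sub_self])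
    rw [sub_mul, one_mul, sub_eq_zero] at this
    exact this.symm
  have h2 : x * q = x := by
    have := congrArg star h1
    rwa [star_mul, hx.star_eq, hq.isSelfAdjoint.star_eq] at this
  refine ⟨⟨x, h.mem hzS, by rw [h1, h2]⟩, fun y hy => h.1 y (hz y hy) (hz _ ?_)⟩
  obtain ⟨w, hw, rfl⟩ := hy
  exact ⟨star w, star_mem hw, by
    rw [star_mul, star_mul, hq.isSelfAdjoint.star_eq, mul_assoc]⟩

end Spectral

/-! ### Suprema of bounded increasing nets -/

section MonotoneSup

variable {𝓗 : Type*} [NormedAddCommGroup 𝓗] [InnerProductSpace ℂ 𝓗] [CompleteSpace 𝓗]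

theorem exists_sqrt_mem (S : VonNeumannAlgebra 𝓗) {x : 𝓗 →L[ℂ] 𝓗} (hx : x ∈ S) (hx0 : 0 ≤ x) :
    ∃ h ∈ S, 0 ≤ h ∧ h * h = x := by
  refine ⟨cfc Real.sqrt x, cfc_mem_vn S hx _, cfc_nonneg fun t _ => Real.sqrt_nonneg t, ?_⟩
  rw [← cfc_mul _ _ x (by fun_prop) (by fun_prop)]
  conv_rhs => rw [← cfc_id ℝ x]
  exact cfc_congr fun t ht => Real.mul_self_sqrt (spectrum_nonneg_of_nonneg hx0 ht)

/-- Applied to differences in an increasing net, this turns convergence of quadratic forms into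
convergence of vectors. -/
theorem norm_apply_sq_le_of_nonneg {x y : 𝓗 →L[ℂ] 𝓗} (hx : 0 ≤ x) (hxy : x ≤ y) (κ : 𝓗) :
    ‖x κ‖ ^ 2 ≤ ‖y‖ * RCLike.re ⟪κ, x κ⟫_ℂ := by
  set h := CFC.sqrt x with hh
  have h0 : 0 ≤ h := CFC.sqrt_nonneg x
  have hhx : h * h = x := CFC.sqrt_mul_sqrt_self x
  have hst : star h = h := (IsSelfAdjoint.of_nonneg h0).star_eq
  have h1 : ‖h κ‖ ^ 2 = RCLike.re ⟪κ, x κ⟫_ℂ := by rw [norm_sq_eq_re_inner, hst, hhx]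
  have h2 : ‖h‖ * ‖h‖ = ‖x‖ := by rw [← CStarRing.norm_star_mul_self (x := h), hst, hhx]
  have h3 : ‖x‖ ≤ ‖y‖ := CStarAlgebra.norm_le_norm_of_nonneg_of_le hx hxy
  calc ‖x κ‖ ^ 2 = ‖h (h κ)‖ ^ 2 := by rw [← hhx]; rfl
    _ ≤ (‖h‖ * ‖h κ‖) ^ 2 := pow_le_pow_left₀ (norm_nonneg _) (h.le_opNorm _) 2
    _ = ‖x‖ * ‖h κ‖ ^ 2 := by rw [← h2]; ring
    _ ≤ ‖y‖ * RCLike.re ⟪κ, x κ⟫_ℂ := by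
      rw [← h1]; exact mul_le_mul_of_nonneg_right h3 (sq_nonneg _)

/-- A bounded directed set of positive operators in a von Neumann algebra has a supremum there. -/
theorem exists_isLUB_of_directedOn (S : VonNeumannAlgebra 𝓗) {D : Set (𝓗 →L[ℂ] 𝓗)}
    (hDS : ∀ x ∈ D, x ∈ S) (hne : D.Nonempty) (hdir : DirectedOn (· ≤ ·) D) {y : 𝓗 →L[ℂ] 𝓗}
    (hD : ∀ x ∈ D, 0 ≤ x ∧ x ≤ y) : ∃ x ∈ S, IsLUB D x := by
  have : Nonempty D := hne.to_subtype
  have : IsDirectedOrder D := ⟨directedOn_iff_directed.1 hdir⟩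
  have hmono : ∀ κ : 𝓗, Monotone fun x : D => RCLike.re ⟪κ, (x : 𝓗 →L[ℂ] 𝓗) κ⟫_ℂ :=
    fun κ x x' h => re_inner_le_of_le h κ
  have hbdd : ∀ κ : 𝓗, BddAbove (Set.range fun x : D => RCLike.re ⟪κ, (x : 𝓗 →L[ℂ] 𝓗) κ⟫_ℂ) := by
    rintro κ
    refine ⟨RCLike.re ⟪κ, y κ⟫_ℂ, ?_⟩
    rintro _ ⟨x, rfl⟩
    exact re_inner_le_of_le (hD x x.2).2 κ
  have hlim : ∀ κ : 𝓗, ∃ v : 𝓗, Tendsto (fun x : D => (x : 𝓗 →L[ℂ] 𝓗) κ) atTop (𝓝 v) := by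
    intro κ
    rw [← cauchy_map_iff_exists_tendsto, Metric.cauchy_iff]
    refine ⟨inferInstance, fun ε hε => ?_⟩
    -- Chosen so that `(‖y‖ + 1) δ = (ε / 3) ^ 2`; two operators beyond `x₀` then differ by at most
    -- `2 ε / 3` at `κ`.
    set δ : ℝ := (ε / 3) ^ 2 / (‖y‖ + 1) with hδ
    have hy1 : 0 < ‖y‖ + 1 := by positivity
    have hδ0 : 0 < δ := by positivity
    obtain ⟨x₀, hx₀⟩ := exists_lt_of_lt_ciSup
      (sub_lt_self (⨆ x : D, RCLike.re ⟪κ, (x : 𝓗 →L[ℂ] 𝓗) κ⟫_ℂ) hδ0)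
    have key : ∀ x : D, x₀ ≤ x → ‖(x : 𝓗 →L[ℂ] 𝓗) κ - (x₀ : 𝓗 →L[ℂ] 𝓗) κ‖ ≤ ε / 3 := by
      intro x hx
      have h1 : (0 : 𝓗 →L[ℂ] 𝓗) ≤ x - x₀ := sub_nonneg.2 hx
      have h2 : (x : 𝓗 →L[ℂ] 𝓗) - x₀ ≤ y :=
        (sub_le_self _ (hD x₀ x₀.2).1).trans (hD x x.2).2
      have h3 := norm_apply_sq_le_of_nonneg h1 h2 κ
      have h4 := le_ciSup (hbdd κ) x
      have h5 : RCLike.re ⟪κ, ((x : 𝓗 →L[ℂ] 𝓗) - x₀) κ⟫_ℂ ≤ δ := by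
        rw [sub_apply, inner_sub_right, map_sub]; linarith
      have h6 : ‖((x : 𝓗 →L[ℂ] 𝓗) - x₀) κ‖ ^ 2 ≤ (ε / 3) ^ 2 := by
        refine h3.trans ?_
        calc ‖y‖ * RCLike.re ⟪κ, ((x : 𝓗 →L[ℂ] 𝓗) - x₀) κ⟫_ℂ ≤ (‖y‖ + 1) * δ :=
              mul_le_mul (by linarith) h5 (re_inner_nonneg_of_nonneg h1 κ) hy1.le
          _ = (ε / 3) ^ 2 := by rw [hδ]; field_simp
      exact (sq_le_sq₀ (norm_nonneg _) (by positivity)).1 h6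
    refine ⟨Set.image (fun x : D => (x : 𝓗 →L[ℂ] 𝓗) κ) (Set.Ici x₀), image_mem_map (Ici_mem_atTop x₀), ?_⟩
    rintro _ ⟨x, hx, rfl⟩ _ ⟨x', hx', rfl⟩
    have h1 := key x hx
    have h2 := key x' hx'
    rw [← dist_eq_norm] at h1 h2
    have h3 := dist_triangle_right ((x : 𝓗 →L[ℂ] 𝓗) κ) ((x' : 𝓗 →L[ℂ] 𝓗) κ) ((x₀ : 𝓗 →L[ℂ] 𝓗) κ)
    simp only
    linarith
  choose f hf using hlim
  obtain ⟨T, hT, -, -⟩ := exists_clm_of_norm_sum_le (ι := 𝓗) (fun κ => κ) f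
    (ContinuousLinearMap.opNorm_nonneg y) (by
      intro s c
      have h1 : Tendsto (fun x : D => ‖∑ i ∈ s, c i • (x : 𝓗 →L[ℂ] 𝓗) i‖) atTop
          (𝓝 ‖∑ i ∈ s, c i • f i‖) :=
        (tendsto_finsetSum _ fun i _ => (hf i).const_smul (c i)).norm
      refine le_of_tendsto' h1 fun x => ?_
      have h2 : ∑ i ∈ s, c i • (x : 𝓗 →L[ℂ] 𝓗) i = (x : 𝓗 →L[ℂ] 𝓗) (∑ i ∈ s, c i • i) := by
        rw [map_sum]; simp
      rw [h2]
      refine ((x : 𝓗 →L[ℂ] 𝓗).le_opNorm _).trans (mul_le_mul_of_nonneg_right ?_ (norm_nonneg _))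
      exact CStarAlgebra.norm_le_norm_of_nonneg_of_le (hD x x.2).1 (hD x x.2).2)
  have hfT : ∀ κ, Tendsto (fun x : D => (x : 𝓗 →L[ℂ] 𝓗) κ) atTop (𝓝 (T κ)) := fun κ => by
    rw [hT]; exact hf κ
  have hre : ∀ κ, Tendsto (fun x : D => RCLike.re ⟪κ, (x : 𝓗 →L[ℂ] 𝓗) κ⟫_ℂ) atTop
      (𝓝 (RCLike.re ⟪κ, T κ⟫_ℂ)) := fun κ =>
    (RCLike.continuous_re.tendsto _).comp (tendsto_const_nhds.inner (hfT κ))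
  have hsa : ∀ x : D, IsSelfAdjoint (x : 𝓗 →L[ℂ] 𝓗) := fun x => .of_nonneg (hD x x.2).1
  have hTsa : IsSelfAdjoint T := by
    refine ContinuousLinearMap.ext fun κ => ext_inner_left ℂ fun v => ?_
    rw [inner_star_right]
    refine tendsto_nhds_unique (f := fun x : D => ⟪(x : 𝓗 →L[ℂ] 𝓗) v, κ⟫_ℂ) (l := atTop)
      ((hfT v).inner tendsto_const_nhds) ?_
    have h1 : (fun x : D => ⟪(x : 𝓗 →L[ℂ] 𝓗) v, κ⟫_ℂ) = fun x : D => ⟪v, (x : 𝓗 →L[ℂ] 𝓗) κ⟫_ℂ := by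
      ext x
      rw [← inner_star_right, (hsa x).star_eq]
    rw [h1]
    exact tendsto_const_nhds.inner (hfT κ)
  refine ⟨T, ?_, ?_, ?_⟩
  · refine mem_of_forall_commutant fun z hz => ContinuousLinearMap.ext fun κ => ?_
    rw [mul_apply_eq_comp, mul_apply_eq_comp]
    refine tendsto_nhds_unique ((z.continuous.tendsto _).comp (hfT κ)) ?_
    refine (hfT (z κ)).congr fun x => ?_
    exact (DFunLike.congr_fun (VonNeumannAlgebra.mem_commutant_iff.1 hz x (hDS x x.2)) κ)
  · intro x hx
    exact le_of_forall_re_inner_le (hsa ⟨x, hx⟩) hTsa fun κ =>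
      (hmono κ).ge_of_tendsto (hre κ) ⟨x, hx⟩
  · intro u hu
    obtain ⟨x, hx⟩ := hne
    have husa : IsSelfAdjoint u := .of_nonneg ((hD x hx).1.trans (hu hx))
    exact le_of_forall_re_inner_le hTsa husa fun κ =>
      le_of_tendsto' (hre κ) fun x => re_inner_le_of_le (hu x.2) κ

end MonotoneSup

/-! ### Vector functionals dominated by a normal semifinite weight -/

section Subordinate

variable {K : Type*} [NormedAddCommGroup K] [InnerProductSpace ℂ K] [CompleteSpace K]
  {A : VonNeumannAlgebra K} {Φ : (K →L[ℂ] K) → ℝ≥0∞}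

theorem IsFNSWeight.mono (hΦ : IsFNSWeight A Φ) {x y : K →L[ℂ] K} (hx : x ∈ positivePart A)
    (hy : y ∈ A) (hxy : x ≤ y) : Φ x ≤ Φ y := by
  have h1 := hΦ.add x hx (y - x) ⟨sub_mem hy hx.1, sub_nonneg.2 hxy⟩
  rw [add_sub_cancel] at h1
  rw [h1]
  exact le_self_add

theorem IsFNSWeight.map_zero (hΦ : IsFNSWeight A Φ) : Φ 0 = 0 := by
  have h1 := hΦ.smul 0 0 ⟨zero_mem _, le_rfl⟩
  simpa using h1

theorem vectorWeight_mono (ζ : K) {x y : K →L[ℂ] K} (h : x ≤ y) :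
    vectorWeight ζ x ≤ vectorWeight ζ y :=
  ENNReal.ofReal_le_ofReal (re_inner_le_of_le h ζ)

theorem vectorWeight_add (ζ : K) {x y : K →L[ℂ] K} (hx : 0 ≤ x) (hy : 0 ≤ y) :
    vectorWeight ζ (x + y) = vectorWeight ζ x + vectorWeight ζ y := by
  rw [vectorWeight, add_apply, inner_add_right, map_add, ENNReal.ofReal_add
    (re_inner_nonneg_of_nonneg hx ζ) (re_inner_nonneg_of_nonneg hy ζ)]
  rfl

/-- A positive multiple of the weight dominates a vector functional on an order interval. -/
theorem IsFNSWeight.exists_dominating_interval (hΦ : IsFNSWeight A Φ) {y₁ : K →L[ℂ] K}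
    (hy₁ : y₁ ∈ positivePart A) (ζ : K) {n : ℝ≥0∞} (hn : vectorWeight ζ y₁ < n * Φ y₁) :
    ∃ y ∈ positivePart A, y ≤ y₁ ∧ y ≠ 0 ∧
      ∀ x ∈ positivePart A, x ≤ y → vectorWeight ζ x ≤ n * Φ x := by
  -- Exhaustion: normality of `Φ` gives a maximal `x₀` with `n Φ x₀` at most the functional. The
  -- strict inequality `hn` keeps `x₀ ≠ y₁`, and an element below `y₁ - x₀` violating the domination
  -- could be added to `x₀`.
  set Z : Set (K →L[ℂ] K) := {x | x ∈ positivePart A ∧ x ≤ y₁ ∧ n * Φ x ≤ vectorWeight ζ x}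
  obtain ⟨x₀, hx₀⟩ : ∃ x₀, Maximal (· ∈ Z) x₀ := by
    refine zorn_le₀ Z fun C hCZ hC => ?_
    rcases C.eq_empty_or_nonempty with rfl | hne
    · exact ⟨0, ⟨⟨zero_mem _, le_rfl⟩, hy₁.2, by rw [hΦ.map_zero, mul_zero]; exact zero_le⟩,
        fun _ h => absurd h (Set.notMem_empty _)⟩
    · have hdir : DirectedOn (· ≤ ·) C := hC.directedOn
      obtain ⟨x, hxA, hx⟩ := exists_isLUB_of_directedOn A (fun x hx => (hCZ hx).1.1) hne hdir
        (y := y₁) fun x hx => ⟨(hCZ hx).1.2, (hCZ hx).2.1⟩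
      obtain ⟨c, hc⟩ := hne
      refine ⟨x, ⟨⟨hxA, (hCZ hc).1.2.trans (hx.1 hc)⟩, hx.2 fun c hc => (hCZ hc).2.1, ?_⟩, hx.1⟩
      rw [hΦ.normal C (fun c hc => (hCZ hc).1) ⟨c, hc⟩ hdir x hxA hx, ENNReal.mul_iSup]
      refine iSup_le fun d => ?_
      rw [ENNReal.mul_iSup]
      exact iSup_le fun hd => (hCZ hd).2.2.trans (vectorWeight_mono ζ (hx.1 hd))
  obtain ⟨⟨hx₀A, hx₀y, hx₀n⟩, hmax⟩ := hx₀
  refine ⟨y₁ - x₀, ⟨sub_mem hy₁.1 hx₀A.1, sub_nonneg.2 hx₀y⟩, sub_le_self _ hx₀A.2, ?_, ?_⟩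
  · intro h
    rw [sub_eq_zero.1 h] at hn
    exact absurd hx₀n (not_le.2 hn)
  · intro x hx hxy
    by_contra hcon
    have hxn := (not_le.1 hcon).le
    have h1 : x₀ + x ∈ Z := by
      refine ⟨⟨add_mem hx₀A.1 hx.1, add_nonneg hx₀A.2 hx.2⟩, ?_, ?_⟩
      · rw [add_comm]; exact le_sub_iff_add_le.1 hxy
      · rw [hΦ.add _ hx₀A _ hx, mul_add, vectorWeight_add ζ hx₀A.2 hx.2]
        exact add_le_add hx₀n hxn
    have h2 := hmax h1 (le_add_of_nonneg_right hx.2)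
    have h3 : x = 0 := le_antisymm (by simpa using h2) hx.2
    rw [h3] at hcon
    simp [vectorWeight] at hcon

theorem vectorWeight_smul (ζ : K) (c : ℝ≥0) (x : K →L[ℂ] K) :
    vectorWeight ζ (((c : ℝ) : ℂ) • x) = c * vectorWeight ζ x := by
  rw [vectorWeight, smul_apply, inner_smul_right, ← RCLike.ofReal_eq_complex_ofReal,
    RCLike.re_ofReal_mul, ENNReal.ofReal_mul c.coe_nonneg, ENNReal.ofReal_coe_nnreal]
  rfl

theorem vectorWeight_conj (ζ : K) {h : K →L[ℂ] K} (hh : IsSelfAdjoint h) (x : K →L[ℂ] K) :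
    vectorWeight (h ζ) x = vectorWeight ζ (h * x * h) := by
  rw [vectorWeight, vectorWeight, mul_apply_eq_comp, mul_apply_eq_comp, ← inner_star_left h,
    hh.star_eq]

theorem exists_le_smul_one {x : K →L[ℂ] K} (hx : IsSelfAdjoint x) :
    ∃ c : ℝ≥0, c ≠ 0 ∧ x ≤ ((c : ℝ) : ℂ) • (1 : K →L[ℂ] K) := by
  refine ⟨‖x‖₊ + 1, by positivity, ?_⟩
  have h1 : x ≤ algebraMap ℝ _ ‖x‖ := hx.le_algebraMap_norm_self
  have h2 : algebraMap ℝ (K →L[ℂ] K) ‖x‖ ≤ algebraMap ℝ _ (‖x‖ + 1) :=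
    algebraMap_mono _ (by linarith)
  refine (h1.trans h2).trans_eq ?_
  rw [Algebra.algebraMap_eq_smul_one]
  exact (RCLike.real_smul_eq_coe_smul (K := ℂ) _ _)

theorem conj_le_smul {h x : K →L[ℂ] K} (hh : IsSelfAdjoint h) {c : ℂ}
    (hx : x ≤ c • (1 : K →L[ℂ] K)) : h * x * h ≤ c • (h * h) := by
  have h1 := star_right_conjugate_nonneg (sub_nonneg.2 hx) h
  rw [hh.star_eq, mul_sub, sub_mul, mul_smul_comm, mul_one, smul_mul_assoc] at h1
  exact sub_nonneg.1 h1

/-- A faithful normal semifinite weight on an abelian von Neumann algebra dominates enough vector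
functionals. -/
theorem IsFNSWeight.exists_subordinate (hA : ∀ x ∈ A, ∀ y ∈ A, x * y = y * x)
    (hΦ : IsFNSWeight A Φ) {a : K →L[ℂ] K} (ha : a ∈ positivePart A) (ha0 : a ≠ 0) :
    ∃ ζ : K, (∀ x ∈ positivePart A, vectorWeight ζ x ≤ Φ x) ∧ vectorWeight ζ a ≠ 0 := by
  obtain ⟨y₀, hy₀, hy₀a, hy₀0, hy₀Φ⟩ := hΦ.semifinite a ha ha0
  obtain ⟨ζ₀, hζ₀⟩ : ∃ ζ₀, y₀ ζ₀ ≠ 0 := by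
    by_contra! hcon
    exact hy₀0 (ContinuousLinearMap.ext hcon)
  -- The support of `ζ₀` in `A`: the projection onto the closure of `A' ζ₀` lies in `A`, and `ζ₀`
  -- separates `A p`.
  set p := jonesProjection A.commutant ζ₀ with hp
  have hpA : p ∈ A := by
    have : p ∈ A.commutant.commutant := jonesProjection_mem_commutant
    rwa [VonNeumannAlgebra.commutant_commutant] at this
  have hpp : IsStarProjection p := jonesProjection_isStarProjection _ _
  have hpsa := hpp.isSelfAdjoint
  have hpζ : p ζ₀ = ζ₀ := jonesProjection_apply_self
  have hfaith : ∀ x ∈ A, x ζ₀ = 0 → x * p = 0 := by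
    intro x hx hx0
    refine ContinuousLinearMap.ext fun κ => ?_
    have h1 : p κ ∈ closure {κ | ∃ b ∈ A.commutant, κ = b ζ₀} := by
      rw [← coe_ltwo]; exact jonesProjection_apply_mem _
    refine closure_minimal (t := {κ | x κ = 0}) ?_
      (isClosed_eq x.continuous continuous_const) h1
    rintro _ ⟨b, hb, rfl⟩
    rw [Set.mem_ofPred_eq, ← mul_apply_eq_comp, VonNeumannAlgebra.mem_commutant_iff.1 hb x hx,
      mul_apply_eq_comp, hx0, _root_.map_zero]
  set y₁ := p * y₀ * p with hy₁
  have hy₁A : y₁ ∈ positivePart A := by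
    refine ⟨mul_mem (mul_mem hpA hy₀.1) hpA, ?_⟩
    have := star_right_conjugate_nonneg hy₀.2 p
    rwa [hpsa.star_eq] at this
  have hy₁le : y₁ ≤ y₀ := by
    have h1 := star_right_conjugate_nonneg hy₀.2 (1 - p)
    rw [star_sub, star_one, hpsa.star_eq] at h1
    have h2 : (1 - p) * y₀ * (1 - p) = y₀ - y₁ := by
      have h3 : y₀ * p = y₁ := by
        rw [hy₁, hA p hpA y₀ hy₀.1, mul_assoc, hpp.isIdempotentElem.eq]
      rw [sub_mul, one_mul, mul_sub, mul_one, sub_mul, ← hy₁, h3, hA p hpA y₀ hy₀.1, h3, sub_self,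
        sub_zero]
    rw [h2] at h1
    exact sub_nonneg.1 h1
  have hy₁0 : y₁ ≠ 0 := by
    intro h
    apply hζ₀
    have h1 : y₁ ζ₀ = y₀ ζ₀ := by
      rw [hy₁, hA p hpA y₀ hy₀.1, mul_assoc, hpp.isIdempotentElem.eq, mul_apply_eq_comp, hpζ]
    rw [← h1, h]; rfl
  have hΦ0 : Φ y₁ ≠ 0 := fun h => hy₁0 (hΦ.faithful _ hy₁A h)
  have hΦt : Φ y₁ ≠ ∞ := ((hΦ.mono hy₁A hy₀.1 hy₁le).trans_lt hy₀Φ).ne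
  have hωt : vectorWeight ζ₀ y₁ ≠ ∞ := ENNReal.ofReal_ne_top
  obtain ⟨n, hn⟩ : ∃ n : ℝ≥0, vectorWeight ζ₀ y₁ < n * Φ y₁ := by
    refine ⟨(vectorWeight ζ₀ y₁ / Φ y₁ + 1).toNNReal, ?_⟩
    rw [ENNReal.coe_toNNReal (ENNReal.add_ne_top.2 ⟨ENNReal.div_ne_top hωt hΦ0, ENNReal.one_ne_top⟩),
      add_mul, ENNReal.div_mul_cancel hΦ0 hΦt, one_mul]
    exact ENNReal.lt_add_right hωt hΦ0
  obtain ⟨y, hyA, hyy₁, hy0, hdom⟩ := hΦ.exists_dominating_interval hy₁A ζ₀ hn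
  -- The functional of `h ζ₀` is that of `ζ₀` at `h x h`. Some multiple of `h x h` lies below `y`,
  -- so domination extends to all `x` by homogeneity; and `Φ (h x h) ≤ c Φ x` because `h x h = √x y
  -- √x` and `y ≤ c`. The factor `(n c)⁻¹` then brings the functional below `Φ`.
  obtain ⟨h, hhA, hh0, hhy⟩ := exists_sqrt_mem A hyA.1 hyA.2
  have hhsa : IsSelfAdjoint h := .of_nonneg hh0
  have hconj : ∀ x ∈ positivePart A, h * x * h ∈ positivePart A := by
    refine fun x hx => ⟨mul_mem (mul_mem hhA hx.1) hhA, ?_⟩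
    have := star_right_conjugate_nonneg hx.2 h
    rwa [hhsa.star_eq] at this
  have hdom' : ∀ x ∈ positivePart A, vectorWeight ζ₀ (h * x * h) ≤ n * Φ (h * x * h) := by
    intro x hx
    obtain ⟨c, hc, hxc⟩ := exists_le_smul_one (IsSelfAdjoint.of_nonneg hx.2)
    have h1 := conj_le_smul hhsa hxc
    rw [hhy] at h1
    have hcinv : ∀ x : K →L[ℂ] K, 0 ≤ x → 0 ≤ (((c⁻¹ : ℝ≥0) : ℝ) : ℂ) • x := fun x hx =>
      (smul_nonneg (c⁻¹).coe_nonneg hx).trans_eq (RCLike.real_smul_eq_coe_smul (K := ℂ) _ _)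
    have h2 : (((c⁻¹ : ℝ≥0) : ℝ) : ℂ) • (h * x * h) ≤ y := by
      have h3 := hcinv _ (sub_nonneg.2 h1)
      rw [smul_sub, smul_smul, ← Complex.ofReal_mul, ← NNReal.coe_mul, inv_mul_cancel₀ hc,
        NNReal.coe_one, Complex.ofReal_one, one_smul] at h3
      exact sub_nonneg.1 h3
    have h4 := hdom _ ⟨smul_mem_vn A _ (hconj x hx).1, hcinv _ (hconj x hx).2⟩ h2
    rw [vectorWeight_smul, hΦ.smul _ _ (hconj x hx), mul_left_comm] at h4
    exact (ENNReal.mul_le_mul_iff_right (by simpa using hc) ENNReal.coe_ne_top).1 h4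
  obtain ⟨c, hc, hyc⟩ := exists_le_smul_one (IsSelfAdjoint.of_nonneg hyA.2)
  have hΦle : ∀ x ∈ positivePart A, Φ (h * x * h) ≤ c * Φ x := by
    intro x hx
    obtain ⟨k, hkA, hk0, hkx⟩ := exists_sqrt_mem A hx.1 hx.2
    have h1 := conj_le_smul (IsSelfAdjoint.of_nonneg hk0) hyc
    rw [hkx] at h1
    have h2 : h * x * h = k * y * k := by
      rw [hA h hhA x hx.1, mul_assoc, hhy, ← hkx, mul_assoc, mul_assoc, hA k hkA y hyA.1]
    rw [← hΦ.smul _ _ hx, h2]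
    exact hΦ.mono (h2 ▸ hconj x hx) (smul_mem_vn A _ hx.1) h1
  set s : ℝ≥0 := NNReal.sqrt (n * c)⁻¹ with hs
  have hn0 : n ≠ 0 := by rintro rfl; simp at hn
  have hs2 : s * s = (n * c)⁻¹ := NNReal.mul_self_sqrt _
  have hscale : ∀ x, vectorWeight (((s : ℝ) : ℂ) • h ζ₀) x =
      ((n * c)⁻¹ : ℝ≥0) * vectorWeight ζ₀ (h * x * h) := by
    intro x
    rw [← vectorWeight_conj _ hhsa, ← hs2, ← vectorWeight_smul, vectorWeight, vectorWeight,
      map_smul, smul_apply, inner_smul_left, inner_smul_right, inner_smul_right,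
      Complex.conj_ofReal, ← mul_assoc, NNReal.coe_mul, Complex.ofReal_mul]
  refine ⟨((s : ℝ) : ℂ) • h ζ₀, fun x hx => ?_, ?_⟩
  · rw [hscale]
    calc (((n * c)⁻¹ : ℝ≥0) : ℝ≥0∞) * vectorWeight ζ₀ (h * x * h)
        ≤ ((n * c)⁻¹ : ℝ≥0) * (n * (c * Φ x)) := by
          gcongr
          exact (hdom' x hx).trans (by gcongr; exact hΦle x hx)
      _ = Φ x := by
        rw [← mul_assoc (n : ℝ≥0∞), ← ENNReal.coe_mul, ← mul_assoc, ← ENNReal.coe_mul,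
          inv_mul_cancel₀ (mul_ne_zero hn0 hc), ENNReal.coe_one, one_mul]
  · have hya : y ≤ a := hyy₁.trans (hy₁le.trans hy₀a)
    refine ((lt_of_lt_of_le ?_ (vectorWeight_mono _ hya))).ne'
    rw [hscale]
    refine ENNReal.mul_pos (by simpa using ⟨hc, hn0⟩) ?_
    have h1 : h * y * h = star y * y := by
      rw [(IsSelfAdjoint.of_nonneg hyA.2).star_eq, hA h hhA y hyA.1, mul_assoc, hhy]
    rw [h1, vectorWeight, ← norm_sq_eq_re_inner, ne_eq, ENNReal.ofReal_eq_zero, not_le]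
    refine pow_pos (norm_pos_iff.2 fun hcon => hy0 ?_) 2
    have h2 := hfaith y hyA.1 hcon
    have h3 := star_right_conjugate_nonneg (sub_nonneg.2 hyy₁) (1 - p)
    have h4 : y₁ * (1 - p) = 0 := by
      rw [mul_sub, mul_one, hy₁, mul_assoc _ p p, hpp.isIdempotentElem.eq, sub_self]
    have h5 : y * (1 - p) = y := by rw [mul_sub, h2, mul_one, sub_zero]
    have h6 : (1 - p) * y = y := by
      rw [← hA y hyA.1 _ (sub_mem (one_mem _) hpA), h5]
    rw [star_sub, star_one, hpsa.star_eq, mul_assoc, sub_mul y₁, h4, h5, zero_sub, mul_neg, h6] at h3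
    exact le_antisymm (neg_nonneg.1 h3) hyA.2

end Subordinate

/-! ### Approximate units of the basic construction built from the Jones projection -/

section ApproximateUnit

variable {H : Type*} [NormedAddCommGroup H] [InnerProductSpace ℂ H] [CompleteSpace H]
  {M B : VonNeumannAlgebra H} {ξ : H}

theorem sum_star_mul_mul_nonneg {e : H →L[ℂ] H} (he : IsStarProjection e) {ι : Type*}
    (s : Finset ι) (v : ι → (H →L[ℂ] H)) : 0 ≤ ∑ i ∈ s, star (v i) * e * v i :=
  Finset.sum_nonneg fun i _ => star_left_conjugate_nonneg he.nonneg (v i)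

theorem cfc_mul_self_mul {t : H →L[ℂ] H} (ht : 0 ≤ t) {u : ℝ → ℝ}
    (hu : ContinuousOn u (spectrum ℝ t)) :
    cfc u t * t * cfc u t = cfc (fun r => u r * r * u r) t := by
  rw [cfc_mul (fun r => u r * r) u t (hu.mul (continuousOn_id' _)) hu, cfc_mul u (fun r => r) t hu
    (continuousOn_id' _), cfc_id' ℝ t]

/-- Finitely many vectors `x ξ` with `x ∈ M` are almost fixed by some `∑ vⱼ* e vⱼ ≤ 1` with
`vⱼ ∈ ⟨M, e⟩`. -/
theorem exists_approximate_unit (M B : VonNeumannAlgebra H) (ξ : H) (F : Finset M) {ε : ℝ}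
    (hε : 0 < ε) :
    ∃ v : Fin F.card → (H →L[ℂ] H), (∀ i, v i ∈ basicConstruction M B ξ) ∧
      ∑ i, star (v i) * jonesProjection B ξ * v i ≤ 1 ∧
      ∀ x ∈ F, ‖(1 - ∑ i, star (v i) * jonesProjection B ξ * v i) ((x : H →L[ℂ] H) ξ)‖ ^ 2 ≤
        ε * ‖ξ‖ ^ 2 := by
  set e := jonesProjection B ξ with he
  have hep : IsStarProjection e := jonesProjection_isStarProjection B ξ
  let f : Fin F.card → (H →L[ℂ] H) := fun i => ((F.equivFin.symm i : F) : M)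
  have hfM : ∀ i, f i ∈ M := fun i => ((F.equivFin.symm i : F) : M).2
  set t : H →L[ℂ] H := ∑ i, star (star (f i)) * e * star (f i) with ht
  have ht0 : 0 ≤ t := sum_star_mul_mul_nonneg hep _ _
  have htN : t ∈ basicConstruction M B ξ := sum_mem fun i _ => mul_mem (mul_mem
    (star_mem (star_mem (mem_basicConstruction (hfM i)))) jonesProjection_mem_basicConstruction)
    (star_mem (mem_basicConstruction (hfM i)))
  have hsp : ∀ r ∈ spectrum ℝ t, 0 ≤ r := fun r hr => spectrum_nonneg_of_nonneg ht0 hr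
  set h : H →L[ℂ] H := cfc (fun r : ℝ => (√(r + ε))⁻¹) t with hh
  have hcont : ContinuousOn (fun r : ℝ => (√(r + ε))⁻¹) (spectrum ℝ t) := by
    refine ContinuousOn.inv₀ (by fun_prop) fun r hr => ?_
    exact (Real.sqrt_pos.2 (by linarith [hsp r hr])).ne'
  have hhsa : IsSelfAdjoint h := cfc_predicate _ t
  have hhN : h ∈ basicConstruction M B ξ := cfc_mem_vn _ htN _
  have hsum : ∑ i, star (star (f i) * h) * e * (star (f i) * h) = h * t * h := by
    rw [ht, Finset.mul_sum, Finset.sum_mul]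
    refine Finset.sum_congr rfl fun i _ => ?_
    rw [star_mul, hhsa.star_eq]
    simp only [mul_assoc]
  have hcont2 : ContinuousOn (fun r : ℝ => ε * (r + ε)⁻¹) (spectrum ℝ t) := by
    refine continuousOn_const.mul (ContinuousOn.inv₀ (by fun_prop) fun r hr => ?_)
    linarith [hsp r hr]
  have hone : 1 - h * t * h = cfc (fun r : ℝ => ε * (r + ε)⁻¹) t := by
    have h1 : h * t * h = cfc (fun r : ℝ => (√(r + ε))⁻¹ * r * (√(r + ε))⁻¹) t := by
      rw [hh, cfc_mul_self_mul ht0 hcont]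
    rw [h1, ← cfc_const_one ℝ t, ← cfc_sub (fun _ => (1 : ℝ))
      (fun r : ℝ => (√(r + ε))⁻¹ * r * (√(r + ε))⁻¹) t continuousOn_const
      ((hcont.mul (continuousOn_id' _)).mul hcont)]
    refine cfc_congr fun r hr => ?_
    have hr0 : 0 < r + ε := by linarith [hsp r hr]
    have h2 : (√(r + ε))⁻¹ * r * (√(r + ε))⁻¹ = r * (r + ε)⁻¹ := by
      rw [mul_comm _ r, mul_assoc, ← mul_inv, Real.mul_self_sqrt hr0.le]
    simp only [h2]
    field_simp
    ring
  set g : H →L[ℂ] H := 1 - h * t * h with hg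
  have hg0 : 0 ≤ g := by
    rw [hone]
    exact cfc_nonneg fun r hr => by
      have := hsp r hr
      positivity
  have hgsa : star g = g := (IsSelfAdjoint.of_nonneg hg0).star_eq
  have hgtg : g * t * g ≤ algebraMap ℝ _ ε := by
    have h1 : g * t * g = cfc (fun r : ℝ => ε * (r + ε)⁻¹ * r * (ε * (r + ε)⁻¹)) t := by
      rw [hone, cfc_mul_self_mul ht0 hcont2]
    rw [h1]
    refine cfc_le_algebraMap _ _ _ (fun r hr => ?_)
      ((hcont2.mul (continuousOn_id' _)).mul hcont2) (IsSelfAdjoint.of_nonneg ht0)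
    have hr1 := hsp r hr
    have hr0 : 0 < r + ε := by linarith
    have h2 : ε * (r + ε)⁻¹ ≤ 1 := by
      rw [← div_eq_mul_inv, div_le_one hr0]; linarith
    have h3 : r * (r + ε)⁻¹ ≤ 1 := by
      rw [← div_eq_mul_inv, div_le_one hr0]; linarith
    have h4 : 0 ≤ ε * (r + ε)⁻¹ := by positivity
    calc ε * (r + ε)⁻¹ * r * (ε * (r + ε)⁻¹) = (ε * (r + ε)⁻¹) * (r * (r + ε)⁻¹) * ε := by ring
      _ ≤ 1 * 1 * ε := by
        refine mul_le_mul_of_nonneg_right (mul_le_mul h2 h3 (by positivity) zero_le_one) hε.le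
      _ = ε := by ring
  refine ⟨fun i => star (f i) * h,
    fun i => mul_mem (star_mem (mem_basicConstruction (hfM i))) hhN, ?_, ?_⟩
  · rw [hsum]
    exact sub_nonneg.1 hg0
  · intro x hx
    rw [hsum, ← hg]
    obtain ⟨i, hi⟩ : ∃ i, f i = (x : H →L[ℂ] H) := ⟨F.equivFin ⟨x, hx⟩, by simp [f]⟩
    rw [← hi]
    set μ := g (f i ξ) with hμ
    have h1 : ‖e (star (f i) (g μ))‖ ^ 2 ≤ ε * ‖μ‖ ^ 2 := by
      have h2 : star (star (f i)) * e * star (f i) ≤ t :=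
        Finset.single_le_sum (f := fun i => star (star (f i)) * e * star (f i))
          (fun i _ => star_left_conjugate_nonneg hep.nonneg _) (Finset.mem_univ i)
      have h3 := re_inner_le_of_le h2 (g μ)
      have h4 : RCLike.re ⟪g μ, (star (star (f i)) * e * star (f i)) (g μ)⟫_ℂ =
          ‖e (star (f i) (g μ))‖ ^ 2 := by
        rw [norm_sq_eq_re_inner, hep.isSelfAdjoint.star_eq, hep.isIdempotentElem.eq,
          mul_assoc, mul_apply_eq_comp, inner_star_right, mul_apply_eq_comp]
      have h5 : RCLike.re ⟪g μ, t (g μ)⟫_ℂ = RCLike.re ⟪μ, (g * t * g) μ⟫_ℂ := by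
        rw [mul_apply_eq_comp, mul_apply_eq_comp, ← inner_star_left g, hgsa]
      have h6 := re_inner_le_of_le hgtg μ
      rw [Algebra.algebraMap_eq_smul_one, smul_apply, one_apply_eq_self,
        inner_smul_right_eq_smul, RCLike.smul_re, inner_self_eq_norm_sq] at h6
      rw [← h4]
      exact h3.trans (h5.le.trans h6)
    -- As `e ξ = ξ`, `‖μ‖² = ⟪e fᵢ* g μ, ξ⟫`; with the previous bound this gives `‖μ‖⁴ ≤ ε ‖μ‖²
    -- ‖ξ‖²`.
    have h2 : ‖μ‖ ^ 2 ≤ ‖e (star (f i) (g μ))‖ * ‖ξ‖ := by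
      have h3 : ⟪μ, μ⟫_ℂ = ⟪e (star (f i) (g μ)), ξ⟫_ℂ := by
        have h4 : ⟪star e (star (f i) (star g μ)), ξ⟫_ℂ = ⟪μ, g (f i (e ξ))⟫_ℂ := by
          rw [inner_star_left, inner_star_left, inner_star_left]
        rw [hep.isSelfAdjoint.star_eq, hgsa] at h4
        rw [h4, he, jonesProjection_apply_self]
      rw [← inner_self_eq_norm_sq (𝕜 := ℂ), h3]
      exact (RCLike.re_le_norm _).trans (norm_inner_le_norm _ _)
    by_cases hμ0 : ‖μ‖ = 0
    · rw [hμ0, zero_pow two_ne_zero]; positivity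
    · have h3 : 0 < ‖μ‖ ^ 2 := by positivity
      have h4 : (‖μ‖ ^ 2) ^ 2 ≤ ε * ‖μ‖ ^ 2 * ‖ξ‖ ^ 2 := by
        calc (‖μ‖ ^ 2) ^ 2 ≤ (‖e (star (f i) (g μ))‖ * ‖ξ‖) ^ 2 :=
              pow_le_pow_left₀ h3.le h2 2
          _ = ‖e (star (f i) (g μ))‖ ^ 2 * ‖ξ‖ ^ 2 := by ring
          _ ≤ ε * ‖μ‖ ^ 2 * ‖ξ‖ ^ 2 := mul_le_mul_of_nonneg_right h1 (sq_nonneg _)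
      refine le_of_mul_le_mul_right ?_ h3
      calc ‖μ‖ ^ 2 * ‖μ‖ ^ 2 = (‖μ‖ ^ 2) ^ 2 := by ring
        _ ≤ _ := h4
        _ = _ := by ring

end ApproximateUnit

/-! ### A lower bound for `Φ ⊗ Tr` and an upper bound for `Φ ⊗ τ` -/

section WeightBounds

variable {K H : Type*} [NormedAddCommGroup K] [InnerProductSpace ℂ K] [CompleteSpace K]
  [NormedAddCommGroup H] [InnerProductSpace ℂ H] [CompleteSpace H]
  {A : VonNeumannAlgebra K} {M B : VonNeumannAlgebra H} {ξ : H} {Φ : (K →L[ℂ] K) → ℝ≥0∞}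

theorem tendsto_opTensor_zero (hM : IsStandardTracial M ξ) {α : Type*} {l : Filter α}
    (T : α → (H →L[ℂ] H)) (hT : ∀ i, ‖T i‖ ≤ 1)
    (h : ∀ m ∈ M, Tendsto (fun i => T i (m ξ)) l (𝓝 0)) (κ : HilbertTensor K H) :
    Tendsto (fun i => opTensor 1 (T i) κ) l (𝓝 0) := by
  have h1 : ∀ η, Tendsto (fun i => T i η) l (𝓝 0) := by
    intro η
    refine closure_minimal (t := {η | Tendsto (fun i => T i η) l (𝓝 0)}) ?_
      (isClosed_setOf_tendsto_zero (fun i => T i) (C := 1) fun i x y => ?_) (hM.cyclic η)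
    · rintro _ ⟨m, hm, rfl⟩
      exact h m hm
    · rw [← map_sub]
      exact (T i).le_of_opNorm_le (hT i) _
  let X : Submodule ℂ (HilbertTensor K H) :=
    { carrier := {κ | Tendsto (fun i => opTensor 1 (T i) κ) l (𝓝 0)}
      add_mem' := fun {a b} ha hb => by
        have := Tendsto.add ha hb
        simpa only [Set.mem_ofPred_eq, map_add, add_zero] using this
      zero_mem' := by
        simpa only [Set.mem_ofPred_eq, map_zero] using tendsto_const_nhds
      smul_mem' := fun c a ha => by
        have := Tendsto.const_smul ha c
        simpa only [Set.mem_ofPred_eq, map_smul, smul_zero] using this }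
  refine mem_of_forall_vecTensor (X := X) ?_ (fun ζ η => ?_) κ
  · refine isClosed_setOf_tendsto_zero (fun i => opTensor (1 : K →L[ℂ] K) (T i)) (C := 1)
      fun i x y => ?_
    rw [← map_sub]
    exact (opTensor 1 (T i)).le_of_opNorm_le ((norm_opTensor_one_le _).trans (hT i)) _
  · change Tendsto (fun i => opTensor 1 (T i) (vecTensor ζ η)) l (𝓝 0)
    have h2 := ((leftTensor (H := H) ζ).continuous.tendsto 0).comp (h1 η)
    rw [map_zero] at h2
    refine h2.congr fun i => ?_
    rw [opTensor_vecTensor]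
    rfl

theorem opTensor_jones_apply (ζ : K) :
    opTensor 1 (jonesProjection B ξ) (vecTensor ζ ξ) = vecTensor ζ ξ := by
  rw [opTensor_vecTensor, jonesProjection_apply_self, one_apply_eq_self]

/-- The compression of `W (1 ⊗ v*)` is `b E` with `b ∈ A ⊗ B`. The two sides are `‖b Ω‖` and `‖b*
Ω‖` for `Ω = ζ ⊗ ξ`, equal by traciality. This is how `W* W` is exchanged with `W W*` under the
trace. -/
theorem norm_apply_vecTensor_star (hA : ∀ x ∈ A, ∀ y ∈ A, x * y = y * x)
    (hM : IsStandardTracial M ξ) (hBM : B ≤ M) {W : HilbertTensor K H →L[ℂ] HilbertTensor K H}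
    (hW : W ∈ vnTensor A (basicConstruction M B ξ))
    (hEW : opTensor 1 (jonesProjection B ξ) * W = W) {v : H →L[ℂ] H}
    (hv : v ∈ basicConstruction M B ξ) (ζ : K) :
    ‖W (vecTensor ζ (star v ξ))‖ =
      ‖opTensor 1 (jonesProjection B ξ * v) (star W (vecTensor ζ ξ))‖ := by
  set E : HilbertTensor K H →L[ℂ] HilbertTensor K H := opTensor 1 (jonesProjection B ξ) with hE
  have hEsa : star E = E := opTensor_jones_isStarProjection.isSelfAdjoint.star_eq
  have hEΩ : E (vecTensor ζ ξ) = vecTensor ζ ξ := opTensor_jones_apply ζ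
  obtain ⟨b, hb, hbE⟩ := exists_vnTensor_compression_eq hA hM hBM
    (mul_mem hW (opTensor_mem (one_mem A) (star_mem hv)))
  have hEb : star b * E = E * star b :=
    VonNeumannAlgebra.mem_commutant_iff.1 opTensor_jones_mem_commutant _ (star_mem hb)
  have h1 : W (vecTensor ζ (star v ξ)) = b (vecTensor ζ ξ) := by
    have h2 := DFunLike.congr_fun hbE (vecTensor ζ ξ)
    rw [← mul_assoc, hEW] at h2
    simp only [mul_apply_eq_comp] at h2
    rw [← hE, hEΩ, opTensor_vecTensor, one_apply_eq_self] at h2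
    exact h2.symm
  have h2 : star b (vecTensor ζ ξ) =
      opTensor 1 (jonesProjection B ξ * v) (star W (vecTensor ζ ξ)) := by
    have h3 := DFunLike.congr_fun (congrArg star hbE) (vecTensor ζ ξ)
    rw [star_mul, star_mul, star_mul, star_mul, ← hE, hEsa, ← hEb, star_opTensor, star_star,
      star_one] at h3
    simp only [mul_apply_eq_comp] at h3
    rw [hEΩ] at h3
    rw [h3, hE, ← mul_apply_eq_comp, opTensor_mul, one_mul]
  rw [h1, ← h2, vnTensor_norm_star_apply hA hM (vnTensor_mono hBM hb)]

theorem sum_norm_sq_eq {n : ℕ} (v : Fin n → (H →L[ℂ] H)) (κ : HilbertTensor K H) :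
    ∑ j, ‖opTensor 1 (jonesProjection B ξ * v j) κ‖ ^ 2 = RCLike.re
      ⟪κ, opTensor 1 (∑ j, star (v j) * jonesProjection B ξ * v j) κ⟫_ℂ := by
  rw [opTensor_sum_right, sum_apply, inner_sum, map_sum]
  refine Finset.sum_congr rfl fun j _ => ?_
  rw [norm_sq_eq_re_inner, star_opTensor, opTensor_mul, star_mul, star_jonesProjection, star_one,
    one_mul, mul_assoc, ← mul_assoc (jonesProjection B ξ), jonesProjection_mul_self, ← mul_assoc]

theorem vectorWeight_star_mul_self {𝓗 : Type*} [NormedAddCommGroup 𝓗] [InnerProductSpace ℂ 𝓗]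
    [CompleteSpace 𝓗] (W : 𝓗 →L[ℂ] 𝓗) (κ : 𝓗) :
    vectorWeight κ (star W * W) = ENNReal.ofReal (‖W κ‖ ^ 2) := by
  rw [vectorWeight, norm_sq_eq_re_inner]

/-- The lower bound of `Φ ⊗ Tr` on `W* W`, for `W ∈ A ⊗ ⟨M, e⟩` with range in the range of
`1 ⊗ e`, which expresses the trace property `Tr(W* W) = Tr(W W*)`. -/
theorem sum_norm_sq_le_weightTensor (hA : ∀ x ∈ A, ∀ y ∈ A, x * y = y * x)
    (hM : IsStandardTracial M ξ) (hBM : B ≤ M) {W : HilbertTensor K H →L[ℂ] HilbertTensor K H}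
    (hW : W ∈ vnTensor A (basicConstruction M B ξ))
    (hEW : opTensor 1 (jonesProjection B ξ) * W = W) {m : ℕ} {ζ : Fin m → K}
    (hζ : IsSubordinate A Φ ζ) :
    ∑ i, ENNReal.ofReal (‖star W (vecTensor (ζ i) ξ)‖ ^ 2) ≤
      weightTensor A Φ (basicConstruction M B ξ) (canonicalTrace M B ξ) (star W * W) := by
  classical
  -- Along these approximate units `1 ⊗ s p` tends strongly to `1`, so the sums over `j` of `‖E (1 ⊗
  -- vⱼ) W* Ω‖²` tend to `‖W* Ω‖²`.
  choose v hvN hv1 hvF using fun p : Finset M × ℕ =>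
    exists_approximate_unit M B ξ p.1 (ε := 1 / ((p.2 : ℝ) + 1)) (by positivity)
  set s : Finset M × ℕ → (H →L[ℂ] H) := fun p =>
    ∑ i, star (v p i) * jonesProjection B ξ * v p i with hs
  have hs0 : ∀ p, 0 ≤ s p := fun p =>
    sum_star_mul_mul_nonneg (jonesProjection_isStarProjection B ξ) _ _
  have hnorm : ∀ p, ‖1 - s p‖ ≤ 1 := fun p =>
    (CStarAlgebra.norm_le_one_iff_of_nonneg _ (sub_nonneg.2 (hv1 p))).2 (sub_le_self _ (hs0 p))
  have hlim : ∀ x ∈ M, Tendsto (fun p => (1 - s p) (x ξ)) atTop (𝓝 0) := by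
    intro x hx
    rw [tendsto_zero_iff_norm_tendsto_zero]
    have h1 : Tendsto (fun p : Finset M × ℕ => √(1 / ((p.2 : ℝ) + 1) * ‖ξ‖ ^ 2)) atTop (𝓝 0) := by
      have h2 : Tendsto (fun n : ℕ => √(1 / ((n : ℝ) + 1) * ‖ξ‖ ^ 2)) atTop
          (𝓝 (√(0 * ‖ξ‖ ^ 2))) :=
        (Real.continuous_sqrt.tendsto _).comp
          (tendsto_one_div_add_atTop_nhds_zero_nat.mul_const _)
      rw [zero_mul, Real.sqrt_zero] at h2
      rw [← prod_atTop_atTop_eq]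
      exact h2.comp tendsto_snd
    refine squeeze_zero' (Eventually.of_forall fun _ => norm_nonneg _) ?_ h1
    filter_upwards [eventually_ge_atTop (({⟨x, hx⟩} : Finset M), 0)] with p hp
    refine Real.le_sqrt_of_sq_le (hvF p ⟨x, hx⟩ (hp.1 (Finset.mem_singleton_self _)))
  have hlim2 : ∀ κ : HilbertTensor K H, Tendsto (fun p => RCLike.re ⟪κ, opTensor 1 (s p) κ⟫_ℂ) atTop
      (𝓝 (‖κ‖ ^ 2)) := by
    intro κ
    have h1 := tendsto_opTensor_zero hM (fun p => 1 - s p) hnorm hlim κ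
    have h2 : Tendsto (fun p => opTensor 1 (s p) κ) atTop (𝓝 (κ - 0)) := by
      refine (h1.const_sub κ).congr fun p => ?_
      rw [opTensor_sub_right, opTensor_one, sub_apply, one_apply_eq_self, sub_sub_cancel]
    rw [sub_zero] at h2
    have h3 := (RCLike.continuous_re.tendsto _).comp ((tendsto_const_nhds (x := κ)).inner h2 (𝕜 := ℂ))
    rwa [inner_self_eq_norm_sq] at h3
  have hlim3 : Tendsto (fun p => ∑ i, ENNReal.ofReal (RCLike.re
      ⟪star W (vecTensor (ζ i) ξ), opTensor 1 (s p) (star W (vecTensor (ζ i) ξ))⟫_ℂ)) atTop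
      (𝓝 (∑ i, ENNReal.ofReal (‖star W (vecTensor (ζ i) ξ)‖ ^ 2))) :=
    tendsto_finsetSum _ fun i _ => ENNReal.tendsto_ofReal (hlim2 _)
  refine le_of_tendsto' hlim3 fun p => ?_
  -- The condition `∑ vⱼ* e vⱼ ≤ 1` makes the vectors `vⱼ* ξ` one of the families whose supremum
  -- defines `canonicalTrace`.
  have hsub : IsSubordinate (basicConstruction M B ξ) (canonicalTrace M B ξ)
      (fun j => star (v p j) ξ) := fun t _ =>
    le_iSup_of_le _ (le_iSup_of_le (v p) (le_iSup_of_le (hvN p) (le_iSup_of_le (hv1 p) le_rfl)))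
  refine le_trans (le_of_eq ?_) (le_iSup_of_le m (le_iSup_of_le _ (le_iSup_of_le ζ
    (le_iSup_of_le (fun j => star (v p j) ξ) (le_iSup_of_le hζ (le_iSup_of_le hsub le_rfl))))))
  refine Finset.sum_congr rfl fun i _ => ?_
  rw [hs, ← sum_norm_sq_eq, ENNReal.ofReal_sum_of_nonneg fun j _ => sq_nonneg _]
  refine Finset.sum_congr rfl fun j _ => ?_
  rw [vectorWeight_star_mul_self, norm_apply_vecTensor_star hA hM hBM hW hEW (hvN p j)]

/-- The supremum of the finite sums of vector functionals dominated by a weight. -/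
noncomputable def subordinateWeight (A : VonNeumannAlgebra K) (Φ : (K →L[ℂ] K) → ℝ≥0∞)
    (x : K →L[ℂ] K) : ℝ≥0∞ :=
  ⨆ (m : ℕ) (ζ : Fin m → K) (_ : IsSubordinate A Φ ζ), ∑ i, vectorWeight (ζ i) x

theorem sum_le_subordinateWeight {m : ℕ} {ζ : Fin m → K} (hζ : IsSubordinate A Φ ζ)
    (x : K →L[ℂ] K) : ∑ i, vectorWeight (ζ i) x ≤ subordinateWeight A Φ x :=
  le_iSup_of_le m (le_iSup_of_le ζ (le_iSup_of_le hζ le_rfl))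

theorem subordinateWeight_le {x : K →L[ℂ] K} {C : ℝ≥0∞}
    (h : ∀ (m : ℕ) (ζ : Fin m → K), IsSubordinate A Φ ζ → ∑ i, vectorWeight (ζ i) x ≤ C) :
    subordinateWeight A Φ x ≤ C :=
  iSup_le fun m => iSup_le fun ζ => iSup_le fun hζ => h m ζ hζ

theorem subordinateWeight_mono {x y : K →L[ℂ] K} (h : x ≤ y) :
    subordinateWeight A Φ x ≤ subordinateWeight A Φ y :=
  subordinateWeight_le fun _ _ hζ =>
    (Finset.sum_le_sum fun _ _ => vectorWeight_mono _ h).trans (sum_le_subordinateWeight hζ y)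

theorem smul_subordinateWeight_le (c : ℝ≥0) (x : K →L[ℂ] K) :
    c * subordinateWeight A Φ x ≤ subordinateWeight A Φ (((c : ℝ) : ℂ) • x) := by
  simp only [subordinateWeight, ENNReal.mul_iSup]
  refine iSup_mono fun m => iSup_mono fun ζ => iSup_mono fun _ => ?_
  rw [Finset.mul_sum]
  simp only [vectorWeight_smul, le_refl]

theorem vectorWeight_sliceRight (T : HilbertTensor K H →L[ℂ] HilbertTensor K H) (ζ : K) :
    vectorWeight ζ (sliceRight ξ ξ T) = vectorWeight (vecTensor ζ ξ) T := by
  rw [vectorWeight, inner_sliceRight]; rfl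

theorem star_sliceLeft (ζ : K) (T : HilbertTensor K H →L[ℂ] HilbertTensor K H) :
    star (sliceLeft ζ ζ T) = sliceLeft ζ ζ (star T) := by
  refine ContinuousLinearMap.ext fun η => ext_inner_left ℂ fun η' => ?_
  rw [inner_star_right, ← inner_conj_symm, inner_sliceLeft, inner_sliceLeft, inner_conj_symm,
    inner_star_right]

theorem star_sliceRight (η : H) (T : HilbertTensor K H →L[ℂ] HilbertTensor K H) :
    star (sliceRight η η T) = sliceRight η η (star T) := by
  refine ContinuousLinearMap.ext fun ζ => ext_inner_left ℂ fun ζ' => ?_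
  rw [inner_star_right, ← inner_conj_symm, inner_sliceRight, inner_sliceRight, inner_conj_symm,
    inner_star_right]

theorem sliceLeft_nonneg {T : HilbertTensor K H →L[ℂ] HilbertTensor K H} (hT : 0 ≤ T) (ζ : K) :
    0 ≤ sliceLeft ζ ζ T := by
  refine le_of_forall_re_inner_le (IsSelfAdjoint.zero _) ?_ fun η => ?_
  · rw [IsSelfAdjoint, star_sliceLeft, (IsSelfAdjoint.of_nonneg hT).star_eq]
  · rw [inner_sliceLeft]
    simpa using re_inner_nonneg_of_nonneg hT (vecTensor ζ η)

theorem sliceRight_nonneg {T : HilbertTensor K H →L[ℂ] HilbertTensor K H} (hT : 0 ≤ T) (η : H) :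
    0 ≤ sliceRight η η T := by
  refine le_of_forall_re_inner_le (IsSelfAdjoint.zero _) ?_ fun ζ => ?_
  · rw [IsSelfAdjoint, star_sliceRight, (IsSelfAdjoint.of_nonneg hT).star_eq]
  · rw [inner_sliceRight]
    simpa using re_inner_nonneg_of_nonneg hT (vecTensor ζ η)

/-- Slicing `x` at `ζ i` leaves a positive element of `M`, on which the functional of the vectors `η
j` is at most that of `ξ`. -/
theorem weightTensor_le_subordinateWeight
    {x : HilbertTensor K H →L[ℂ] HilbertTensor K H} (hx : x ∈ vnTensor A M) (hx0 : 0 ≤ x) :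
    weightTensor A Φ M (vectorWeight ξ) x ≤ subordinateWeight A Φ (sliceRight ξ ξ x) := by
  refine iSup_le fun m => iSup_le fun n => iSup_le fun ζ => iSup_le fun η => iSup_le fun hζ =>
    iSup_le fun hη => le_trans ?_ (sum_le_subordinateWeight hζ _)
  refine Finset.sum_le_sum fun i _ => ?_
  have h1 := hη (sliceLeft (ζ i) (ζ i) x)
    ⟨sliceLeft_mem (fun n hn => vnTensor_commute_right hx hn) _ _, sliceLeft_nonneg hx0 _⟩
  rw [vectorWeight_sliceRight]
  simpa only [vectorWeight, inner_sliceLeft] using h1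

end WeightBounds

/-! ### Comparison of positive elements of `A` through a weight -/

section Comparison

variable {K : Type*} [NormedAddCommGroup K] [InnerProductSpace ℂ K] [CompleteSpace K]
  {A : VonNeumannAlgebra K} {Φ : (K →L[ℂ] K) → ℝ≥0∞}

theorem star_mul_eq (S T : K →L[ℂ] K) : star (S * T) = star T * star S := star_mul S T

theorem mul_eq_zero_of_le {y p n : K →L[ℂ] K} (hy : 0 ≤ y) (hyp : y ≤ p) (hpn : p * n = 0) :
    y * n = 0 := by
  set h := CFC.sqrt y
  have hh : h * h = y := CFC.sqrt_mul_sqrt_self y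
  have hst : star h = h := (IsSelfAdjoint.of_nonneg (CFC.sqrt_nonneg y)).star_eq
  have h1 : star (h * n) * (h * n) = 0 := by
    have h2 : star (h * n) * (h * n) = star n * y * n := by
      rw [star_mul, hst, mul_assoc, ← mul_assoc h, hh, mul_assoc]
    refine le_antisymm ?_ (star_mul_self_nonneg _)
    have h3 := star_left_conjugate_nonneg (sub_nonneg.2 hyp) n
    rw [mul_sub, sub_mul, mul_assoc _ p, hpn, mul_zero, zero_sub, ← h2] at h3
    exact neg_nonneg.1 h3
  rw [← hh, mul_assoc, (CStarRing.star_mul_self_eq_zero_iff _).1 h1, mul_zero]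

theorem conj_projection_eq (hA : ∀ x ∈ A, ∀ y ∈ A, x * y = y * x) {s x : K →L[ℂ] K}
    (hs : IsStarProjection s) (hsA : s ∈ A) (hx : x ∈ A) : s * x * star s = x * s := by
  rw [hs.isSelfAdjoint.star_eq, hA s hsA x hx, mul_assoc, hs.isIdempotentElem.eq]

theorem coe_smul_eq (c : ℝ) (x : K →L[ℂ] K) : (c : ℂ) • x = c • x :=
  (RCLike.real_smul_eq_coe_smul (K := ℂ) c x).symm

theorem subordinateWeight_le_weight (x : K →L[ℂ] K) (hx : x ∈ positivePart A) :
    subordinateWeight A Φ x ≤ Φ x :=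
  subordinateWeight_le fun _ _ hζ => hζ x hx

theorem mul_projection_mono (hA : ∀ x ∈ A, ∀ y ∈ A, x * y = y * x) {s x y : K →L[ℂ] K}
    (hs : IsStarProjection s) (hsA : s ∈ A) (hx : x ∈ A) (hy : y ∈ A) (h : x ≤ y) :
    x * s ≤ y * s := by
  have h1 := star_right_conjugate_nonneg (sub_nonneg.2 h) s
  rw [conj_projection_eq hA hs hsA (sub_mem hy hx), sub_mul] at h1
  exact sub_nonneg.1 h1

/-- Positive elements of an abelian von Neumann algebra can be compared through a weight on all
their compressions. -/
theorem IsFNSWeight.le_of_subordinateWeight_le (hA : ∀ x ∈ A, ∀ y ∈ A, x * y = y * x)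
    (hΦ : IsFNSWeight A Φ) {F G : K →L[ℂ] K} (hF : F ∈ positivePart A) (hG : G ∈ positivePart A)
    (hG1 : G ≤ 1) (h : ∀ p ∈ A, IsStarProjection p →
      subordinateWeight A Φ (F * p) ≤ subordinateWeight A Φ (G * p)) : F ≤ G := by
  -- Otherwise the positive part `p` of `F - G` is nonzero. Semifiniteness gives a nonzero `y ≤ p`
  -- of finite weight, and its spectral projection `t` for `(ε, ∞)`, `ε = ‖y‖ / 2`, is nonzero, of
  -- finite weight, and satisfies `ε t ≤ p t`.
  by_contra hcon
  have hmem : ∀ {z s : K →L[ℂ] K}, z ∈ A →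
      (∀ y, y * z = z * y → star y * z = z * star y → y * s = s * y) → s ∈ A := fun hz hs =>
    mem_of_forall_commutant fun y hy => hs y
      (VonNeumannAlgebra.mem_commutant_iff.1 hy _ hz).symm
      (VonNeumannAlgebra.mem_commutant_iff.1 (star_mem hy) _ hz).symm
  have hdA : F - G ∈ A := sub_mem hF.1 hG.1
  obtain ⟨s, p, n, hs, hp, hn, hsp, hps, hsn, hns, hd, hcomm, -⟩ := exists_spectral_cut
    ((IsSelfAdjoint.of_nonneg hF.2).sub (IsSelfAdjoint.of_nonneg hG.2)) 0
  rw [zero_smul, zero_add] at hd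
  have hsA : s ∈ A := hmem hdA hcomm
  have hpA : p ∈ A := by
    have : p = s * (F - G) := by rw [hd, mul_sub, hsp, hsn, sub_zero]
    rw [this]
    exact mul_mem hsA hdA
  have hp0 : p ≠ 0 := by
    intro h0
    rw [h0, zero_sub] at hd
    refine hcon (sub_nonpos.1 ?_)
    rw [hd]
    exact neg_nonpos.2 hn
  obtain ⟨y, hyA, hyp, hy0, hyΦ⟩ := hΦ.semifinite p ⟨hpA, hp⟩ hp0
  set ε : ℝ≥0 := ‖y‖₊ / 2 with hε
  have hy0' : 0 < ‖y‖₊ := nnnorm_pos.2 hy0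
  have hε0 : 0 < ε := half_pos hy0'
  obtain ⟨t, p', n', ht, hp', hn', htp, hpt, htn, hnt, hy, hcomm', hsupp⟩ := exists_spectral_cut
    (IsSelfAdjoint.of_nonneg hyA.2) (ε : ℝ)
  have htA : t ∈ A := hmem hyA.1 hcomm'
  have htpos : t ∈ positivePart A := ⟨htA, ht.nonneg⟩
  have ht0 : t ≠ 0 := by
    intro h0
    rw [h0, zero_mul] at htp
    rw [← htp, add_zero] at hy
    have h1 : y ≤ algebraMap ℝ _ (ε : ℝ) := by
      rw [Algebra.algebraMap_eq_smul_one, hy]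
      exact sub_le_self _ hn'
    have h2 := (CStarAlgebra.norm_le_iff_le_algebraMap y ε.coe_nonneg hyA.2).2 h1
    have h3 : ‖y‖₊ ≤ ‖y‖₊ / 2 := h2
    exact absurd h3 (not_le.2 (half_lt_self hy0'))
  have hny : n * y = 0 := by
    have hpn : p * n = 0 := by rw [← hps, mul_assoc, hsn, mul_zero]
    have h1 := congrArg star (mul_eq_zero_of_le hyA.2 hyp hpn)
    rwa [star_mul, (IsSelfAdjoint.of_nonneg hyA.2).star_eq, (IsSelfAdjoint.of_nonneg hn).star_eq,
      star_zero] at h1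
  have hnt0 : n * t = 0 := hsupp hε0 n hny
  have hyt : y * t = (ε : ℝ) • t + p' := by
    rw [hy, sub_mul, add_mul, hnt, hpt, smul_mul_assoc, one_mul, sub_zero]
  have hεpt : (ε : ℝ) • t ≤ p * t :=
    calc (ε : ℝ) • t ≤ y * t := by rw [hyt]; exact le_add_of_nonneg_right hp'
      _ ≤ p * t := mul_projection_mono hA ht htA hyA.1 hpA hyp
  have hεty : (ε : ℝ) • t ≤ y := by
    have h1 : y * t ≤ y := by
      have h2 := star_right_conjugate_nonneg hyA.2 (1 - t)
      rw [conj_projection_eq hA ht.one_sub (sub_mem (one_mem _) htA) hyA.1, mul_sub, mul_one] at h2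
      exact sub_nonneg.1 h2
    refine le_trans ?_ h1
    rw [hyt]
    exact le_add_of_nonneg_right hp'
  have hΦt : Φ t ≠ ∞ := by
    intro htop
    have h1 : Φ (((ε : ℝ) : ℂ) • t) ≤ Φ y := by
      refine hΦ.mono ⟨smul_mem_vn A _ htA, ?_⟩ hyA.1 ?_ <;> rw [coe_smul_eq]
      · exact smul_nonneg ε.coe_nonneg ht.nonneg
      · exact hεty
    rw [hΦ.smul _ _ htpos, htop, ENNReal.mul_top (by simpa using hε0.ne')] at h1
    exact absurd hyΦ (not_lt.2 h1)
  have hGt : G * t ≤ t := by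
    simpa using mul_projection_mono hA ht htA hG.1 (one_mem A) hG1
  have hGt0 : 0 ≤ G * t := by
    simpa using mul_projection_mono hA ht htA (zero_mem A) hG.1 hG.2
  have hFt : F * t = G * t + p * t := by
    have h1 : (F - G) * t = p * t := by rw [hd, sub_mul, hnt0, sub_zero]
    rw [sub_mul] at h1
    rw [← h1, add_sub_cancel]
  -- Additivity of `subordinateWeight` is not used. From `G ≤ 1` follows `(1 + ε) G t ≤ F t`, which
  -- with finiteness forces the weight of `G t` to vanish; then `ε t ≤ F t` forces that of `t` to
  -- vanish, against the existence of subordinate vectors.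
  have hF1 : ((((1 + ε : ℝ≥0) : ℝ) : ℂ)) • (G * t) ≤ F * t := by
    rw [coe_smul_eq, NNReal.coe_add, NNReal.coe_one, add_smul, one_smul, hFt]
    gcongr
    exact (smul_le_smul_of_nonneg_left hGt ε.coe_nonneg).trans hεpt
  have hF2 : ((ε : ℝ) : ℂ) • t ≤ F * t := by
    rw [coe_smul_eq, hFt]
    exact hεpt.trans (le_add_of_nonneg_left hGt0)
  have hmain := h t htA ht
  have hWt : subordinateWeight A Φ t ≠ ∞ :=
    ((subordinateWeight_le_weight t htpos).trans_lt (lt_top_iff_ne_top.2 hΦt)).ne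
  have hWG : subordinateWeight A Φ (G * t) ≠ ∞ :=
    ((subordinateWeight_mono hGt).trans_lt (lt_top_iff_ne_top.2 hWt)).ne
  have hW1 := (smul_subordinateWeight_le (1 + ε) (G * t)).trans
    ((subordinateWeight_mono hF1).trans hmain)
  have hW2 := (smul_subordinateWeight_le ε t).trans ((subordinateWeight_mono hF2).trans hmain)
  have hWG0 : subordinateWeight A Φ (G * t) = 0 := by
    rw [ENNReal.coe_add, ENNReal.coe_one, add_mul, one_mul] at hW1
    have h1 : (ε : ℝ≥0∞) * subordinateWeight A Φ (G * t) ≤ 0 :=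
      (ENNReal.add_le_add_iff_left hWG).1 (by rwa [add_zero])
    have h2 := nonpos_iff_eq_zero.1 h1
    rcases mul_eq_zero.1 h2 with h3 | h3
    · exact absurd (ENNReal.coe_eq_zero.1 h3) hε0.ne'
    · exact h3
  rw [hWG0] at hW2
  have hW0 : subordinateWeight A Φ t = 0 := by
    rcases mul_eq_zero.1 (nonpos_iff_eq_zero.1 hW2) with h3 | h3
    · exact absurd (ENNReal.coe_eq_zero.1 h3) hε0.ne'
    · exact h3
  obtain ⟨ζ, hζ, hζt⟩ := hΦ.exists_subordinate hA htpos ht0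
  have hsub : IsSubordinate A Φ (fun _ : Fin 1 => ζ) := fun x hx => by simpa using hζ x hx
  have h1 := sum_le_subordinateWeight hsub t
  rw [hW0] at h1
  simp at h1
  exact hζt h1

end Comparison

/-! ### From the inequality of weights to an inequality of vector norms -/

section CenterInequality

variable {K H : Type*} [NormedAddCommGroup K] [InnerProductSpace ℂ K] [CompleteSpace K]
  [NormedAddCommGroup H] [InnerProductSpace ℂ H] [CompleteSpace H]
  {A : VonNeumannAlgebra K} {M B : VonNeumannAlgebra H} {ξ : H} {Φ : (K →L[ℂ] K) → ℝ≥0∞}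

theorem sliceRight_mul_opTensor (η' η : H) (T : HilbertTensor K H →L[ℂ] HilbertTensor K H)
    (a : K →L[ℂ] K) : sliceRight η' η (T * opTensor a 1) = sliceRight η' η T * a := by
  refine ContinuousLinearMap.ext fun ζ => ext_inner_left ℂ fun ζ' => ?_
  rw [inner_sliceRight, mul_apply_eq_comp, mul_apply_eq_comp, inner_sliceRight, opTensor_vecTensor,
    one_apply_eq_self]

theorem opTensor_one_isStarProjection {p : K →L[ℂ] K} (hp : IsStarProjection p) :
    IsStarProjection (opTensor p (1 : H →L[ℂ] H)) :=
  ⟨by rw [IsIdempotentElem, opTensor_mul, hp.isIdempotentElem.eq, one_mul],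
    by rw [IsSelfAdjoint, star_opTensor, hp.isSelfAdjoint.star_eq, star_one]⟩

/-- The inequality of weights on the center of the corner, read on the vectors `ζ ⊗ ξ`. -/
theorem norm_sq_le_of_weightTensor_le (hA : ∀ x ∈ A, ∀ y ∈ A, x * y = y * x)
    (hΦ : IsFNSWeight A Φ) (hM : IsStandardTracial M ξ) (hBM : B ≤ M)
    {q V : HilbertTensor K H →L[ℂ] HilbertTensor K H}
    (hV : V ∈ vnTensor A (basicConstruction M B ξ))
    (hEV : opTensor 1 (jonesProjection B ξ) * V = V)
    (hVr : ∀ r ∈ centerOf (corner q (vnTensor A B)), IsStarProjection r →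
      weightTensor A Φ (basicConstruction M B ξ) (canonicalTrace M B ξ)
        (star (V * r) * (V * r)) ≤ weightTensor A Φ M (vectorWeight ξ) r)
    {r : HilbertTensor K H →L[ℂ] HilbertTensor K H}
    (hqB : q ∈ vnTensor A B)
    (hr : r ∈ centerOf (corner q (vnTensor A B))) (hrp : IsStarProjection r) (ζ : K) :
    ‖r (star V (vecTensor ζ ξ))‖ ^ 2 ≤ ‖r (vecTensor ζ ξ)‖ ^ 2 := by
  have hBN : vnTensor A B ≤ vnTensor A (basicConstruction M B ξ) :=
    vnTensor_mono fun b hb => mem_basicConstruction (hBM hb)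
  have hmemB : ∀ r ∈ centerOf (corner q (vnTensor A B)), r ∈ vnTensor A B := by
    rintro _ ⟨⟨x, hx, rfl⟩, -⟩
    exact mul_mem (mul_mem hqB hx) hqB
  -- Cutting by `p ⊗ 1` stays inside the center of the corner, so the inequality of weights
  -- localises over `A` and becomes an operator inequality.
  have hcut : ∀ p ∈ A, IsStarProjection p → r * opTensor p 1 ∈ centerOf (corner q (vnTensor A B)) ∧
      IsStarProjection (r * opTensor p 1) := by
    intro p hp hpp
    have hcom : ∀ x ∈ vnTensor A B, opTensor p 1 * x = x * opTensor p 1 := fun x hx =>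
      vnTensor_commute_left hx (mem_commutant_of_abelian hA hp)
    have hpp' := opTensor_one_isStarProjection (H := H) hpp
    refine ⟨⟨?_, ?_⟩, ?_⟩
    · obtain ⟨⟨x, hx, hrx⟩, -⟩ := hr
      refine ⟨x * opTensor p 1, mul_mem hx (opTensor_mem hp (one_mem _)), ?_⟩
      rw [hrx, mul_assoc (q * x), ← hcom q hqB]
      simp only [mul_assoc]
    · intro y hy
      have hyB : y ∈ vnTensor A B := by
        obtain ⟨x, hx, rfl⟩ := hy
        exact mul_mem (mul_mem hqB hx) hqB
      rw [← mul_assoc, hr.2 y hy, mul_assoc, mul_assoc, hcom y hyB]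
    · refine ⟨?_, ?_⟩
      · rw [IsIdempotentElem, mul_assoc, ← mul_assoc _ r, hcom r (hmemB r hr), mul_assoc r,
          hpp'.isIdempotentElem.eq, ← mul_assoc, hrp.isIdempotentElem.eq]
      · have h1 : star (r * opTensor p 1) = star (opTensor p 1) * star r := star_mul_eq _ _
        rw [IsSelfAdjoint, h1, hpp'.isSelfAdjoint.star_eq, hrp.isSelfAdjoint.star_eq,
          hcom r (hmemB r hr)]
  -- For `W = V r` the lower bound of `Φ ⊗ Tr` at `W* W` is the weight of the slice of `W W* = V r
  -- V*`.
  have hweight : ∀ r ∈ centerOf (corner q (vnTensor A B)), IsStarProjection r →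
      subordinateWeight A Φ (sliceRight ξ ξ (V * r * star V)) ≤
        subordinateWeight A Φ (sliceRight ξ ξ r) := by
    intro r hr hrp
    refine le_trans (subordinateWeight_le fun m ζ hζ => ?_) ((hVr r hr hrp).trans
      (weightTensor_le_subordinateWeight (vnTensor_mono hBM (hmemB r hr)) hrp.nonneg))
    refine le_trans (le_of_eq ?_) (sum_norm_sq_le_weightTensor hA hM hBM
      (mul_mem hV (hBN (hmemB r hr))) (by rw [← mul_assoc, hEV]) hζ)
    refine Finset.sum_congr rfl fun i _ => ?_
    have h1 : star (V * r) = star r * star V := star_mul_eq _ _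
    rw [vectorWeight_sliceRight, ← vectorWeight_star_mul_self, star_star, h1,
      hrp.isSelfAdjoint.star_eq, ← mul_assoc (V * r), mul_assoc V r r, hrp.isIdempotentElem.eq]
  have hle : sliceRight ξ ξ (V * r * star V) ≤ sliceRight ξ ξ r := by
    refine hΦ.le_of_subordinateWeight_le hA ⟨?_, ?_⟩ ⟨?_, ?_⟩ ?_ ?_
    · exact sliceRight_mem (fun a ha => vnTensor_commute_left (mul_mem (mul_mem hV
        (hBN (hmemB r hr))) (star_mem hV)) ha) _ _
    · exact sliceRight_nonneg (star_right_conjugate_nonneg hrp.nonneg V) _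
    · exact sliceRight_mem (fun a ha => vnTensor_commute_left (hmemB r hr) ha) _ _
    · exact sliceRight_nonneg hrp.nonneg _
    · refine le_of_forall_re_inner_le ?_ (IsSelfAdjoint.one _) fun κ => ?_
      · rw [IsSelfAdjoint, star_sliceRight, hrp.isSelfAdjoint.star_eq]
      · have h1 := re_inner_le_of_le hrp.le_one (vecTensor κ ξ)
        rw [one_apply_eq_self, inner_self_eq_norm_sq, norm_vecTensor, hM.norm_eq_one, mul_one] at h1
        rwa [inner_sliceRight, one_apply_eq_self, inner_self_eq_norm_sq]
    · intro p hp hpp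
      have h1 := hweight _ (hcut p hp hpp).1 (hcut p hp hpp).2
      have h2 : V * (r * opTensor p 1) * star V = V * r * star V * opTensor p 1 := by
        rw [mul_assoc, mul_assoc r, vnTensor_commute_left (star_mem hV)
          (mem_commutant_of_abelian hA hp)]
        simp only [mul_assoc]
      rwa [h2, sliceRight_mul_opTensor, sliceRight_mul_opTensor] at h1
  have h1 := re_inner_le_of_le hle ζ
  rw [inner_sliceRight, inner_sliceRight] at h1
  rw [norm_sq_eq_re_inner r (vecTensor ζ ξ), norm_sq_eq_re_inner r, hrp.isSelfAdjoint.star_eq,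
    hrp.isIdempotentElem.eq, inner_star_left, ← mul_apply_eq_comp, ← mul_apply_eq_comp]
  exact h1

end CenterInequality

/-! ### Invariance of the vector functional of `V* (ζ ⊗ ξ)` and its domination on `A ⊗ M` -/

section Implementer

variable {K H : Type*} [NormedAddCommGroup K] [InnerProductSpace ℂ K] [CompleteSpace K]
  [NormedAddCommGroup H] [InnerProductSpace ℂ H] [CompleteSpace H]
  {A : VonNeumannAlgebra K} {M B : VonNeumannAlgebra H} {ξ : H}
  {q V : HilbertTensor K H →L[ℂ] HilbertTensor K H}

/-- A partial isometry of `A ⊗ ⟨M, e⟩` from a projection below `q`, commuting with the elements of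
`A ⊗ B` that commute with `q`, into `1 ⊗ e`. -/
structure IsImplementer (A : VonNeumannAlgebra K) (M B : VonNeumannAlgebra H) (ξ : H)
    (q V : HilbertTensor K H →L[ℂ] HilbertTensor K H) : Prop where
  mem : V ∈ vnTensor A (basicConstruction M B ξ)
  jones_mul : opTensor 1 (jonesProjection B ξ) * V = V
  mul_corner : V * q = V
  mul_star_mul : V * star V * V = V
  commute : ∀ y ∈ vnTensor A B, y * q = q * y → y * (star V * V) = star V * V * y

theorem vnTensor_jones_commute {b : HilbertTensor K H →L[ℂ] HilbertTensor K H}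
    (hb : b ∈ vnTensor A B) :
    b * opTensor 1 (jonesProjection B ξ) = opTensor 1 (jonesProjection B ξ) * b :=
  VonNeumannAlgebra.mem_commutant_iff.1 opTensor_jones_mem_commutant _ hb

theorem mul_jones_apply {b X : HilbertTensor K H →L[ℂ] HilbertTensor K H}
    (h : b * opTensor 1 (jonesProjection B ξ) = X) (ζ : K) :
    X (vecTensor ζ ξ) = b (vecTensor ζ ξ) := by
  rw [← h, mul_apply_eq_comp, opTensor_jones_apply]

theorem eq_of_mul_jones_eq (hM : IsStandardTracial M ξ) (hBM : B ≤ M)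
    {b b' : HilbertTensor K H →L[ℂ] HilbertTensor K H} (hb : b ∈ vnTensor A B)
    (hb' : b' ∈ vnTensor A B)
    (h : b * opTensor 1 (jonesProjection B ξ) = b' * opTensor 1 (jonesProjection B ξ)) :
    b = b' := by
  refine sub_eq_zero.1 (vnTensor_eq_zero hM (vnTensor_mono hBM (sub_mem hb hb')) fun ζ => ?_)
  rw [sub_apply, ← mul_jones_apply h ζ, mul_apply_eq_comp, opTensor_jones_apply, sub_self]

theorem jones_star_eq : star (opTensor (1 : K →L[ℂ] K) (jonesProjection B ξ)) =
    opTensor 1 (jonesProjection B ξ) := opTensor_jones_isStarProjection.isSelfAdjoint.star_eq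

theorem vnTensor_le_basicConstruction : vnTensor A M ≤ vnTensor A (basicConstruction M B ξ) :=
  vnTensor_mono fun _ hb => mem_basicConstruction hb

theorem IsImplementer.star_mul_jones (h : IsImplementer A M B ξ q V) :
    star V * opTensor 1 (jonesProjection B ξ) = star V := by
  have h1 := congrArg star h.jones_mul
  have h2 := star_mul_eq (opTensor 1 (jonesProjection B ξ)) V
  rw [h2, jones_star_eq] at h1
  exact h1

theorem IsImplementer.exists_compression (hA : ∀ x ∈ A, ∀ y ∈ A, x * y = y * x)
    (hM : IsStandardTracial M ξ) (hBM : B ≤ M) (h : IsImplementer A M B ξ q V)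
    {x : HilbertTensor K H →L[ℂ] HilbertTensor K H}
    (hx : x ∈ vnTensor A (basicConstruction M B ξ)) :
    ∃ b ∈ vnTensor A B, b * opTensor 1 (jonesProjection B ξ) = V * x * star V := by
  obtain ⟨b, hb, hbE⟩ := exists_vnTensor_compression_eq (X := V * x * star V) hA hM hBM
    (mul_mem (mul_mem h.mem hx) (star_mem h.mem))
  refine ⟨b, hb, ?_⟩
  rw [hbE, mul_assoc, mul_assoc (V * x), h.star_mul_jones, ← mul_assoc, ← mul_assoc, h.jones_mul]

theorem IsImplementer.star_mul_star_mul (h : IsImplementer A M B ξ q V) :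
    star V * V * star V = star V := by
  have h1 := congrArg star h.mul_star_mul
  have h2 := star_mul_eq (V * star V) V
  have h3 := star_mul_eq V (star V)
  rw [h2, h3, star_star, ← mul_assoc] at h1
  exact h1

/-- `V* V` commutes with `y` and `V* V V* = V*`. The intertwining relation of the final partial
isometry descends from this one. -/
theorem IsImplementer.intertwine (h : IsImplementer A M B ξ q V)
    {y : HilbertTensor K H →L[ℂ] HilbertTensor K H} (hy : y ∈ vnTensor A B)
    (hyq : y * q = q * y) : star V * (V * y * star V) = y * star V := by
  rw [← mul_assoc, ← mul_assoc, ← h.commute y hy hyq, mul_assoc, h.star_mul_star_mul]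

theorem IsImplementer.corner_mul_star (hq : IsStarProjection q) (h : IsImplementer A M B ξ q V) :
    q * star V = star V := by
  have h1 := congrArg star h.mul_corner
  rw [star_mul_eq V q, hq.isSelfAdjoint.star_eq] at h1
  exact h1

/-- The vector functional of `V* (ζ ⊗ ξ)` is invariant under the unitaries of `A ⊗ B` that commute
with `q`. -/
theorem IsImplementer.inner_conj (hA : ∀ x ∈ A, ∀ y ∈ A, x * y = y * x)
    (hM : IsStandardTracial M ξ) (hBM : B ≤ M) (h : IsImplementer A M B ξ q V)
    {u x : HilbertTensor K H →L[ℂ] HilbertTensor K H} (hu : u ∈ vnTensor A B)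
    (huq : star u * q = q * star u) (hu1 : star u * u = 1)
    (hx : x ∈ vnTensor A (basicConstruction M B ξ)) (ζ : K) :
    ⟪star V (vecTensor ζ ξ), (u * x * star u) (star V (vecTensor ζ ξ))⟫_ℂ =
      ⟪star V (vecTensor ζ ξ), x (star V (vecTensor ζ ξ))⟫_ℂ := by
  have hBN : vnTensor A B ≤ vnTensor A (basicConstruction M B ξ) :=
    (vnTensor_mono hBM).trans vnTensor_le_basicConstruction
  have hBM' : vnTensor A B ≤ vnTensor A M := vnTensor_mono hBM
  set E : HilbertTensor K H →L[ℂ] HilbertTensor K H := opTensor 1 (jonesProjection B ξ) with hE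
  -- Let `Ω = ζ ⊗ ξ`, `b E = V u* V*` and `c E = V x V*`. Then `u* V* Ω = V* b Ω`, so the left side
  -- is `⟪Ω, b* c b Ω⟫ = ⟪Ω, c b b* Ω⟫` by traciality, and `b b* E = V V*` is absorbed by `V x V*`.
  obtain ⟨b, hb, hbE⟩ := h.exists_compression hA hM hBM (hBN (star_mem hu))
  obtain ⟨c, hc, hcE⟩ := h.exists_compression hA hM hBM hx
  have h1 : star u (star V (vecTensor ζ ξ)) = star V (b (vecTensor ζ ξ)) := by
    rw [← mul_jones_apply hbE, ← mul_apply_eq_comp, ← mul_apply_eq_comp,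
      h.intertwine (star_mem hu) huq]
  have hbb : b * star b * E = V * star V := by
    have h2 : star b * E = V * u * star V := by
      have h3 := congrArg star hbE
      rw [star_mul_eq b E, star_mul_eq (V * star u) (star V), star_mul_eq V (star u), star_star,
        star_star, hE, jones_star_eq, ← vnTensor_jones_commute (star_mem hb), ← mul_assoc] at h3
      exact h3
    calc b * star b * E = b * (E * (star b * E)) := by
          rw [mul_assoc, vnTensor_jones_commute (star_mem hb), ← mul_assoc E E,
            opTensor_jones_isStarProjection.isIdempotentElem.eq]
      _ = V * (star u * (star V * V)) * u * star V := by
          rw [← mul_assoc, hbE, h2]; simp only [mul_assoc]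
      _ = V * star V * V * (star u * u) * star V := by
          rw [h.commute _ (star_mem hu) huq]; simp only [mul_assoc]
      _ = V * star V := by rw [hu1, mul_one, h.mul_star_mul]
  have hcbb : c * (b * star b) * E = V * x * star V := by
    rw [mul_assoc, hbb, ← h.jones_mul, ← mul_assoc, ← mul_assoc, hcE, h.jones_mul, mul_assoc,
      mul_assoc, ← mul_assoc (star V), h.star_mul_star_mul]
  have h2 : ⟪star V (vecTensor ζ ξ), (u * x * star u) (star V (vecTensor ζ ξ))⟫_ℂ =
      ⟪vecTensor ζ ξ, (star b * (c * b)) (vecTensor ζ ξ)⟫_ℂ := by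
    rw [mul_apply_eq_comp, mul_apply_eq_comp, h1, ← inner_star_left u, h1, inner_star_left,
      mul_apply_eq_comp, inner_star_right, mul_apply_eq_comp]
    congr 1
    have h3 : b (vecTensor ζ ξ) = E (b (vecTensor ζ ξ)) := by
      rw [← mul_apply_eq_comp, hE, ← vnTensor_jones_commute hb, mul_apply_eq_comp,
        opTensor_jones_apply]
    conv_rhs => rw [h3, ← mul_apply_eq_comp, hcE]
    rfl
  rw [h2, vnTensor_tracial hA hM (star_mem (hBM' hb)) (mul_mem (hBM' hc) (hBM' hb)), mul_assoc,
    ← mul_jones_apply hcbb, inner_star_left]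
  rfl

theorem commutant_cyclic (hM : IsStandardTracial M ξ) :
    Dense {η : H | ∃ x ∈ M.commutant, η = x ξ} := by
  refine hM.cyclic.mono ?_
  rintro _ ⟨m, hm, rfl⟩
  obtain ⟨R, hR⟩ := hM.exists_isRightMul hm
  exact ⟨R, hR.mem, hR.apply.symm⟩

/-- The density lemma is applied with `A'` and `M'` in place of `A` and `M`: `V*` commutes with `A ⊗
1` since `A` is abelian, and `A' ⊗ M'` lies in `(A ⊗ M)'`. The averaging argument requires the
vector in this closure. -/
theorem IsImplementer.star_apply_mem_closure (hA : ∀ x ∈ A, ∀ y ∈ A, x * y = y * x)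
    (hM : IsStandardTracial M ξ) (h : IsImplementer A M B ξ q V) (ζ : K) :
    star V (vecTensor ζ ξ) ∈
      closure {v | ∃ X ∈ (vnTensor A M).commutant, v = X (vecTensor ζ ξ)} := by
  have h1 := mem_closure_of_commute (A := A.commutant) (commutant_cyclic hM) (Y := star V)
    (fun a ha => vnTensor_commute_left (star_mem h.mem) (mem_commutant_of_abelian hA (by
      rwa [VonNeumannAlgebra.commutant_commutant] at ha))) ζ
  refine closure_mono ?_ h1
  rintro _ ⟨y, hy, rfl⟩
  refine ⟨y, ?_, rfl⟩
  refine vnGenerated_le (N := (vnTensor A M).commutant) ?_ hy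
  rintro _ ⟨a, ha, b, hb, rfl⟩
  exact VonNeumannAlgebra.mem_commutant_iff.2 fun g hg => (vnTensor_commute_opTensor hg ha hb).symm

/-- The elements of `S` that commute with the projection `q`. -/
noncomputable def cornerCommutant (q : HilbertTensor K H →L[ℂ] HilbertTensor K H)
    (S : VonNeumannAlgebra (HilbertTensor K H)) : VonNeumannAlgebra (HilbertTensor K H) :=
  relCommutant (vnGenerated {q}) S

theorem mem_cornerCommutant (hq : IsStarProjection q) {S : VonNeumannAlgebra (HilbertTensor K H)}
    {y : HilbertTensor K H →L[ℂ] HilbertTensor K H} :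
    y ∈ cornerCommutant q S ↔ y ∈ S ∧ y * q = q * y := by
  constructor
  · rintro ⟨h1, h2⟩
    exact ⟨h2, (VonNeumannAlgebra.mem_commutant_iff.1 h1 q (subset_vnGenerated rfl)).symm⟩
  · rintro ⟨h1, h2⟩
    refine ⟨VonNeumannAlgebra.mem_commutant_iff.2 fun g hg => ?_, h1⟩
    refine (commute_of_mem_vnGenerated hg ?_).symm
    rintro _ rfl
    rw [hq.isSelfAdjoint.star_eq]
    exact ⟨h2.symm, h2.symm⟩

/-- An inequality between the functionals of `V* (ζ ⊗ ξ)` and `ζ ⊗ ξ` extends from the projections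
in the center of the corner to `A ⊗ M`. -/
theorem IsImplementer.norm_apply_le (hA : ∀ x ∈ A, ∀ y ∈ A, x * y = y * x)
    (hM : IsStandardTracial M ξ) (hBM : B ≤ M) (hB : relCommutant B M ≤ B)
    (hq : IsStarProjection q) (hqB : q ∈ vnTensor A B) (h : IsImplementer A M B ξ q V) {ζ : K}
    (hcenter : ∀ r ∈ centerOf (corner q (vnTensor A B)), IsStarProjection r →
      ‖r (star V (vecTensor ζ ξ))‖ ^ 2 ≤ ‖r (vecTensor ζ ξ)‖ ^ 2)
    {y : HilbertTensor K H →L[ℂ] HilbertTensor K H} (hy : y ∈ vnTensor A M) :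
    ‖y (star V (vecTensor ζ ξ))‖ ≤ ‖y (vecTensor ζ ξ)‖ := by
  have hBM' : vnTensor A B ≤ vnTensor A M := vnTensor_mono hBM
  set g := star V (vecTensor ζ ξ) with hg
  set x := star (y * q) * (y * q) with hx
  have hyq : y * q ∈ vnTensor A M := mul_mem hy (hBM' hqB)
  have hxM : x ∈ vnTensor A M := mul_mem (star_mem hyq) hyq
  -- `c` is the average of `x` over the unitaries of `A ⊗ B` that commute with `q`; the functionals
  -- of `ζ ⊗ ξ` and of `g` take the same values at `c` and at `x`.
  obtain ⟨c, hcM, hc0, hcG, hcΩ, hcg, hcd⟩ := exists_average (𝔐 := vnTensor A M)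
    (Ω := vecTensor ζ ξ) (fun x hx y hy => vnTensor_tracial hA hM hx hy ζ)
    (𝒢 := {u | u ∈ cornerCommutant q (vnTensor A B) ∧ star u * u = 1 ∧ u * star u = 1})
    (fun u hu => hBM' ((mem_cornerCommutant hq).1 hu.1).1) (fun u hu => hu.2)
    ⟨one_mem _, by simp, by simp⟩
    (fun u hu v hv => ⟨mul_mem hu.1 hv.1, by
      rw [star_mul_eq, mul_assoc, ← mul_assoc (star u), hu.2.1, one_mul, hv.2.1], by
      rw [star_mul_eq, mul_assoc, ← mul_assoc v, hv.2.2, one_mul, hu.2.2]⟩)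
    hxM (star_mul_self_nonneg (y * q)) (g := g) (h.star_apply_mem_closure hA hM ζ)
    (fun u hu => h.inner_conj hA hM hBM ((mem_cornerCommutant hq).1 hu.1).1
      ((mem_cornerCommutant hq).1 (star_mem hu.1)).2 hu.2.1 (vnTensor_le_basicConstruction hxM) ζ)
  have hqc : q * c = c := by
    have h1 := hcd (1 - q) (fun u hu => by
      rw [sub_mul, mul_sub, one_mul, mul_one, ((mem_cornerCommutant hq).1 hu.1).2]) (by
      rw [hx, star_mul_eq, hq.isSelfAdjoint.star_eq, mul_assoc q, ← mul_assoc, sub_mul, one_mul,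
        hq.isIdempotentElem.eq, sub_self, zero_mul])
    rw [sub_mul, one_mul, sub_eq_zero] at h1
    exact h1.symm
  have hcq : c * q = c := by
    have h1 := congrArg star hqc
    rw [star_mul_eq, hq.isSelfAdjoint.star_eq, (IsSelfAdjoint.of_nonneg hc0).star_eq] at h1
    exact h1
  have hcorner : ∀ b ∈ vnTensor A B, q * b * q * c = c * (q * b * q) := by
    intro b hb
    have hmem : q * b * q ∈ cornerCommutant q (vnTensor A B) := by
      refine (mem_cornerCommutant hq).2 ⟨mul_mem (mul_mem hqB hb) hqB, ?_⟩
      rw [mul_assoc, hq.isIdempotentElem.eq, ← mul_assoc, ← mul_assoc, hq.isIdempotentElem.eq]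
    obtain ⟨u, a, hu, hu'⟩ := exists_sum_four_unitary_mem
      (cornerCommutant q (vnTensor A B)).toStarSubalgebra (vn_isClosed _) hmem
    rw [hu, Finset.sum_mul, Finset.mul_sum]
    refine Finset.sum_congr rfl fun i _ => ?_
    rw [smul_mul_assoc, hcG (u i) (hu' i), mul_smul_comm]
  -- The relative commutant hypothesis puts `c` in the center of the corner, so its spectral
  -- projections are among those for which the inequality is given.
  have hcB : c ∈ vnTensor A B := mem_vnTensor_of_commute_corner hA hBM hB hq hqB hcM
    (by rw [hqc, hcq]) hcorner
  have hle : RCLike.re ⟪g, c g⟫_ℂ ≤ RCLike.re ⟪vecTensor ζ ξ, c (vecTensor ζ ξ)⟫_ℂ := by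
    refine re_inner_le_of_projections hc0 fun s hs hcs => ?_
    have h1 := hcenter s (hcs.mem_centerOf_corner hq hs.isSelfAdjoint hcB hqc (by
      rintro _ ⟨b, hb, rfl⟩
      exact hcorner b hb)) hs
    rw [norm_sq_eq_re_inner s, norm_sq_eq_re_inner s, hs.isSelfAdjoint.star_eq,
      hs.isIdempotentElem.eq] at h1
    exact h1
  rw [hcΩ, hcg, hx, ← norm_sq_eq_re_inner, ← norm_sq_eq_re_inner,
    sq_le_sq₀ (norm_nonneg _) (norm_nonneg _)] at hle
  have hqg : q g = g := by
    rw [hg, ← mul_apply_eq_comp, h.corner_mul_star hq]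
  rw [mul_apply_eq_comp, hqg] at hle
  refine hle.trans ?_
  -- With `Ω = ζ ⊗ ξ`, traciality removes `q`: `‖y q Ω‖ = ‖q y* Ω‖ ≤ ‖y* Ω‖ = ‖y Ω‖`.
  have hstar := star_mul_eq y q
  rw [← vnTensor_norm_star_apply hA hM hyq, hstar, hq.isSelfAdjoint.star_eq, mul_apply_eq_comp,
    ← vnTensor_norm_star_apply hA hM hy]
  refine (q.le_opNorm _).trans ?_
  exact mul_le_of_le_one_left (norm_nonneg _) hq.norm_le

end Implementer

/-! ### Absorption of the initial and final projections -/

section PartialIsometry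

variable {𝓗 : Type*} [NormedAddCommGroup 𝓗] [InnerProductSpace ℂ 𝓗] [CompleteSpace 𝓗]
  {V P E : 𝓗 →L[ℂ] 𝓗}

theorem mul_eq_self_of_star_mul_eq (hP : IsStarProjection P) (hVP : star V * V = P) :
    V * P = V := by
  have h1 : star (V - V * P) * (V - V * P) = 0 := by
    rw [star_sub, star_mul, hP.isSelfAdjoint.star_eq, sub_mul, mul_sub, mul_sub, hVP,
      ← mul_assoc, hVP, mul_assoc P, hVP, mul_assoc P (star V), ← mul_assoc (star V), hVP,
      hP.isIdempotentElem.eq, hP.isIdempotentElem.eq, sub_self]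
  exact (sub_eq_zero.1 ((CStarRing.star_mul_self_eq_zero_iff _).1 h1)).symm

theorem mul_eq_self_of_mul_star_le (hE : IsStarProjection E) (hVE : V * star V ≤ E) :
    E * V = V := by
  have h1 : (1 - E) * (V * star V) * star (1 - E) = 0 := by
    refine le_antisymm ?_ (star_right_conjugate_nonneg (mul_star_self_nonneg V) _)
    have h2 := star_right_conjugate_nonneg (sub_nonneg.2 hVE) (1 - E)
    rw [mul_sub, sub_mul, sub_mul 1 E E, one_mul, hE.isIdempotentElem.eq, sub_self, zero_mul,
      zero_sub] at h2
    exact neg_nonneg.1 h2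
  have h2 : (1 - E) * V * star ((1 - E) * V) = 0 := by
    rw [star_mul, ← mul_assoc, mul_assoc (1 - E) V]
    exact h1
  have h3 := (CStarRing.mul_star_self_eq_zero_iff _).1 h2
  rw [sub_mul, one_mul] at h3
  exact (sub_eq_zero.1 h3).symm

end PartialIsometry

/-! ### Construction of the intertwiner -/

section Intertwiner

variable {K H : Type*} [NormedAddCommGroup K] [InnerProductSpace ℂ K] [CompleteSpace K]
  [NormedAddCommGroup H] [InnerProductSpace ℂ H] [CompleteSpace H]
  {A : VonNeumannAlgebra K} {M B : VonNeumannAlgebra H} {ξ : H}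
  {q V : HilbertTensor K H →L[ℂ] HilbertTensor K H}

theorem mul_jones_ext {S T : HilbertTensor K H →L[ℂ] HilbertTensor K H}
    (h : ∀ ζ, ∀ b ∈ B, S (vecTensor ζ (b ξ)) = T (vecTensor ζ (b ξ))) :
    S * opTensor 1 (jonesProjection B ξ) = T * opTensor 1 (jonesProjection B ξ) := by
  refine ext_vecTensor fun ζ η => ?_
  rw [mul_apply_eq_comp, mul_apply_eq_comp, opTensor_vecTensor]
  have hη : jonesProjection B ξ η ∈ closure {η : H | ∃ b ∈ B, η = b ξ} := by
    rw [← coe_ltwo]; exact jonesProjection_apply_mem _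
  refine closure_minimal (t := {η | S (vecTensor ζ η) = T (vecTensor ζ η)}) ?_ ?_ hη
  · rintro _ ⟨x, hx, rfl⟩
    exact h ζ x hx
  · exact isClosed_eq (S.continuous.comp (leftTensor ζ).continuous)
      (T.continuous.comp (leftTensor ζ).continuous)

/-- `D` and `V*` both commute with right multiplications by `B`, so their agreement at the vectors
`ζ ⊗ ξ` spreads to the range of `1 ⊗ e_B`. -/
theorem IsImplementer.star_eq_mul_jones (hM : IsStandardTracial M ξ) (hBM : B ≤ M)
    (h : IsImplementer A M B ξ q V) {D : HilbertTensor K H →L[ℂ] HilbertTensor K H}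
    (hD : D ∈ vnTensor A M) (hDV : ∀ ζ, D (vecTensor ζ ξ) = star V (vecTensor ζ ξ)) :
    star V = D * opTensor 1 (jonesProjection B ξ) := by
  rw [← h.star_mul_jones]
  refine mul_jones_ext fun ζ b hb => ?_
  obtain ⟨R, hR⟩ := hM.exists_isRightMul (hBM hb)
  have h1 : vecTensor ζ (b ξ) = opTensor 1 R (vecTensor ζ ξ) := by
    rw [opTensor_vecTensor, hR.apply, one_apply_eq_self]
  rw [h1, ← mul_apply_eq_comp, ← mul_apply_eq_comp, ← vnTensor_commute_right hD hR.mem,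
    ← vnTensor_commute_right (star_mem h.mem) (hR.mem_commutant_basicConstruction hBM hb),
    mul_apply_eq_comp, mul_apply_eq_comp, hDV]

/-- An implementer whose functional is dominated by the trace functional comes from an intertwiner
in `A ⊗ M`. -/
theorem IsImplementer.exists_intertwiner (hA : ∀ x ∈ A, ∀ y ∈ A, x * y = y * x)
    (hM : IsStandardTracial M ξ) (hBM : B ≤ M) (hB : relCommutant B M ≤ B)
    (hq : IsStarProjection q) (hqB : q ∈ vnTensor A B) (h : IsImplementer A M B ξ q V)
    (hdom : ∀ ζ, ∀ y ∈ vnTensor A M, ‖y (star V (vecTensor ζ ξ))‖ ≤ ‖y (vecTensor ζ ξ)‖) :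
    ∃ w ∈ intertwiners (vnTensor A M) (vnTensor A B),
      V = opTensor 1 (jonesProjection B ξ) * w := by
  have hBM' : vnTensor A B ≤ vnTensor A M := vnTensor_mono hBM
  obtain ⟨D, hDM, hD1, hDV⟩ := exists_pullDown hA hM (Y := star V)
    (fun a ha => vnTensor_commute_left (star_mem h.mem) ha) hdom
  set E : HilbertTensor K H →L[ℂ] HilbertTensor K H := opTensor 1 (jonesProjection B ξ) with hE
  have hDE : star V = D * E := h.star_eq_mul_jones hM hBM hDM hDV
  have hVw : V = E * star D := by
    have h1 := congrArg star hDE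
    rw [star_mul_eq, hE, jones_star_eq] at h1
    exact (star_star V).symm.trans h1
  have hDb : ∀ b ∈ vnTensor A B, ∀ ζ, D (b (vecTensor ζ ξ)) = star V (b (vecTensor ζ ξ)) := by
    intro b hb ζ
    rw [hDE, mul_apply_eq_comp]
    congr 1
    rw [← mul_apply_eq_comp, hE, ← vnTensor_jones_commute hb, mul_apply_eq_comp,
      opTensor_jones_apply]
  -- `g` is the projection of `A ⊗ B` with `g E = V V*`; it turns out to be `D* D`.
  obtain ⟨g, hgB, hgE⟩ := h.exists_compression hA hM hBM (one_mem _)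
  rw [mul_one] at hgE
  have hgsa : star g = g := by
    refine eq_of_mul_jones_eq hM hBM (star_mem hgB) hgB ?_
    have h1 := congrArg star hgE
    rw [star_mul_eq, star_mul_eq, star_star, jones_star_eq,
      ← vnTensor_jones_commute (star_mem hgB)] at h1
    exact h1.trans hgE.symm
  have hgg : g * g = g := by
    refine eq_of_mul_jones_eq hM hBM (mul_mem hgB hgB) hgB ?_
    rw [mul_assoc, hgE, ← h.jones_mul, ← mul_assoc, ← mul_assoc, hgE, h.jones_mul, h.mul_star_mul]
  have hDg : D * g = D := by
    refine sub_eq_zero.1 (vnTensor_eq_zero hM (sub_mem (mul_mem hDM (hBM' hgB)) hDM) fun ζ => ?_)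
    rw [sub_apply, mul_apply_eq_comp, hDb g hgB, hDV, ← mul_jones_apply hgE, ← mul_apply_eq_comp,
      ← mul_assoc, h.star_mul_star_mul, sub_self]
  -- A contraction with `D g = D` satisfies `D* D ≤ g`. Both sides have the same value in the
  -- functional of every `ζ ⊗ ξ`, and these functionals are jointly faithful on `A ⊗ M`.
  have hDD : star D * D = g := by
    have hnorm : ∀ κ, ‖D κ‖ ≤ ‖g κ‖ := by
      intro κ
      conv_lhs => rw [← hDg, mul_apply_eq_comp]
      exact (D.le_of_opNorm_le hD1 _).trans_eq (one_mul _)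
    have hpos : 0 ≤ g - star D * D := by
      refine sub_nonneg.2 (le_of_forall_re_inner_le (IsSelfAdjoint.star_mul_self D) hgsa fun κ => ?_)
      have h1 : RCLike.re ⟪κ, g κ⟫_ℂ = ‖g κ‖ ^ 2 := by rw [norm_sq_eq_re_inner, hgsa, hgg]
      rw [← norm_sq_eq_re_inner, h1]
      exact pow_le_pow_left₀ (norm_nonneg _) (hnorm κ) 2
    obtain ⟨k, hkM, hk0, hkk⟩ := exists_sqrt_mem (vnTensor A M)
      (sub_mem (hBM' hgB) (mul_mem (star_mem hDM) hDM)) hpos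
    have hksa := (IsSelfAdjoint.of_nonneg hk0).star_eq
    have hk : k = 0 := by
      refine vnTensor_eq_zero hM hkM fun ζ => ?_
      have h1 : ‖k (vecTensor ζ ξ)‖ ^ 2 = 0 := by
        rw [norm_sq_eq_re_inner, hksa, hkk, sub_apply, inner_sub_right, map_sub,
          ← norm_sq_eq_re_inner, hDV, norm_sq_eq_re_inner, star_star, ← mul_jones_apply hgE,
          sub_self]
      exact norm_eq_zero.1 (pow_eq_zero_iff two_ne_zero |>.1 h1)
    rw [hk, mul_zero] at hkk
    exact (sub_eq_zero.1 hkk.symm).symm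
  have hqD : q * D = D := by
    refine sub_eq_zero.1 (vnTensor_eq_zero hM (sub_mem (mul_mem (hBM' hqB) hDM) hDM) fun ζ => ?_)
    rw [sub_apply, mul_apply_eq_comp, hDV, ← mul_apply_eq_comp, h.corner_mul_star hq, sub_self]
  have hDq : star D * q = star D := by
    have h1 := congrArg star hqD
    rw [star_mul_eq, hq.isSelfAdjoint.star_eq] at h1
    exact h1
  -- The relation `y V* = V* θ` passes to `D` because elements of `A ⊗ M` are determined by their
  -- values at the vectors `ζ ⊗ ξ`.
  have hinter : ∀ y ∈ vnTensor A B, y * q = q * y → ∃ θ ∈ vnTensor A B,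
      θ * E = V * y * star V ∧ y * D = D * θ := by
    intro y hy hyq
    obtain ⟨θ, hθ, hθE⟩ := h.exists_compression hA hM hBM (vnTensor_le_basicConstruction (hBM' hy))
    refine ⟨θ, hθ, hθE, sub_eq_zero.1 (vnTensor_eq_zero hM (sub_mem (mul_mem (hBM' hy) hDM)
      (mul_mem hDM (hBM' hθ))) fun ζ => ?_)⟩
    rw [sub_apply, mul_apply_eq_comp, mul_apply_eq_comp, hDV, hDb θ hθ, ← mul_jones_apply hθE,
      ← mul_apply_eq_comp (star V), h.intertwine hy hyq, mul_apply_eq_comp, sub_self]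
  have hcornercomm : ∀ b ∈ vnTensor A B, q * b * q ∈ vnTensor A B ∧
      q * b * q * q = q * (q * b * q) := by
    intro b hb
    refine ⟨mul_mem (mul_mem hqB hb) hqB, ?_⟩
    rw [mul_assoc, hq.isIdempotentElem.eq, ← mul_assoc, ← mul_assoc, hq.isIdempotentElem.eq]
  -- For `y` in the corner, `y D = D θ` together with the adjoint of the relation for `y*` gives `y
  -- D D* = D θ D* = D D* y`.
  have hDDB : D * star D ∈ vnTensor A B := by
    refine mem_vnTensor_of_commute_corner hA hBM hB hq hqB (mul_mem hDM (star_mem hDM)) ?_ ?_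
    · rw [← mul_assoc, hqD, mul_assoc, hDq]
    · intro b hb
      obtain ⟨hy, hyq⟩ := hcornercomm b hb
      generalize q * b * q = y at hy hyq ⊢
      have hyq' : star y * q = q * star y := by
        have h1 := congrArg star hyq
        rw [star_mul_eq, star_mul_eq, hq.isSelfAdjoint.star_eq] at h1
        exact h1.symm
      obtain ⟨θ, hθ, hθE, hyD⟩ := hinter y hy hyq
      obtain ⟨θ', hθ', hθE', hyD'⟩ := hinter (star y) (star_mem hy) hyq'
      have hθθ : star θ' = θ := by
        refine eq_of_mul_jones_eq hM hBM (star_mem hθ') hθ ?_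
        have h1 := congrArg star hθE'
        rw [star_mul_eq, star_mul_eq, star_mul_eq, star_star, star_star, hE, jones_star_eq,
          ← vnTensor_jones_commute (star_mem hθ'), ← mul_assoc] at h1
        exact h1.trans hθE.symm
      have h2 := congrArg star hyD'
      rw [star_mul_eq, star_mul_eq, hθθ, star_star] at h2
      rw [← mul_assoc, hyD, mul_assoc, mul_assoc, h2]
  refine ⟨star D, ⟨star_mem hDM, ?_, ?_, ?_⟩, hVw⟩
  · rw [star_star, hDD]
    have h1 := congrArg star hDg
    rw [star_mul_eq, hgsa] at h1
    exact h1
  · intro b hb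
    obtain ⟨hy, hyq⟩ := hcornercomm b hb
    obtain ⟨θ, hθ, -, hyD⟩ := hinter _ hy hyq
    -- Since `q D = D`, only the corner part `q b q` of `b` matters, and the intertwining relation
    -- moves it past `D`.
    have h1 : star D * b * star (star D) = g * θ := by
      calc star D * b * star (star D) = star D * q * b * (q * D) := by rw [hqD, hDq, star_star]
        _ = star D * (q * b * q * D) := by simp only [mul_assoc]
        _ = g * θ := by rw [hyD, ← mul_assoc, hDD]
    rw [h1]
    exact mul_mem hgB hθ
  · rw [star_star]
    exact hDDB

end Intertwiner

end GroupoidNormalizers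

/-! ### Proof of the theorem -/

theorem theorem4p1 {K H : Type*}
    [NormedAddCommGroup K] [InnerProductSpace ℂ K] [CompleteSpace K]
    [NormedAddCommGroup H] [InnerProductSpace ℂ H] [CompleteSpace H]
    (A : VonNeumannAlgebra K) (hA : ∀ x ∈ A, ∀ y ∈ A, x * y = y * x)
    (Φ : (K →L[ℂ] K) → ENNReal) (hΦ : IsFNSWeight A Φ)
    (M B : VonNeumannAlgebra H) (ξ : H) (hM : IsStandardTracial M ξ)
    (hBM : B ≤ M) (hB : relCommutant B M ≤ B)
    (q : HilbertTensor K H →L[ℂ] HilbertTensor K H)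
    (hq : IsStarProjection q) (hqAB : q ∈ vnTensor A B)
    (P : HilbertTensor K H →L[ℂ] HilbertTensor K H)
    (hP : IsStarProjection P) (hP0 : P ≠ 0)
    (hPmem : ∃ T ∈ vnTensor A (relCommutant B (basicConstruction M B ξ)), P = T * q)
    (hPe : SubEquivalent (vnTensor A (basicConstruction M B ξ)) P
      (opTensor 1 (jonesProjection B ξ)))
    (hPtr : ∀ r ∈ centerOf (corner q (vnTensor A B)), IsStarProjection r →
      weightTensor A Φ (basicConstruction M B ξ) (canonicalTrace M B ξ) (P * r) ≤
        weightTensor A Φ M (vectorWeight ξ) (q * r)) :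
    ∃ v ∈ intertwiners (vnTensor A M) (vnTensor A B),
      P = star v * opTensor 1 (jonesProjection B ξ) * v := by
  obtain ⟨T, hT, hPT⟩ := hPmem
  obtain ⟨V, hV, hVP, hVE⟩ := hPe
  set E : HilbertTensor K H →L[ℂ] HilbertTensor K H := opTensor 1 (jonesProjection B ξ) with hE
  have hEp : IsStarProjection E := opTensor_jones_isStarProjection
  -- `T` commutes with `A ⊗ B`: the first factor is abelian, the second lies in `B'`. Hence `P = T
  -- q` commutes with every element of `A ⊗ B` that commutes with `q`.
  have hTcomm : ∀ y ∈ vnTensor A B, T * y = y * T := fun y hy =>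
    vnTensor_commute hy fun a ha b hb => vnTensor_commute_opTensor hT
      (mem_commutant_of_abelian hA ha) (VonNeumannAlgebra.mem_commutant_iff.2 fun g hg =>
        (VonNeumannAlgebra.mem_commutant_iff.1 hg.1 b hb).symm)
  have hPcomm : ∀ y ∈ vnTensor A B, y * q = q * y → y * P = P * y := by
    intro y hy hyq
    rw [hPT, ← mul_assoc, ← hTcomm y hy, mul_assoc, hyq, mul_assoc]
  have hVPV : V * P = V := mul_eq_self_of_star_mul_eq hP hVP
  have hEV : E * V = V := mul_eq_self_of_mul_star_le hEp hVE
  have hPq : P * q = P := by rw [hPT, mul_assoc, hq.isIdempotentElem.eq]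
  have himp : IsImplementer A M B ξ q V :=
    { mem := hV
      jones_mul := hEV
      mul_corner := by rw [← hVPV, mul_assoc, hPq]
      mul_star_mul := by rw [mul_assoc, hVP, hVPV]
      commute := fun y hy hyq => by rw [hVP]; exact hPcomm y hy hyq }
  obtain ⟨w, hw, hVw⟩ := himp.exists_intertwiner hA hM hBM hB hq hqAB fun ζ y hy =>
    himp.norm_apply_le hA hM hBM hB hq hqAB (fun r hr hrp =>
      norm_sq_le_of_weightTensor_le hA hΦ hM hBM hV hEV (fun r hr hrp => by
        have hqr : q * r = r ∧ r * q = r := by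
          obtain ⟨⟨x, hx, rfl⟩, -⟩ := hr
          exact ⟨by rw [← mul_assoc, ← mul_assoc, hq.isIdempotentElem.eq],
            by rw [mul_assoc, hq.isIdempotentElem.eq]⟩
        have hrB : r ∈ vnTensor A B := by
          obtain ⟨⟨x, hx, rfl⟩, -⟩ := hr
          exact mul_mem (mul_mem hqAB hx) hqAB
        have h1 := hPtr r hr hrp
        -- This turns the hypothesis on `P r` into one on `W* W` for `W = V r`; `r` passes through
        -- `P` because it commutes with `q`.
        have h2 : star (V * r) * (V * r) = P * r := by
          rw [star_mul_eq, hrp.isSelfAdjoint.star_eq, mul_assoc, ← mul_assoc (star V), hVP,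
            ← mul_assoc, hPcomm r hrB (hqr.2.trans hqr.1.symm), mul_assoc,
            hrp.isIdempotentElem.eq]
        rw [h2]
        rwa [hqr.1] at h1) hqAB hr hrp ζ) hy
  refine ⟨w, hw, ?_⟩
  rw [← hVP, hVw, star_mul_eq, hEp.isSelfAdjoint.star_eq, mul_assoc, ← mul_assoc E,
    hEp.isIdempotentElem.eq, mul_assoc]
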